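/- **Setting.** Let $p\ge 3$, $d,k\ge 1$ be integers, $0<\lambda_1\le 1$ and $\delta\in(0,1)$. Actions are $p$-tuples $a=(a(1),\dots,a(p))$ of vectors in the closed Euclidean unit ball of $\mathbb R^d$. The expected reward is $$f(a)=\sum_{j=1}^k\lambda_j\prod_{s=1}^p\langle v_j(s),a(s)\rangle ,$$ where for each slot $s$ the vectors $v_1(s),\dots,v_k(s)$ are orthonormal and $\lambda_1\ge|\lambda_2|\ge\dots\ge|\lambda_k|$; put $f^*=\sup_a f(a)$. Playing $a_t$ at time $t$ returns $f(a_t)+\eta_t$, where $\eta_t$ is conditionally zero-mean $1$-sub-Gaussian given everything before it (including the learner's internal randomness, which consists of fresh i.i.d. standard Gaussian vectors). **Algorithm.** *Phased elimination with alternating noisy power iteration* has as tuning parameters integers $L,S$ and, for each stage $s$, integers $I_s,n_s$ and reals $m_s>0$, $\zeta_s\in(0,1]$. It starts with $L$ candidates whose $p$ slots are independent and uniform on the unit sphere. In stage $s=1,\dots,S$ every candidate $\tilde a$ is updated by $I_s$ sweeps over the slots $j=1,\dots,p$. In slot $j$, for $i=1,\dots,n_s$, draw $z_i\sim N(0,I_d/m_s)$,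 play $\tilde a$ with slot $j$ replaced by $(1-\zeta_s)\tilde a(j)+\zeta_s z_i$ (projected to the unit ball), and receive $r_i$; then set $y=\frac1{n_s}\sum_i r_iz_i$ and $\tilde a(j)\leftarrow y/\|y\|$. After the sweeps, $\tilde a$ is played $n_s$ more times, and is kept if and only if its average observed reward is at least $\lambda_1(1-p2^{-s})$. The output is the list of surviving candidates. **Theorem.** There are universal constants $C>0$ and $c\in\mathbb N$ such that for all $p,d,k,\lambda_1,\delta$ as above the following hold. 1. For every $\varepsilon\in(0,1)$ there are parameters, depending only on $p,d,k,\lambda_1,\delta,\varepsilon$, such that for every $f$ and every noise process as above, with probability at least $1-\delta$ the output contains an $\varepsilon$-optimal action, i.e. an $a$ with $f(a)\ge f^*-\varepsilon$. Moreover, always, the total number of actions played is at most $$C\,p^c\Bigl(1+\log\tfrac{d}{\varepsilon\delta}\Bigr)^c\;(2k)^p\log^p(p/\delta)\,d^p\,\lambda_1^{-1}\varepsilon^{-1},$$ and the number of candidates in the output is at most $C\,p^c\bigl(1+\log\frac{d}{\varepsilon\delta}\bigr)^c(2k)^p\log^p(p/\delta)$. 2. For every horizon $T\in\mathbb N$ there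 are parameters and a number $b>0$, depending only on $p,d,k,\lambda_1,\delta,T$, such that for every $f$ and every noise process as above, the algorithm followed by UCB on the surviving candidates (each is played once; then each round plays a candidate maximizing its empirical mean, over the rewards observed in the UCB phase, plus $\sqrt{b/N}$, where $N$ is the number of times it has been played in the UCB phase; if no candidate has survived, the zero action is played) satisfies, with probability at least $1-\delta$, $$\sum_{t=1}^T\bigl(f^*-f(a_t)\bigr)\le C\,p^c\Bigl(1+\log\tfrac{dT}{\delta}\Bigr)^c\sqrt{(2k)^p\log^p(p/\delta)\,d^p\,T}$$ (for $T\geq 1$; for $T=0$ the left side is $0$). For fixed $p$ this is $\tilde O(\sqrt{k^pd^pT})$. -/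

import Mathlib

open MeasureTheory ProbabilityTheory

noncomputable section

namespace TensorBandit

/-! ### Actions and reward functions -/

/-- Euclidean space `ℝ^d`. -/
abbrev Vec (d : ℕ) : Type := EuclideanSpace ℝ (Fin d)

/-- The closed Euclidean unit ball of `ℝ^d`. -/
abbrev UnitBall (d : ℕ) : Type := {x : Vec d // ‖x‖ ≤ 1}

/-- An action: `p` vectors, each in the unit ball of `ℝ^d`. -/
abbrev Action (d p : ℕ) : Type := Fin p → UnitBall d

/-- An orthogonal tensor `∑ⱼ λⱼ vⱼ(1) ⊗ ⋯ ⊗ vⱼ(p)` with `k` terms and leading coefficient `lam`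
(the coefficient of index `0`): in every slot `s` the vectors `vⱼ(s)` are orthonormal, and the
coefficients are ordered by absolute value. -/
structure OrthTensor (d p k : ℕ) [NeZero k] (lam : ℝ) where
  coeff : Fin k → ℝ
  vec : Fin p → Fin k → Vec d
  orthonormal_vec : ∀ s, Orthonormal ℝ (vec s)
  coeff_zero : coeff 0 = lam
  abs_coeff_antitone : ∀ i j, i ≤ j → |coeff j| ≤ |coeff i|

/-- The expected reward `f(a) = ∑ⱼ λⱼ ∏ₛ ⟨vⱼ(s), a(s)⟩`. -/
def OrthTensor.reward {d p k : ℕ} [NeZero k] {lam : ℝ} (T : OrthTensor d p k lam)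
    (a : Action d p) : ℝ :=
  ∑ j, T.coeff j * ∏ s, inner ℝ (T.vec s j) (a s : Vec d)

/-- The optimal expected reward `f* = sup_a f(a)` over the whole action set. -/
def optReward {d p : ℕ} (f : Action d p → ℝ) : ℝ := ⨆ a, f a

/-! ### Interactive randomized algorithms -/

/-- A randomized algorithm interacting with the bandit: it stops with a result, or draws a fresh
standard Gaussian vector of `ℝ^d`, or plays an action and receives a noisy reward. -/
inductive Prog (d p : ℕ) (α : Type) : Type
  | ret (a : α) : Prog d p α
  | draw (next : Vec d → Prog d p α) : Prog d p α
  | play (a : Action d p) (next : ℝ → Prog d p α) : Prog d p α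

namespace Prog

variable {d p : ℕ} {α β : Type}

/-- Sequential composition. -/
def bind : Prog d p α → (α → Prog d p β) → Prog d p β
  | ret a, g => g a
  | draw next, g => draw fun z => (next z).bind g
  | play a next, g => play a fun r => (next r).bind g

/-- Execution. The `i`-th draw returns `ξ i`, and the action `a` played at time `t` (times start
at `0`) returns the reward `f a + η t`. The result is the output together with the list of
actions played, in order; `i` and `t` count the draws and the plays made so far. -/
def runFrom (f : Action d p → ℝ) (ξ : ℕ → Vec d) (η : ℕ → ℝ) :
    Prog d p α → ℕ → ℕ → α × List (Action d p)
  | ret a, _, _ => (a, [])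
  | draw next, i, t => runFrom f ξ η (next (ξ i)) (i + 1) t
  | play a next, i, t =>
      let out := runFrom f ξ η (next (f a + η t)) i (t + 1)
      (out.1, a :: out.2)

/-- The output of an execution. -/
def output (P : Prog d p α) (f : Action d p → ℝ) (ξ : ℕ → Vec d) (η : ℕ → ℝ) : α :=
  (runFrom f ξ η P 0 0).1

/-- The list of all actions played during an execution, in order. -/
def actions (P : Prog d p α) (f : Action d p → ℝ) (ξ : ℕ → Vec d) (η : ℕ → ℝ) :
    List (Action d p) :=
  (runFrom f ξ η P 0 0).2

/-- Run `P` independently `n` times and collect the results. -/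
def replicate (P : Prog d p α) : ℕ → Prog d p (List α)
  | 0 => ret []
  | n + 1 => P.bind fun x => (replicate P n).bind fun l => ret (x :: l)

/-- Run `P` independently `n` times and average the results. -/
def average (P : Prog d p (Vec d)) (n : ℕ) : Prog d p (Vec d) :=
  (P.replicate n).bind fun l => ret ((n : ℝ)⁻¹ • l.sum)

/-- `for b in l do x ← step b x`. -/
def forList (step : β → α → Prog d p α) : List β → α → Prog d p α
  | [], x => ret x
  | b :: l, x => (step b x).bind fun y => forList step l y

end Prog

/-! ### Phased elimination with alternating noisy power iteration -/

section Algorithm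

variable {d p : ℕ}

/-- `x / ‖x‖` (and `0` for `x = 0`), as a point of the unit ball. -/
def normalize (x : Vec d) : UnitBall d :=
  ⟨‖x‖⁻¹ • x, by
    rw [norm_smul, norm_inv, norm_norm]
    exact inv_mul_le_one⟩

/-- The nearest point of the unit ball; keeps the tentative actions inside the action set. -/
def clip (x : Vec d) : UnitBall d :=
  ⟨(max 1 ‖x‖)⁻¹ • x, by
    have h : 0 < max 1 ‖x‖ := lt_of_lt_of_le one_pos (le_max_left _ _)
    rw [norm_smul, norm_inv, Real.norm_of_nonneg h.le, inv_mul_le_iff₀ h, mul_one]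
    exact le_max_right _ _⟩

/-- Tuning parameters: the number of random initial actions, the number of stages and, for each
stage `s`, the number of sweeps of the power iteration, the sample size `nₛ`, the inverse variance
`mₛ` of the Gaussian perturbations and their weight `ζₛ` in the tentative action. -/
structure Params where
  inits : ℕ
  stages : ℕ
  sweeps : ℕ → ℕ
  samples : ℕ → ℕ
  invVar : ℕ → ℝ
  weight : ℕ → ℝ
  invVar_pos : ∀ s, 0 < invVar s
  weight_pos : ∀ s, 0 < weight s
  weight_le_one : ∀ s, weight s ≤ 1

/-- A random action whose slots are independent and uniform on the unit sphere (sampled as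
normalized standard Gaussian vectors). -/
def randomAction : Prog d p (Action d p) :=
  Prog.forList (fun (j : Fin p) a => .draw fun z => .ret (Function.update a j (normalize z)))
    (List.finRange p) (fun _ => normalize 0)

/-- One sample of the estimator for slot `j`: draw `z ∼ N(0, I/m)`, play `a` with slot `j` replaced
by `(1 - ζ) a(j) + ζ z`, observe the reward `r`, and return `r z`. -/
def slotSample (m ζ : ℝ) (a : Action d p) (j : Fin p) : Prog d p (Vec d) :=
  .draw fun g =>
    let z : Vec d := (Real.sqrt m)⁻¹ • g
    .play (Function.update a j (clip ((1 - ζ) • (a j : Vec d) + ζ • z))) fun r => .ret (r • z)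

/-- The noisy power update of slot `j`: `a(j) ← y / ‖y‖`, `y` the average of `n` samples. -/
def slotUpdate (n : ℕ) (m ζ : ℝ) (j : Fin p) (a : Action d p) : Prog d p (Action d p) :=
  ((slotSample m ζ a j).average n).bind fun y => .ret (Function.update a j (normalize y))

/-- The alternating power iteration of stage `s`: sweeps over the slots `1, …, p` in order. -/
def powerIteration (θ : Params) (s : ℕ) (a : Action d p) : Prog d p (Action d p) :=
  Prog.forList
    (fun _ b => Prog.forList (slotUpdate (θ.samples s) (θ.invVar s) (θ.weight s))
      (List.finRange p) b)
    (List.range (θ.sweeps s)) a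

/-- The mean of `n` noisy rewards of the action `a`. -/
def meanReward (n : ℕ) (a : Action d p) : Prog d p ℝ :=
  (Prog.replicate (.play a fun r => .ret r) n).bind fun l => .ret ((n : ℝ)⁻¹ * l.sum)

/-- Stage `s`: improve every candidate by alternating power iteration, and keep those whose
estimated reward is at least `lam (1 - p 2⁻ˢ)`. -/
def stage (lam : ℝ) (θ : Params) (s : ℕ) : List (Action d p) → Prog d p (List (Action d p))
  | [] => .ret []
  | a :: l =>
      (powerIteration θ s a).bind fun b =>
      (meanReward (θ.samples s) b).bind fun r =>
      (stage lam θ s l).bind fun rest =>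
      .ret (if lam * (1 - p * (1 / 2) ^ s) ≤ r then b :: rest else rest)

/-- Phased elimination with alternating noisy power iteration: start with random candidates and
run the stages `1, …, S`. The output is the list of surviving candidates. -/
def phasedElimination (d p : ℕ) (lam : ℝ) (θ : Params) : Prog d p (List (Action d p)) :=
  (Prog.replicate randomAction θ.inits).bind
    (Prog.forList (fun i l => stage lam θ (i + 1) l) (List.range θ.stages))

/-- UCB rounds over a finite list of arms, where arm `i` has been played `N i` times so far with
total reward `R i`: each round plays an arm maximizing `R i / N i + √(b / N i)`.
(If the list is empty, the zero action is played.) -/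
def ucbRounds (arms : List (Action d p)) (b : ℝ) :
    ℕ → (Fin arms.length → ℕ) → (Fin arms.length → ℝ) → Prog d p Unit
  | 0, _, _ => .ret ()
  | n + 1, N, R =>
    match (List.finRange arms.length).argmax (fun i => R i / N i + Real.sqrt (b / N i)) with
    | none => .play (fun _ => normalize 0) fun _ => ucbRounds arms b n N R
    | some i => .play (arms.get i) fun r =>
        ucbRounds arms b n (Function.update N i (N i + 1)) (Function.update R i (R i + r))

/-- UCB: play every arm once, then perform `n` UCB rounds. -/
def ucb (arms : List (Action d p)) (b : ℝ) (n : ℕ) : Prog d p Unit :=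
  (Prog.forList (fun i R => .play (arms.get i) fun r => .ret (Function.update R i r))
    (List.finRange arms.length) (fun _ => 0)).bind
    fun R => ucbRounds arms b n (fun _ => 1) R

/-- The bandit algorithm: phased elimination, then UCB on the surviving candidates. The number of
UCB rounds is such that at least `T` actions are played. -/
def banditAlg (d p : ℕ) (lam : ℝ) (θ : Params) (b : ℝ) (T : ℕ) : Prog d p Unit :=
  (phasedElimination d p lam θ).bind fun arms => ucb arms b T

end Algorithm

/-- The cumulative regret of the first `T` actions. -/
def regret {d p : ℕ} {α : Type} (P : Prog d p α) (f : Action d p → ℝ) (ξ : ℕ → Vec d)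
    (η : ℕ → ℝ) (T : ℕ) : ℝ :=
  (((P.actions f ξ η).take T).map fun a => optReward f - f a).sum

/-! ### The randomness -/

/-- The σ-algebra of everything before the noise of time `t`: the learner's own random draws and
the noise at the times before `t`. -/
abbrev history {Ω : Type*} {d : ℕ} (ξ : ℕ → Ω → Vec d) (η : ℕ → Ω → ℝ) (t : ℕ) : MeasurableSpace Ω :=
  (⨆ i, MeasurableSpace.comap (ξ i) inferInstance) ⊔
    ⨆ i, ⨆ _ : i < t, MeasurableSpace.comap (η i) inferInstance

theorem history_le {Ω : Type*} [mΩ : MeasurableSpace Ω] {d : ℕ} {ξ : ℕ → Ω → Vec d}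
    {η : ℕ → Ω → ℝ} (hξ : ∀ i, Measurable (ξ i)) (hη : ∀ t, Measurable (η t)) (t : ℕ) :
    history ξ η t ≤ mΩ :=
  sup_le (iSup_le fun i => (hξ i).comap_le) (iSup₂_le fun i _ => (hη i).comap_le)

/-- The learner's draws `ξ` are i.i.d. standard Gaussian vectors, and the noise `η t` is
conditionally zero-mean `1`-sub-Gaussian given the history before it. (As the learner's draws are
fresh, they may be thought of as made in advance. The sub-Gaussian bound on the conditional moment
generating function forces the conditional mean to vanish. The law of `η t` given the history, and
hence given the action played, is otherwise arbitrary.) -/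
structure IsBanditRandomness {Ω : Type*} [MeasurableSpace Ω] [StandardBorelSpace Ω]
    (P : Measure Ω) [IsProbabilityMeasure P] {d : ℕ} (ξ : ℕ → Ω → Vec d) (η : ℕ → Ω → ℝ) :
    Prop where
  measurable_draw : ∀ i, Measurable (ξ i)
  measurable_noise : ∀ t, Measurable (η t)
  indep_draw : iIndepFun ξ P
  law_draw : ∀ i, P.map (ξ i) = stdGaussian (Vec d)
  subgaussian_noise : ∀ t, HasCondSubgaussianMGF (history ξ η t)
    (history_le measurable_draw measurable_noise t) (η t) 1 P

end TensorBandit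

end

open TensorBandit

/-! A single stage of elimination already suffices. At stage `1` the threshold `lam * (1 - p / 2)`
is at most `-lam / 2`, because `p ≥ 3`, whereas a power update never leaves the reward much below
zero: the new slot is almost aligned with the gradient of the reward in that slot
(`neg_le_basisReward_update`). So on the good event no candidate is eliminated, the output has a
deterministic length, and it only remains to show that one candidate converges to the leading
component.

The perturbation weight is `ζ = 1`, so an update plays the bare Gaussian vector `z`. While clipping
is inactive, the observed mean is linear in `z`, and `m y` estimates the gradient. In the
orthonormal bases of the tensor the gradient has `ℓ¹` norm at most `lam ≤ 1`, as at least two slots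
remain besides the updated one. Entrywise closeness of the empirical covariance to the identity
therefore controls the error simultaneously for all actions (`abs_slotMean_sub_slotGrad_le`), and
the adaptivity of the iteration costs nothing: every update consumes exactly `n` draws and `n`
plays, so a union bound over deterministic offsets covers all blocks (`exists_blockGood`).

Let `i₀` be the leading index and suppose that in every slot the other relevant coordinates are at
most `r` times that of `i₀`, with `r (1 + γ) ≤ 1`. A noiseless update replaces `r` by at most `r ^
(p - 1) ≤ r ^ 2`, and with small noise the ratio still shrinks by the factor `1 - γ / 4`
(`dominates_normalize`). Since the reward is within `2 p lam d r ^ 2` of `lam`, a final ratio of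
order `√(ε / (p lam d))` is enough. The error must be small relative to the signal `lam d ^ (-(p -
1) / 2)` at the start and relative to `r lam` at the end. The two demands give sample sizes of order
`d ^ p / lam ^ 2` and `d ^ 2 2 ^ p / (lam ε)`, up to logarithmic factors, and both fit into `(640 d)
^ p / (lam ε)`.

A Gaussian vector has its coordinate `i₀` positive and dominant among `k` coordinates with
probability of order `1 / k`, even with a margin `γ` of inverse logarithmic size
(`stdGaussian_dominant_ge`). Hence about `(60 k) ^ p log (4 / δ)` independent candidates contain one
that is good in all `p` slots. The excess exponential factors `30 ^ p` and `19200 ^ p` are absorbed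
by `log (p / δ) ^ p` at the price of a huge universal constant (`exists_pow_le_mul_log_pow`).

For the regret put `s = √(A n)`, where `A = (2 k) ^ p log (p / δ) ^ p d ^ p`. If `s ≥ lam n`, the
trivial bound `2 lam n` is enough. Otherwise elimination is run at accuracy `s / n`; its plays cost
about `lam · A / (lam s / n) = s`, the inaccuracy of the best arm costs `n · s / n = s`, and UCB
over the surviving arms costs `√(A n)` up to logarithms. The arms are random, but are determined by
the history before the UCB phase, so the exponential supermartingale for predictable weights
(`lintegral_exp_sum_le_one`) applies to the noise of each arm. -/

noncomputable section

namespace TensorBandit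

/-! ### Executions with explicit counters -/

namespace Prog

variable {d p : ℕ} {α β : Type}

/-- `Runs f ξ η P i t x as i' t'`: executed from the counters `i` (draws) and `t` (plays), the
program `P` returns `x`, plays the actions `as` and ends with the counters `i'` and `t'`. -/
inductive Runs (f : Action d p → ℝ) (ξ : ℕ → Vec d) (η : ℕ → ℝ) :
    Prog d p α → ℕ → ℕ → α → List (Action d p) → ℕ → ℕ → Prop
  | ret (a : α) (i t : ℕ) : Runs f ξ η (.ret a) i t a [] i t
  | draw {next : Vec d → Prog d p α} {i t : ℕ} {x : α} {as : List (Action d p)} {i' t' : ℕ}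
      (h : Runs f ξ η (next (ξ i)) (i + 1) t x as i' t') :
      Runs f ξ η (.draw next) i t x as i' t'
  | play {a : Action d p} {next : ℝ → Prog d p α} {i t : ℕ} {x : α} {as : List (Action d p)}
      {i' t' : ℕ} (h : Runs f ξ η (next (f a + η t)) i (t + 1) x as i' t') :
      Runs f ξ η (.play a next) i t x (a :: as) i' t'

variable {f : Action d p → ℝ} {ξ : ℕ → Vec d} {η : ℕ → ℝ}

theorem Runs.runFrom_eq {P : Prog d p α} {i t : ℕ} {x : α} {as : List (Action d p)} {i' t' : ℕ}
    (h : Runs f ξ η P i t x as i' t') : runFrom f ξ η P i t = (x, as) := by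
  induction h with
  | ret => rfl
  | draw _ ih => exact ih
  | play _ ih => simp only [runFrom, ih]

theorem Runs.length_add {P : Prog d p α} {i t : ℕ} {x : α} {as : List (Action d p)} {i' t' : ℕ}
    (h : Runs f ξ η P i t x as i' t') : as.length + t = t' := by
  induction h with
  | ret => simp
  | draw _ ih => exact ih
  | play _ ih => simp only [List.length_cons]; omega

theorem Runs.bind {P : Prog d p α} {g : α → Prog d p β} {i t : ℕ} {x : α}
    {as : List (Action d p)} {i' t' : ℕ} (h : Runs f ξ η P i t x as i' t') {y : β}
    {bs : List (Action d p)} {i'' t'' : ℕ} (h' : Runs f ξ η (g x) i' t' y bs i'' t'') :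
    Runs f ξ η (P.bind g) i t y (as ++ bs) i'' t'' := by
  induction h with
  | ret => exact h'
  | draw _ ih => exact .draw (ih h')
  | play _ ih => exact .play (ih h')

/-- `Ends f ξ η P i t x i' t'`: executed from the counters `i` and `t`, the program `P` returns `x`
and ends with the counters `i'` and `t'`. -/
def Ends (f : Action d p → ℝ) (ξ : ℕ → Vec d) (η : ℕ → ℝ) (P : Prog d p α) (i t : ℕ) (x : α)
    (i' t' : ℕ) : Prop :=
  ∃ as, Runs f ξ η P i t x as i' t'

theorem Ends.ret (a : α) (i t : ℕ) : Ends f ξ η (.ret a) i t a i t := ⟨_, .ret a i t⟩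

theorem Ends.congr {P : Prog d p α} {i t : ℕ} {x y : α} {i' t' i'' t'' : ℕ}
    (h : Ends f ξ η P i t x i' t') (hx : x = y) (hi : i' = i'') (ht : t' = t'') :
    Ends f ξ η P i t y i'' t'' := by
  subst hx hi ht
  exact h

theorem Ends.draw {next : Vec d → Prog d p α} {i t : ℕ} {x : α} {i' t' : ℕ}
    (h : Ends f ξ η (next (ξ i)) (i + 1) t x i' t') : Ends f ξ η (.draw next) i t x i' t' :=
  ⟨_, .draw h.choose_spec⟩

theorem Ends.play {a : Action d p} {next : ℝ → Prog d p α} {i t : ℕ} {x : α} {i' t' : ℕ}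
    (h : Ends f ξ η (next (f a + η t)) i (t + 1) x i' t') :
    Ends f ξ η (.play a next) i t x i' t' :=
  ⟨_, .play h.choose_spec⟩

theorem Ends.bind {P : Prog d p α} {g : α → Prog d p β} {i t : ℕ} {x : α} {i' t' : ℕ}
    (h : Ends f ξ η P i t x i' t') {y : β} {i'' t'' : ℕ}
    (h' : Ends f ξ η (g x) i' t' y i'' t'') : Ends f ξ η (P.bind g) i t y i'' t'' :=
  ⟨_, h.choose_spec.bind h'.choose_spec⟩

/-- The cost `D`, `N` of a run does not depend on its outcome, so the `u`-th run starts at counters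
affine in `u`. This determinism is what later permits union bounds over fixed positions in the
random sequences. -/
theorem Ends.replicate {P : Prog d p α} {x : ℕ → α} {D N : ℕ} (n : ℕ) {i t : ℕ}
    (h : ∀ u, Ends f ξ η P (i + u * D) (t + u * N) (x u) (i + (u + 1) * D) (t + (u + 1) * N)) :
    Ends f ξ η (P.replicate n) i t ((List.range n).map x) (i + n * D) (t + n * N) := by
  induction n generalizing i t x with
  | zero => exact (Ends.ret _ _ _).congr rfl (by simp) (by simp)
  | succ n ih =>
    have h0 := h 0
    simp only [Nat.zero_mul, add_zero, Nat.zero_add, Nat.one_mul] at h0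
    have h1 := ih (x := fun u => x (u + 1)) (i := i + D) (t := t + N) fun u => by
      have := h (u + 1)
      convert this using 1 <;> ring
    rw [List.range_succ_eq_map, List.map_cons, List.map_map]
    refine h0.bind (h1.bind ?_)
    exact (Ends.ret _ _ _).congr rfl (by ring) (by ring)

/-- The state after a loop each of whose passes uses `D` draws and `N` plays; `F b i t x` is the
state after the pass `b` started from the state `x` and the counters `i`, `t`. -/
def iter (F : β → ℕ → ℕ → α → α) (D N : ℕ) : List β → ℕ → ℕ → α → α
  | [], _, _, x => x
  | b :: l, i, t, x => iter F D N l (i + D) (t + N) (F b i t x)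

theorem Ends.forList {step : β → α → Prog d p α} {F : β → ℕ → ℕ → α → α} {D N : ℕ}
    (h : ∀ b x i t, Ends f ξ η (step b x) i t (F b i t x) (i + D) (t + N)) (l : List β) (x : α)
    (i t : ℕ) :
    Ends f ξ η (forList step l x) i t (iter F D N l i t x) (i + l.length * D)
      (t + l.length * N) := by
  induction l generalizing x i t with
  | nil => exact (Ends.ret _ _ _).congr rfl (by simp) (by simp)
  | cons b l ih =>
    refine (h b x i t).bind ?_
    exact (ih (F b i t x) (i + D) (t + N)).congr rfl (by rw [List.length_cons]; ring)
      (by rw [List.length_cons]; ring)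

/-- A loop that overwrites the slots in order. -/
theorem iter_update {q : ℕ} (g : Fin q → ℕ → ℕ → α) (D N : ℕ) (i t : ℕ) (a : Fin q → α) :
    iter (fun j i t a => Function.update a j (g j i t)) D N (List.finRange q) i t a =
      fun j => g j (i + j * D) (t + j * N) := by
  -- Generalized to a loop over a list of consecutive slots beginning at slot `r`, so that the
  -- induction can remove the first slot.
  have key : ∀ (r : ℕ) (l : List (Fin q)), l.map Fin.val = List.range' r l.length →
      ∀ (i t : ℕ) (a : Fin q → α), iter (fun j i t a => Function.update a j (g j i t)) D N l i t a =
        fun j : Fin q => if r ≤ j.val ∧ j.val < r + l.length then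
          g j (i + (j.val - r) * D) (t + (j.val - r) * N) else a j := by
    intro r l
    induction l generalizing r with
    | nil =>
      intro _ i t a
      funext j
      simp [iter]
    | cons b l ih =>
      intro hl i t a
      rw [List.map_cons, List.length_cons, List.range'_succ, List.cons.injEq] at hl
      rw [iter, ih (r + 1) hl.2]
      funext j
      simp only [List.length_cons, Function.update_apply]
      by_cases hj : j = b
      · subst hj
        rw [if_neg (by omega), if_pos rfl, if_pos (by omega), hl.1]
        simp
      · have hj' : j.val ≠ r := fun h => hj (Fin.ext (h.trans hl.1.symm))
        rw [if_neg hj]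
        by_cases h2 : r + 1 ≤ j.val ∧ j.val < r + 1 + l.length
        · rw [if_pos h2, if_pos (by omega)]
          have e : j.val - r = j.val - (r + 1) + 1 := by omega
          rw [e, Nat.add_mul, Nat.add_mul, Nat.one_mul, Nat.one_mul]
          congr 1 <;> ring
        · rw [if_neg h2, if_neg (by omega)]
  rw [key 0 _ (by simp [List.range_eq_range'])]
  funext j
  simp

end Prog

open Prog

/-! ### Closed forms of the outcomes of the algorithm -/

section Outcome

variable {d p : ℕ} (f : Action d p → ℝ) (ξ : ℕ → Vec d) (η : ℕ → ℝ)

/-- The action played in a sample of slot `j` of `a` with perturbation `z`. -/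
def tentative (ζ : ℝ) (a : Action d p) (j : Fin p) (z : Vec d) : Action d p :=
  Function.update a j (clip ((1 - ζ) • (a j : Vec d) + ζ • z))

/-- The estimator `y` of an update of slot `j` from the counters `i`, `t`. -/
def slotMean (n : ℕ) (m ζ : ℝ) (j : Fin p) (i t : ℕ) (a : Action d p) : Vec d :=
  (n : ℝ)⁻¹ • ((List.range n).map fun u =>
    (f (tentative ζ a j ((Real.sqrt m)⁻¹ • ξ (i + u))) + η (t + u)) •
      ((Real.sqrt m)⁻¹ • ξ (i + u))).sum

/-- The outcome of an update of slot `j` from the counters `i`, `t`. -/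
def slotOut (n : ℕ) (m ζ : ℝ) (j : Fin p) (i t : ℕ) (a : Action d p) : Action d p :=
  Function.update a j (normalize (slotMean f ξ η n m ζ j i t a))

/-- The outcome of one sweep over all slots. -/
def sweepOut (n : ℕ) (m ζ : ℝ) (i t : ℕ) (a : Action d p) : Action d p :=
  iter (slotOut f ξ η n m ζ) n n (List.finRange p) i t a

/-- The outcome of `I` sweeps. -/
def powerOut (n : ℕ) (m ζ : ℝ) (I : ℕ) (i t : ℕ) (a : Action d p) : Action d p :=
  iter (fun _ : ℕ => sweepOut f ξ η n m ζ) (p * n) (p * n) (List.range I) i t a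

/-- The outcome of the test of an action. -/
def meanOut (n : ℕ) (t : ℕ) (a : Action d p) : ℝ :=
  (n : ℝ)⁻¹ * ((List.range n).map fun u => f a + η (t + u)).sum

/-- The outcome of a stage whose test has threshold `c`. -/
def stageOut (c : ℝ) (n : ℕ) (m ζ : ℝ) (I : ℕ) : List (Action d p) → ℕ → ℕ → List (Action d p)
  | [], _, _ => []
  | a :: l, i, t =>
    let b := powerOut f ξ η n m ζ I i t a
    let rest := stageOut c n m ζ I l (i + I * (p * n)) (t + (I * (p * n) + n))
    if c ≤ meanOut f η n (t + I * (p * n)) b then b :: rest else rest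

variable {f ξ η}

theorem ends_slotUpdate (n : ℕ) (m ζ : ℝ) (j : Fin p) (a : Action d p) (i t : ℕ) :
    Ends f ξ η (slotUpdate n m ζ j a) i t (slotOut f ξ η n m ζ j i t a) (i + n) (t + n) := by
  have h := Ends.replicate (f := f) (ξ := ξ) (η := η) (D := 1) (N := 1) (P := slotSample m ζ a j)
    (x := fun u => (f (tentative ζ a j ((Real.sqrt m)⁻¹ • ξ (i + u))) + η (t + u)) •
      ((Real.sqrt m)⁻¹ • ξ (i + u))) n (i := i) (t := t) fun u => by
    refine Ends.draw (Ends.play ?_)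
    refine (Ends.ret _ _ _).congr ?_ (by ring) (by ring)
    simp only [mul_one, tentative]
  simp only [mul_one] at h
  unfold slotUpdate Prog.average
  refine Ends.bind (x := slotMean f ξ η n m ζ j i t a) (i' := i + n) (t' := t + n)
    (Ends.bind h ?_) ?_
  · exact Ends.ret _ _ _
  · exact Ends.ret _ _ _

theorem ends_powerIteration (θ : Params) (s : ℕ) (a : Action d p) (i t : ℕ) :
    Ends f ξ η (powerIteration θ s a) i t
      (powerOut f ξ η (θ.samples s) (θ.invVar s) (θ.weight s) (θ.sweeps s) i t a)
      (i + θ.sweeps s * (p * θ.samples s)) (t + θ.sweeps s * (p * θ.samples s)) := by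
  have := Ends.forList (f := f) (ξ := ξ) (η := η)
    (step := fun (_ : ℕ) b => Prog.forList
      (slotUpdate (θ.samples s) (θ.invVar s) (θ.weight s)) (List.finRange p) b)
    (F := fun _ => sweepOut f ξ η (θ.samples s) (θ.invVar s) (θ.weight s))
    (D := p * θ.samples s) (N := p * θ.samples s) (fun _ x i t => by
      have := Ends.forList (fun b x i t => ends_slotUpdate (f := f) (ξ := ξ) (η := η)
        (θ.samples s) (θ.invVar s) (θ.weight s) b x i t) (List.finRange p) x i t
      exact this.congr rfl (by simp) (by simp)) (List.range (θ.sweeps s)) a i t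
  exact this.congr rfl (by simp) (by simp)

theorem ends_meanReward (n : ℕ) (a : Action d p) (i t : ℕ) :
    Ends f ξ η (meanReward n a) i t (meanOut f η n t a) i (t + n) := by
  refine Ends.bind (i' := i) (t' := t + n) (x := (List.range n).map fun u => f a + η (t + u)) ?_
    (Ends.ret _ _ _)
  have := Ends.replicate (f := f) (ξ := ξ) (η := η)
    (P := (.play a fun r => .ret r : Prog d p ℝ)) (x := fun u => f a + η (t + u)) (D := 0) (N := 1)
    n (i := i) (t := t) fun u => by
      refine Ends.play ?_
      simp only [mul_zero, mul_one, ← add_assoc]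
      exact Ends.ret _ _ _
  exact this.congr rfl (by simp) (by simp)

theorem ends_stage (lam : ℝ) (θ : Params) (s : ℕ) (l : List (Action d p)) (i t : ℕ) :
    Ends f ξ η (stage lam θ s l) i t
      (stageOut f ξ η (lam * (1 - p * (1 / 2) ^ s)) (θ.samples s) (θ.invVar s) (θ.weight s)
        (θ.sweeps s) l i t)
      (i + l.length * (θ.sweeps s * (p * θ.samples s)))
      (t + l.length * (θ.sweeps s * (p * θ.samples s) + θ.samples s)) := by
  induction l generalizing i t with
  | nil => exact (Ends.ret _ _ _).congr rfl (by simp) (by simp)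
  | cons a l ih =>
    refine (ends_powerIteration θ s a i t).bind ((ends_meanReward _ _ _ _).bind
      ((ih _ _).bind ?_))
    refine (Ends.ret _ _ _).congr ?_ (by rw [List.length_cons]; ring)
      (by rw [List.length_cons]; ring)
    rw [add_assoc t]
    rfl

theorem length_stageOut_le (c : ℝ) (n : ℕ) (m ζ : ℝ) (I : ℕ) (l : List (Action d p)) (i t : ℕ) :
    (stageOut f ξ η c n m ζ I l i t).length ≤ l.length := by
  induction l generalizing i t with
  | nil => simp [stageOut]
  | cons a l ih =>
    have := ih (i + I * (p * n)) (t + (I * (p * n) + n))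
    simp only [stageOut]
    split_ifs <;> simp only [List.length_cons] <;> omega

/-- When nothing is eliminated, the surviving list has a deterministic length and its `u`-th entry
is an explicit function of blocks at deterministic counters. Both facts are needed in order to
regard the arms of UCB as a family indexed by `Fin L`. -/
theorem stageOut_map_range (c : ℝ) (n : ℕ) (m ζ : ℝ) (I : ℕ) (L : ℕ) (a : ℕ → Action d p)
    (i t : ℕ)
    (h : ∀ u < L, c ≤ meanOut f η n (t + u * (I * (p * n) + n) + I * (p * n))
      (powerOut f ξ η n m ζ I (i + u * (I * (p * n))) (t + u * (I * (p * n) + n)) (a u))) :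
    stageOut f ξ η c n m ζ I ((List.range L).map a) i t =
      (List.range L).map fun u =>
        powerOut f ξ η n m ζ I (i + u * (I * (p * n))) (t + u * (I * (p * n) + n)) (a u) := by
  induction L generalizing a i t with
  | zero => rfl
  | succ L ih =>
    rw [List.range_succ_eq_map, List.map_cons, List.map_cons, List.map_map, List.map_map]
    have h0 := h 0 (Nat.succ_pos L)
    simp only [Nat.zero_mul, add_zero] at h0
    have ih' := ih (a ∘ Nat.succ) (i + I * (p * n)) (t + (I * (p * n) + n)) fun u hu => by
      have := h (u + 1) (by omega)
      simp only [Nat.add_mul, Nat.one_mul] at this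
      rw [show i + I * (p * n) + u * (I * (p * n)) = i + (u * (I * (p * n)) + I * (p * n)) by ring,
        show t + (I * (p * n) + n) + u * (I * (p * n) + n) =
          t + (u * (I * (p * n) + n) + (I * (p * n) + n)) by ring]
      exact this
    simp only [stageOut, Nat.zero_mul, add_zero]
    rw [if_pos h0, ih']
    congr 1
    refine List.map_congr_left fun u _ => ?_
    simp only [Function.comp, Nat.succ_eq_add_one, Nat.add_mul, Nat.one_mul]
    congr 1 <;> ring

/-- The random initial action drawn from the counter `i` on. -/
def initOut (ξ : ℕ → Vec d) (i : ℕ) : Action d p := fun j => normalize (ξ (i + j.val))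

theorem ends_randomAction (i t : ℕ) :
    Ends f ξ η (randomAction (d := d) (p := p)) i t (initOut ξ i) (i + p) t := by
  have h1 := Ends.forList (f := f) (ξ := ξ) (η := η) (D := 1) (N := 0)
    (step := fun (j : Fin p) (a : Action d p) =>
      .draw fun z => .ret (Function.update a j (normalize z)))
    (F := fun j i _ a => Function.update a j (normalize (ξ i)))
    (fun b x i t => Ends.draw (Ends.ret _ _ _)) (List.finRange p) (fun _ => normalize 0) i t
  have h2 := iter_update (fun _ i _ => normalize (ξ i)) 1 0 i t
    (fun _ => normalize 0 : Action d p)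
  refine h1.congr (h2.trans ?_) (by simp) (by simp)
  funext j
  simp only [initOut, mul_one]

/-- One-stage phased elimination: final form of the `u`-th candidate. -/
def armOut (f : Action d p → ℝ) (ξ : ℕ → Vec d) (η : ℕ → ℝ) (L n : ℕ) (m ζ : ℝ) (I u : ℕ) :
    Action d p :=
  powerOut f ξ η n m ζ I (L * p + u * (I * (p * n))) (u * (I * (p * n) + n)) (initOut ξ (u * p))

/-- The case of one stage is the only nontrivial one needed: the initial draws occupy the first
`θ.inits * p` draw counters, and the stage follows from time `0`. -/
theorem ends_phasedElimination (lam : ℝ) (θ : Params) (hθ : θ.stages = 1) :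
    Ends f ξ η (phasedElimination d p lam θ) 0 0
      (stageOut f ξ η (lam * (1 - p * (1 / 2) ^ 1)) (θ.samples 1) (θ.invVar 1) (θ.weight 1)
        (θ.sweeps 1) ((List.range θ.inits).map fun u => initOut ξ (u * p)) (θ.inits * p) 0)
      (θ.inits * p + θ.inits * (θ.sweeps 1 * (p * θ.samples 1)))
      (θ.inits * (θ.sweeps 1 * (p * θ.samples 1) + θ.samples 1)) := by
  have h0 := Ends.replicate (f := f) (ξ := ξ) (η := η) (P := randomAction (d := d) (p := p))
    (x := fun u => initOut ξ (u * p)) (D := p) (N := 0) θ.inits (i := 0) (t := 0) fun u => by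
      have := ends_randomAction (f := f) (ξ := ξ) (η := η) (d := d) (p := p) (u * p) 0
      convert this using 1 <;> ring
  refine h0.bind ?_
  rw [hθ]
  have h1 := ends_stage (f := f) (ξ := ξ) (η := η) lam θ 1
    ((List.range θ.inits).map fun u => initOut ξ (u * p)) (θ.inits * p) 0
  simp only [List.length_map, List.length_range] at h1
  simp only [zero_add, mul_zero, List.range_one, Prog.forList] at h1 ⊢
  have := h1.bind (Ends.ret (f := f) (ξ := ξ) (η := η) _ _ _)
  exact this

theorem length_actions_phasedElimination (lam : ℝ) (θ : Params) (hθ : θ.stages = 1) :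
    ((phasedElimination d p lam θ).actions f ξ η).length =
      θ.inits * (θ.sweeps 1 * (p * θ.samples 1) + θ.samples 1) := by
  obtain ⟨as, h⟩ := ends_phasedElimination (f := f) (ξ := ξ) (η := η) lam θ hθ
  rw [actions, h.runFrom_eq]
  exact h.length_add

theorem output_phasedElimination (lam : ℝ) (θ : Params) (hθ : θ.stages = 1) :
    (phasedElimination d p lam θ).output f ξ η =
      stageOut f ξ η (lam * (1 - p * (1 / 2) ^ 1)) (θ.samples 1) (θ.invVar 1) (θ.weight 1)
        (θ.sweeps 1) ((List.range θ.inits).map fun u => initOut ξ (u * p)) (θ.inits * p) 0 := by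
  obtain ⟨as, h⟩ := ends_phasedElimination (f := f) (ξ := ξ) (η := η) lam θ hθ
  rw [output, h.runFrom_eq]

theorem length_output_phasedElimination_le (lam : ℝ) (θ : Params) (hθ : θ.stages = 1) :
    ((phasedElimination d p lam θ).output f ξ η).length ≤ θ.inits := by
  rw [output_phasedElimination lam θ hθ]
  simpa using length_stageOut_le (f := f) (ξ := ξ) (η := η) _ _ _ _ _
    ((List.range θ.inits).map fun u => initOut ξ (u * p)) _ _

theorem stageOut_eq_arms (lam : ℝ) (L n : ℕ) (m ζ : ℝ) (I : ℕ)
    (h : ∀ u < L, lam * (1 - p * (1 / 2) ^ 1) ≤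
      meanOut f η n (u * (I * (p * n) + n) + I * (p * n)) (armOut f ξ η L n m ζ I u)) :
    stageOut f ξ η (lam * (1 - p * (1 / 2) ^ 1)) n m ζ I
      ((List.range L).map fun u => initOut ξ (u * p)) (L * p) 0 =
      (List.range L).map (armOut f ξ η L n m ζ I) := by
  have := stageOut_map_range (f := f) (ξ := ξ) (η := η) (lam * (1 - p * (1 / 2) ^ 1)) n m ζ I L
    (fun u => initOut ξ (u * p)) (L * p) 0 (by simpa only [zero_add, armOut] using h)
  simp only [zero_add] at this
  exact this

end Outcome

/-! ### Concentration of Gaussian squares -/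

section Gaussian

theorem integral_exp_mul_sq_gaussianReal {s : ℝ} (hs : s < 1 / 2) :
    ∫ x, Real.exp (s * x ^ 2) ∂(gaussianReal 0 1) = (Real.sqrt (1 - 2 * s))⁻¹ := by
  rw [integral_gaussianReal_eq_integral_smul (by norm_num)]
  have : ∀ x : ℝ, gaussianPDFReal 0 1 x • Real.exp (s * x ^ 2) =
      (Real.sqrt (2 * Real.pi))⁻¹ * Real.exp (-((1 - 2 * s) / 2) * x ^ 2) := by
    intro x
    simp only [gaussianPDFReal, NNReal.coe_one, mul_one, sub_zero, smul_eq_mul]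
    rw [mul_assoc, ← Real.exp_add]
    congr 2
    ring
  simp_rw [this]
  rw [integral_const_mul, integral_gaussian, ← Real.sqrt_inv, ← Real.sqrt_inv, ← Real.sqrt_mul
    (by positivity)]
  congr 1
  have : 1 - 2 * s ≠ 0 := by linarith
  field_simp

theorem integrable_exp_mul_sq_gaussianReal {s : ℝ} (hs : s < 1 / 2) :
    Integrable (fun x => Real.exp (s * x ^ 2)) (gaussianReal 0 1) := by
  -- The Bochner integral of a non-integrable function is `0`, so the positive closed form above
  -- already proves integrability.
  apply Integrable.of_integral_ne_zero
  rw [integral_exp_mul_sq_gaussianReal hs]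
  have : 0 < 1 - 2 * s := by linarith
  positivity

/-- The left side is `exp (-s - log (1 - 2 s) / 2)`. The linear terms cancel, and the remainder of
the logarithm is at most `8 s ^ 2`. This is the moment generating function of a centred `χ²`
variable. -/
theorem inv_sqrt_one_sub_le {s : ℝ} (hs : |s| ≤ 1 / 4) :
    Real.exp (-s) * (Real.sqrt (1 - 2 * s))⁻¹ ≤ Real.exp (4 * s ^ 2) := by
  have hs' := abs_le.1 hs
  have h1 : |2 * s| < 1 := by rw [abs_mul, abs_two]; linarith
  have h := Real.abs_log_sub_add_sum_range_le h1 1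
  simp only [Finset.sum_range_one, zero_add, pow_one, Nat.cast_zero, div_one] at h
  have h2 : |2 * s| ^ 2 / (1 - |2 * s|) ≤ 8 * s ^ 2 := by
    rw [div_le_iff₀ (by linarith), sq_abs, abs_mul, abs_two]
    nlinarith [sq_nonneg s]
  have h3 := (abs_le.1 (h.trans h2)).1
  have hpos : 0 < 1 - 2 * s := by linarith
  rw [Real.sqrt_eq_rpow, ← Real.rpow_neg hpos.le, Real.rpow_def_of_pos hpos, ← Real.exp_add]
  apply Real.exp_le_exp.2
  linarith

/-- Bernstein's inequality for independent variables whose moment generating function is at most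
`exp (4 s²)` for `|s| ≤ 1/4`. -/
theorem measure_abs_sum_ge_le_of_mgf_le {Ω : Type*} [MeasurableSpace Ω] {P : Measure Ω}
    [IsProbabilityMeasure P] {X : ℕ → Ω → ℝ} (hX : iIndepFun X P) (hm : ∀ i, Measurable (X i))
    (hint : ∀ i s, |s| ≤ 1 / 4 → Integrable (fun ω => Real.exp (s * X i ω)) P)
    (hmgf : ∀ i s, |s| ≤ 1 / 4 → mgf (X i) P s ≤ Real.exp (4 * s ^ 2)) (n : ℕ) {v : ℝ}
    (hv : 0 ≤ v) (hv1 : v ≤ 1) :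
    P {ω | n * v < |∑ i ∈ Finset.range n, X i ω|} ≤
      ENNReal.ofReal (2 * Real.exp (-(n * v ^ 2 / 16))) := by
  have hsum : ∀ s, |s| ≤ 1 / 4 → mgf (∑ i ∈ Finset.range n, X i) P s ≤ Real.exp (4 * s ^ 2 * n) := by
    intro s hs
    rw [hX.mgf_sum hm, mul_comm, Real.exp_nat_mul]
    calc ∏ i ∈ Finset.range n, mgf (X i) P s ≤ ∏ _i ∈ Finset.range n, Real.exp (4 * s ^ 2) :=
          Finset.prod_le_prod (fun _ _ => mgf_nonneg) fun i _ => hmgf i s hs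
      _ = _ := by simp
  have hi : ∀ s, |s| ≤ 1 / 4 →
      Integrable (fun ω => Real.exp (s * (∑ i ∈ Finset.range n, X i) ω)) P :=
    fun s hs => hX.integrable_exp_mul_sum hm fun i _ => hint i s hs
  -- The Chernoff parameter `v / 8` minimizes `4 s ^ 2 - s v`, with value `-v ^ 2 / 16`, and is
  -- admissible because `v ≤ 1`.
  have h8 : |v / 8| ≤ 1 / 4 := by rw [abs_of_nonneg (by positivity)]; linarith
  have h8' : |-(v / 8)| ≤ 1 / 4 := by rw [abs_neg]; exact h8
  have h1 := measure_ge_le_exp_mul_mgf (μ := P) (X := ∑ i ∈ Finset.range n, X i) (n * v)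
    (by positivity : 0 ≤ v / 8) (hi _ h8)
  have h2 := measure_le_le_exp_mul_mgf (μ := P) (X := ∑ i ∈ Finset.range n, X i) (-(n * v))
    (by linarith [show 0 ≤ v / 8 by positivity] : -(v / 8) ≤ 0) (hi _ h8')
  have h1' : P.real {ω | n * v ≤ (∑ i ∈ Finset.range n, X i) ω} ≤ Real.exp (-(n * v ^ 2 / 16)) := by
    refine h1.trans ((mul_le_mul_of_nonneg_left (hsum _ h8) (Real.exp_nonneg _)).trans ?_)
    rw [← Real.exp_add]
    apply Real.exp_le_exp.2
    apply le_of_eq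
    ring
  have h2' : P.real {ω | (∑ i ∈ Finset.range n, X i) ω ≤ -(n * v)} ≤
      Real.exp (-(n * v ^ 2 / 16)) := by
    refine h2.trans ((mul_le_mul_of_nonneg_left (hsum _ h8') (Real.exp_nonneg _)).trans ?_)
    rw [← Real.exp_add]
    apply Real.exp_le_exp.2
    apply le_of_eq
    ring
  have hsub : {ω | n * v < |∑ i ∈ Finset.range n, X i ω|} ⊆
      {ω | n * v ≤ (∑ i ∈ Finset.range n, X i) ω} ∪
        {ω | (∑ i ∈ Finset.range n, X i) ω ≤ -(n * v)} := by
    intro ω hω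
    simp only [Set.mem_ofPred_eq, Set.mem_union, Finset.sum_apply] at hω ⊢
    rcases lt_abs.1 hω with h | h
    · exact .inl h.le
    · exact .inr (by linarith)
  rw [ENNReal.le_ofReal_iff_toReal_le (measure_ne_top _ _) (by positivity)]
  change P.real _ ≤ _
  calc P.real _ ≤ P.real _ := measureReal_mono hsub (measure_ne_top _ _)
    _ ≤ _ := measureReal_union_le _ _
    _ ≤ _ := by linarith

variable {d : ℕ}

theorem map_inner_stdGaussian {u : Vec d} (hu : ‖u‖ = 1) :
    (stdGaussian (Vec d)).map (fun x => inner ℝ u x) = gaussianReal 0 1 := by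
  have h := IsGaussian.map_eq_gaussianReal (μ := stdGaussian (Vec d)) (innerSL ℝ u)
  rw [integral_strongDual_stdGaussian, variance_dual_stdGaussian, innerSL_apply_norm, hu] at h
  simpa using h

theorem inner_law {Ω : Type*} [MeasurableSpace Ω] {P : Measure Ω} {ξ : Ω → Vec d}
    (hξ : Measurable ξ) (hlaw : P.map ξ = stdGaussian (Vec d)) {u : Vec d} (hu : ‖u‖ = 1) :
    P.map (fun ω => inner ℝ u (ξ ω)) = gaussianReal 0 1 := by
  rw [← map_inner_stdGaussian hu, ← hlaw, Measure.map_map (by fun_prop) hξ]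
  rfl

/-- The empirical second moment of a Gaussian sample in a fixed direction. -/
theorem measure_sum_inner_sq_le {Ω : Type*} [MeasurableSpace Ω] {P : Measure Ω}
    [IsProbabilityMeasure P] {ξ : ℕ → Ω → Vec d} (hm : ∀ i, Measurable (ξ i))
    (hind : iIndepFun ξ P) (hlaw : ∀ i, P.map (ξ i) = stdGaussian (Vec d)) {u : Vec d}
    (hu : ‖u‖ = 1) (i₀ n : ℕ) {v : ℝ} (hv : 0 ≤ v) (hv1 : v ≤ 1) :
    P {ω | n * v < |∑ i ∈ Finset.range n, (inner ℝ u (ξ (i₀ + i) ω) ^ 2 - 1)|} ≤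
      ENNReal.ofReal (2 * Real.exp (-(n * v ^ 2 / 16))) := by
  have hl : ∀ i, P.map (fun ω => inner ℝ u (ξ i ω)) = gaussianReal 0 1 :=
    fun i => inner_law (hm i) (hlaw i) hu
  have hmi : ∀ i, Measurable fun ω => inner ℝ u (ξ i ω) := fun i => by
    have := hm i
    fun_prop
  have key : ∀ i s, |s| ≤ 1 / 4 →
      Integrable (fun ω => Real.exp (s * (inner ℝ u (ξ (i₀ + i) ω) ^ 2 - 1))) P ∧
      ∫ ω, Real.exp (s * (inner ℝ u (ξ (i₀ + i) ω) ^ 2 - 1)) ∂P ≤ Real.exp (4 * s ^ 2) := by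
    intro i s hs
    have hs2 : s < 1 / 2 := by linarith [(abs_le.1 hs).2]
    have e : ∀ ω, Real.exp (s * (inner ℝ u (ξ (i₀ + i) ω) ^ 2 - 1)) =
        Real.exp (-s) * Real.exp (s * inner ℝ u (ξ (i₀ + i) ω) ^ 2) := by
      intro ω
      rw [← Real.exp_add]
      congr 1
      ring
    simp_rw [e]
    have hmap : Integrable (fun ω => Real.exp (s * inner ℝ u (ξ (i₀ + i) ω) ^ 2)) P := by
      have := integrable_exp_mul_sq_gaussianReal hs2
      rw [← hl (i₀ + i)] at this
      exact this.comp_measurable (hmi _)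
    refine ⟨hmap.const_mul _, ?_⟩
    rw [integral_const_mul]
    have : ∫ ω, Real.exp (s * inner ℝ u (ξ (i₀ + i) ω) ^ 2) ∂P =
        ∫ x, Real.exp (s * x ^ 2) ∂(gaussianReal 0 1) := by
      rw [← hl (i₀ + i), integral_map (hmi _).aemeasurable (by fun_prop)]
    rw [this, integral_exp_mul_sq_gaussianReal hs2]
    exact inv_sqrt_one_sub_le hs
  refine measure_abs_sum_ge_le_of_mgf_le
    (X := fun i ω => inner ℝ u (ξ (i₀ + i) ω) ^ 2 - 1) ?_ ?_ (fun i s hs => (key i s hs).1)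
    (fun i s hs => (key i s hs).2) n hv hv1
  · have h1 := hind.precomp (g := fun i => i₀ + i) (fun a b h => by simpa using h)
    exact h1.comp (fun _ x => inner ℝ u x ^ 2 - 1) (fun _ => by fun_prop)
  · intro i
    have := hmi (i₀ + i)
    fun_prop

theorem exp_quarter_mul_sum_sq (y : Fin d → ℝ) :
    Real.exp ((1 / 4 : ℝ) * ∑ i, y i ^ 2) = ∏ i, Real.exp ((1 / 4 : ℝ) * y i ^ 2) := by
  rw [Finset.mul_sum, Real.exp_sum]

theorem integrable_exp_quarter_mul_sum_sq :
    Integrable (fun y : Fin d → ℝ => Real.exp ((1 / 4 : ℝ) * ∑ i, y i ^ 2))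
      (Measure.pi fun _ => gaussianReal 0 1) := by
  simp_rw [exp_quarter_mul_sum_sq]
  exact Integrable.fintype_prod (μ := fun _ : Fin d => gaussianReal 0 1)
    (f := fun _ x => Real.exp ((1 / 4 : ℝ) * x ^ 2))
    (fun _ => integrable_exp_mul_sq_gaussianReal (by norm_num))

theorem integral_exp_quarter_mul_sum_sq_le :
    ∫ y : Fin d → ℝ, Real.exp ((1 / 4 : ℝ) * ∑ i, y i ^ 2) ∂(Measure.pi fun _ => gaussianReal 0 1)
      ≤ Real.exp d := by
  simp_rw [exp_quarter_mul_sum_sq]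
  rw [integral_fintype_prod_eq_prod (μ := fun _ : Fin d => gaussianReal 0 1)
    (fun _ x => Real.exp ((1 / 4 : ℝ) * x ^ 2)), Finset.prod_const, Finset.card_univ,
    Fintype.card_fin, integral_exp_mul_sq_gaussianReal (by norm_num), ← Real.exp_one_pow]
  refine pow_le_pow_left₀ (by positivity) ?_ _
  -- Each coordinate contributes the factor `√2 ≤ 2 ≤ e`.
  have h2 : (Real.sqrt (1 - 2 * (1 / 4)))⁻¹ ≤ 2 := by
    rw [inv_le_comm₀ (by positivity) (by norm_num)]
    exact Real.le_sqrt_of_sq_le (by norm_num)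
  linarith [Real.add_one_le_exp (1 : ℝ)]

theorem pi_gaussianReal_sum_sq_gt_le (x : ℝ) :
    Measure.pi (fun _ : Fin d => gaussianReal 0 1) {y | x < ∑ i, y i ^ 2} ≤
      ENNReal.ofReal (Real.exp (d - x / 4)) := by
  set μ := Measure.pi (fun _ : Fin d => gaussianReal 0 1) with hμ
  have h : μ.real {y | x ≤ ∑ i, y i ^ 2} ≤ Real.exp (-(1 / 4) * x) * mgf (fun y => ∑ i, y i ^ 2) μ (1 / 4) :=
    measure_ge_le_exp_mul_mgf x (by norm_num) integrable_exp_quarter_mul_sum_sq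
  have h1 : mgf (fun y => ∑ i, y i ^ 2) μ (1 / 4) ≤ Real.exp d := integral_exp_quarter_mul_sum_sq_le
  have h2 : μ.real {y | x < ∑ i, y i ^ 2} ≤ μ.real {y | x ≤ ∑ i, y i ^ 2} :=
        measureReal_mono (fun y (hy : x < _) => hy.le) (measure_ne_top _ _)
  have h3 : Real.exp (-(1 / 4) * x) * Real.exp d = Real.exp (d - x / 4) := by
    rw [← Real.exp_add]
    congr 1
    ring
  rw [ENNReal.le_ofReal_iff_toReal_le (measure_ne_top _ _) (Real.exp_nonneg _), ← h3]
  exact (h2.trans h).trans (mul_le_mul_of_nonneg_left h1 (Real.exp_nonneg _))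

/-- A tail bound for the norm of a standard Gaussian vector. -/
theorem stdGaussian_norm_sq_gt_le (x : ℝ) :
    stdGaussian (Vec d) {z | x < ‖z‖ ^ 2} ≤ ENNReal.ofReal (Real.exp (d - x / 4)) := by
  rw [← map_pi_eq_stdGaussian,
    Measure.map_apply (by fun_prop) (measurableSet_lt (by fun_prop) (by fun_prop))]
  simp only [EuclideanSpace.real_norm_sq_eq, Set.preimage_ofPred_eq]
  exact pi_gaussianReal_sum_sq_gt_le x

end Gaussian

/-! ### A dominant coordinate of a Gaussian vector -/

section Dominant

/-- The probability that a standard Gaussian has absolute value at most `u`. -/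
def centralMass (u : ℝ) : ℝ := ∫ x in (-u)..u, gaussianPDFReal 0 1 x

theorem continuous_gaussianPDFReal : Continuous (gaussianPDFReal 0 1) := by
  unfold gaussianPDFReal
  fun_prop

theorem gaussianPDFReal_neg (x : ℝ) : gaussianPDFReal 0 1 (-x) = gaussianPDFReal 0 1 x := by
  simp [gaussianPDFReal]

/-- Both endpoints contribute the same amount, as the density is even. Consequently the density
times `centralMass ^ (k - 1)` is an exact derivative, which makes the dominance probability
computable. -/
theorem hasDerivAt_centralMass (u : ℝ) :
    HasDerivAt centralMass (2 * gaussianPDFReal 0 1 u) u := by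
  have hF : ∀ v, HasDerivAt (fun v => ∫ x in (0:ℝ)..v, gaussianPDFReal 0 1 x)
      (gaussianPDFReal 0 1 v) v := fun v =>
    intervalIntegral.integral_hasDerivAt_right
      (continuous_gaussianPDFReal.intervalIntegrable _ _)
      (continuous_gaussianPDFReal.stronglyMeasurableAtFilter _ _) continuous_gaussianPDFReal.continuousAt
  have h := (hF u).sub ((hF (-u)).comp u (hasDerivAt_neg u))
  rw [gaussianPDFReal_neg, mul_neg, mul_one, sub_neg_eq_add, ← two_mul] at h
  refine h.congr_of_eventuallyEq (.of_forall fun v => ?_)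
  simp only [centralMass, Pi.sub_apply, Function.comp]
  rw [intervalIntegral.integral_interval_sub_left] <;>
    exact continuous_gaussianPDFReal.intervalIntegrable _ _

theorem continuous_centralMass : Continuous centralMass :=
  continuous_iff_continuousAt.2 fun u => (hasDerivAt_centralMass u).continuousAt

theorem gaussianReal_abs_le {u : ℝ} (hu : 0 ≤ u) :
    gaussianReal 0 1 {x | |x| ≤ u} = ENNReal.ofReal (centralMass u) := by
  have e : {x : ℝ | |x| ≤ u} = Set.Icc (-u) u := by
    ext x
    simp [abs_le]
  rw [e, gaussianReal_apply_eq_integral 0 (by norm_num), centralMass,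
    intervalIntegral.integral_of_le (by linarith), integral_Icc_eq_integral_Ioc]

theorem centralMass_nonneg {u : ℝ} (hu : 0 ≤ u) : 0 ≤ centralMass u :=
  intervalIntegral.integral_nonneg (by linarith) fun _ _ => gaussianPDFReal_nonneg _ _ _

theorem centralMass_le_one {u : ℝ} (hu : 0 ≤ u) : centralMass u ≤ 1 := by
  have h : gaussianReal 0 1 {x | |x| ≤ u} ≤ 1 := prob_le_one
  rw [gaussianReal_abs_le hu] at h
  simpa using h

theorem gaussianPDFReal_le_half (x : ℝ) : gaussianPDFReal 0 1 x ≤ 1 / 2 := by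
  simp only [gaussianPDFReal, NNReal.coe_one, mul_one, sub_zero]
  have h1 : Real.exp (-x ^ 2 / 2) ≤ 1 := Real.exp_le_one_iff.2 (by nlinarith [sq_nonneg x])
  have h2 : (Real.sqrt (2 * Real.pi))⁻¹ ≤ 1 / 2 := by
    rw [one_div]
    refine inv_anti₀ (by norm_num) (Real.le_sqrt_of_sq_le ?_)
    linarith [Real.pi_gt_three]
  calc _ ≤ (1 / 2 : ℝ) * 1 := mul_le_mul h2 h1 (Real.exp_nonneg _) (by norm_num)
    _ = _ := mul_one _

theorem centralMass_quarter_le : centralMass (1 / 4) ≤ 1 / 4 := by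
  calc centralMass (1 / 4) ≤ ∫ _x in (-(1 / 4 : ℝ))..(1 / 4), (1 / 2 : ℝ) :=
        intervalIntegral.integral_mono_on (by norm_num)
          (continuous_gaussianPDFReal.intervalIntegrable _ _) (by simp)
          fun x _ => gaussianPDFReal_le_half x
    _ = 1 / 4 := by
      rw [intervalIntegral.integral_const]
      norm_num

/-- Markov's inequality for `exp (x ^ 2 / 4)`, whose expectation is `√2 ≤ 3 / 2`. -/
theorem one_sub_le_centralMass {u : ℝ} (hu : 0 ≤ u) :
    1 - 3 / 2 * Real.exp (-(u ^ 2 / 4)) ≤ centralMass u := by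
  have hint := integrable_exp_mul_sq_gaussianReal (s := 1 / 4) (by norm_num)
  have h : (gaussianReal 0 1).real {x | u ^ 2 ≤ x ^ 2} ≤
      Real.exp (-(1 / 4) * u ^ 2) * mgf (fun x => x ^ 2) (gaussianReal 0 1) (1 / 4) :=
    measure_ge_le_exp_mul_mgf _ (by norm_num) hint
  have h1 : mgf (fun x => x ^ 2) (gaussianReal 0 1) (1 / 4) ≤ 3 / 2 := by
    rw [mgf, integral_exp_mul_sq_gaussianReal (by norm_num)]
    rw [inv_le_comm₀ (by positivity) (by norm_num)]
    exact Real.le_sqrt_of_sq_le (by norm_num)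
  have h2 : (gaussianReal 0 1).real {x | |x| ≤ u} = centralMass u := by
    rw [measureReal_def, gaussianReal_abs_le hu, ENNReal.toReal_ofReal (centralMass_nonneg hu)]
  have h3 : (gaussianReal 0 1).real {x | |x| ≤ u}ᶜ ≤ (gaussianReal 0 1).real {x | u ^ 2 ≤ x ^ 2} :=
    measureReal_mono (fun x hx => by
      simp only [Set.mem_compl_iff, Set.mem_ofPred_eq, not_le] at hx ⊢
      rw [← sq_abs x]
      exact pow_le_pow_left₀ hu hx.le 2) (measure_ne_top _ _)
  rw [probReal_compl_eq_one_sub (measurableSet_le (by fun_prop) (by fun_prop)), h2] at h3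
  have h4 := mul_le_mul_of_nonneg_left h1 (Real.exp_nonneg (-(1 / 4) * u ^ 2))
  rw [show -(1 / 4) * u ^ 2 = -(u ^ 2 / 4) by ring] at h h4
  linarith

/-- The integral form of the dominance probability. -/
theorem le_integral_centralMass_pow {k : ℕ} (hk : 1 ≤ k) {γ : ℝ} (hγ0 : 0 ≤ γ) (hγ1 : γ ≤ 1 / 4)
    (hγ : γ * (4 * Real.log (12 * k)) ≤ 1) :
    5 / (144 * k : ℝ) ≤ ∫ x in ((1 + γ) * (1 / 4))..((1 + γ) * Real.sqrt (4 * Real.log (12 * k))),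
      gaussianPDFReal 0 1 x * centralMass (x / (1 + γ)) ^ (k - 1) := by
  -- The cutoff is chosen so that the tail bound `3 / 2 * exp (-B ^ 2 / 4)` equals `1 / (8 k)`, and
  -- so that the hypothesis on `γ` reads `γ B ^ 2 ≤ 1`.
  set B := Real.sqrt (4 * Real.log (12 * k)) with hB
  have hk' : (1 : ℝ) ≤ k := by exact_mod_cast hk
  have hlog : 1 ≤ Real.log (12 * k) := by
    rw [Real.le_log_iff_exp_le (by positivity)]
    linarith [Real.exp_one_lt_d9]
  have hB2 : B ^ 2 = 4 * Real.log (12 * k) := Real.sq_sqrt (by linarith)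
  have hB1 : 1 / 4 ≤ B := Real.le_sqrt_of_sq_le (by linarith)
  have h1γ : 0 < 1 + γ := by linarith
  have hcm := continuous_centralMass
  have hpdf := continuous_gaussianPDFReal
  have hsubst := intervalIntegral.mul_integral_comp_mul_left (a := 1 / 4) (b := B)
    (f := fun x => gaussianPDFReal 0 1 x * centralMass (x / (1 + γ)) ^ (k - 1)) (1 + γ)
  rw [← hsubst]
  -- After the substitution `x = (1 + γ) u` the margin only affects the density. It costs `exp (-(γ
  -- + γ ^ 2 / 2) u ^ 2) ≥ exp (-2) ≥ 1 / 9` for `u ≤ B`.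
  have hmono : ∫ u in (1 / 4)..B, 1 / 9 * (gaussianPDFReal 0 1 u * centralMass u ^ (k - 1)) ≤
      ∫ u in (1 / 4)..B, gaussianPDFReal 0 1 ((1 + γ) * u) *
        centralMass ((1 + γ) * u / (1 + γ)) ^ (k - 1) := by
    refine intervalIntegral.integral_mono_on hB1
      (Continuous.intervalIntegrable (by fun_prop) _ _)
      (Continuous.intervalIntegrable (by fun_prop) _ _) fun u hu => ?_
    rw [mul_div_cancel_left₀ _ h1γ.ne', ← mul_assoc]
    have hu0 : 0 ≤ u := by linarith [hu.1]
    refine mul_le_mul_of_nonneg_right ?_ (pow_nonneg (centralMass_nonneg hu0) _)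
    simp only [gaussianPDFReal, NNReal.coe_one, mul_one, sub_zero]
    have h9 : (1 / 9 : ℝ) ≤ Real.exp (-2) := by
      rw [Real.exp_neg, one_div]
      refine inv_anti₀ (Real.exp_pos _) ?_
      have : Real.exp 2 = Real.exp 1 ^ 2 := by rw [← Real.exp_nat_mul]; norm_num
      rw [this]
      nlinarith [Real.exp_one_lt_d9, Real.exp_pos 1]
    have hu2 : u ^ 2 ≤ B ^ 2 := pow_le_pow_left₀ hu0 hu.2 2
    have hexp : Real.exp (-2) * Real.exp (-u ^ 2 / 2) ≤ Real.exp (-((1 + γ) * u) ^ 2 / 2) := by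
      rw [← Real.exp_add]
      apply Real.exp_le_exp.2
      have hb : γ * u ^ 2 ≤ 1 := (mul_le_mul_of_nonneg_left hu2 hγ0).trans (hB2 ▸ hγ)
      nlinarith [mul_le_mul_of_nonneg_left hb hγ0]
    have hc : 0 ≤ (Real.sqrt (2 * Real.pi))⁻¹ := by positivity
    calc 1 / 9 * ((Real.sqrt (2 * Real.pi))⁻¹ * Real.exp (-u ^ 2 / 2))
        = (Real.sqrt (2 * Real.pi))⁻¹ * (1 / 9 * Real.exp (-u ^ 2 / 2)) := by ring
      _ ≤ (Real.sqrt (2 * Real.pi))⁻¹ * (Real.exp (-2) * Real.exp (-u ^ 2 / 2)) := by gcongr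
      _ ≤ _ := by gcongr
  have hftc : ∫ u in (1 / 4)..B, gaussianPDFReal 0 1 u * centralMass u ^ (k - 1) =
      (centralMass B ^ k - centralMass (1 / 4) ^ k) / (2 * k) := by
    have := intervalIntegral.integral_eq_sub_of_hasDerivAt (a := 1 / 4) (b := B)
      (f := fun u => centralMass u ^ k / (2 * k))
      (f' := fun u => gaussianPDFReal 0 1 u * centralMass u ^ (k - 1)) (fun u _ => by
        have h := ((hasDerivAt_centralMass u).pow k).div_const (2 * (k : ℝ))
        refine h.congr_deriv ?_
        field_simp) (Continuous.intervalIntegrable (by fun_prop) _ _)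
    rw [this]
    ring
  rw [intervalIntegral.integral_const_mul, hftc] at hmono
  have hBm : 1 - 1 / (8 * k) ≤ centralMass B := by
    refine le_trans ?_ (one_sub_le_centralMass (by linarith))
    rw [hB2, mul_div_cancel_left₀ _ (by norm_num : (4:ℝ) ≠ 0), Real.exp_neg,
      Real.exp_log (by positivity)]
    apply le_of_eq
    field_simp
    ring
  have hBk : 7 / 8 ≤ centralMass B ^ k := by
    have h0 : 0 ≤ 1 - 1 / (8 * (k : ℝ)) := by
      rw [sub_nonneg, div_le_one (by positivity)]
      linarith
    have := one_add_mul_le_pow (a := -(1 / (8 * (k : ℝ)))) (by linarith) k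
    have e : 1 + (k : ℝ) * -(1 / (8 * k)) = 7 / 8 := by
      field_simp
      norm_num
    rw [e, ← sub_eq_add_neg] at this
    exact this.trans (pow_le_pow_left₀ h0 hBm k)
  have hak : centralMass (1 / 4) ^ k ≤ 1 / 4 := by
    have h0 := centralMass_nonneg (show (0:ℝ) ≤ 1 / 4 by norm_num)
    exact (pow_le_of_le_one h0 (centralMass_le_one (by norm_num)) (by omega)).trans
      centralMass_quarter_le
  -- The constant is `(7 / 8 - 1 / 4) / (9 · 2)`. The remaining factor `1 + γ ≥ 1` of the
  -- substitution is dropped.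
  have h5 : 5 / (144 * k : ℝ) ≤ 1 / 9 * ((centralMass B ^ k - centralMass (1 / 4) ^ k) / (2 * k)) := by
    rw [mul_div_assoc', div_le_div_iff₀ (by positivity) (by positivity)]
    nlinarith
  have hpos : (0:ℝ) ≤ 5 / (144 * k : ℝ) := by positivity
  have := h5.trans hmono
  nlinarith

/-- Conditionally on the coordinate `i₀` having the value `x`, the other `k - 1` coordinates in `K`
are independent and each is at most `x / (1 + γ)` in absolute value with probability `centralMass (x
/ (1 + γ))`. Fubini reduces the claim to the one-dimensional integral above. -/
theorem pi_gaussianReal_dominant_ge {d k : ℕ} (K : Finset (Fin d)) (i₀ : Fin d) (hi₀ : i₀ ∈ K)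
    (hK : K.card = k) {γ : ℝ} (hγ0 : 0 ≤ γ) (hγ1 : γ ≤ 1 / 4)
    (hγ : γ * (4 * Real.log (12 * k)) ≤ 1) :
    ENNReal.ofReal (5 / (144 * k)) ≤ Measure.pi (fun _ : Fin d => gaussianReal 0 1)
      {y | 1 / 4 ≤ y i₀ ∧ ∀ i ∈ K, i ≠ i₀ → (1 + γ) * |y i| ≤ y i₀} := by
  obtain ⟨d, rfl⟩ : ∃ d', d = d' + 1 := ⟨d - 1, by have := i₀.2; omega⟩
  have hk : 1 ≤ k := hK ▸ Finset.card_pos.2 ⟨_, hi₀⟩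
  have h1γ : 0 < 1 + γ := by linarith
  set μ := gaussianReal 0 1
  set B := Real.sqrt (4 * Real.log (12 * k))
  set A : Set (Fin (d + 1) → ℝ) := {y | 1 / 4 ≤ y i₀ ∧ ∀ i ∈ K, i ≠ i₀ → (1 + γ) * |y i| ≤ y i₀}
  set A' : Set (ℝ × (Fin d → ℝ)) :=
    {z | 1 / 4 ≤ z.1 ∧ ∀ j, i₀.succAbove j ∈ K → (1 + γ) * |z.2 j| ≤ z.1} with hA'
  have hA'm : MeasurableSet A' := by
    have h1 : MeasurableSet {z : ℝ × (Fin d → ℝ) | 1 / 4 ≤ z.1} :=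
      measurableSet_le (by fun_prop) (by fun_prop)
    refine h1.inter ?_
    have : {z : ℝ × (Fin d → ℝ) | ∀ j, i₀.succAbove j ∈ K → (1 + γ) * |z.2 j| ≤ z.1} =
        ⋂ j, ⋂ _ : i₀.succAbove j ∈ K, {z | (1 + γ) * |z.2 j| ≤ z.1} := by
      ext z
      simp
    change MeasurableSet {z : ℝ × (Fin d → ℝ) | ∀ j, i₀.succAbove j ∈ K → (1 + γ) * |z.2 j| ≤ z.1}
    rw [this]
    exact .iInter fun j => .iInter fun _ => measurableSet_le (by fun_prop) (by fun_prop)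
  have hpre : A = MeasurableEquiv.piFinSuccAbove (fun _ => ℝ) i₀ ⁻¹' A' := by
    ext y
    simp only [A, A', Set.mem_preimage, Set.mem_ofPred_eq, MeasurableEquiv.piFinSuccAbove_apply]
    refine and_congr_right fun _ => ⟨fun h j hj => h _ hj (Fin.succAbove_ne _ _), fun h i hi hne => ?_⟩
    obtain ⟨j, rfl⟩ := Fin.exists_succAbove_eq hne
    exact h j hi
  have hcard : (Finset.univ.filter fun j => i₀.succAbove j ∈ K).card = k - 1 := by
    rw [← hK, ← Finset.card_erase_of_mem hi₀]
    refine Finset.card_bij (fun j _ => i₀.succAbove j) ?_ ?_ ?_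
    · intro j hj
      exact Finset.mem_erase.2 ⟨Fin.succAbove_ne _ _, (Finset.mem_filter.1 hj).2⟩
    · intro a _ b _ h
      exact Fin.succAbove_right_injective h
    · intro i hi
      obtain ⟨j, rfl⟩ := Fin.exists_succAbove_eq (Finset.mem_erase.1 hi).1
      exact ⟨j, Finset.mem_filter.2 ⟨Finset.mem_univ _, (Finset.mem_erase.1 hi).2⟩, rfl⟩
  have hsection : ∀ x, (1 + γ) * (1 / 4) ≤ x →
      Measure.pi (fun _ : Fin d => μ) (Prod.mk x ⁻¹' A') =
        ENNReal.ofReal (centralMass (x / (1 + γ)) ^ (k - 1)) := by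
    intro x hx
    have hx0 : 0 ≤ x / (1 + γ) := div_nonneg (by linarith) h1γ.le
    have e : Prod.mk x ⁻¹' A' = Set.univ.pi fun j =>
        if i₀.succAbove j ∈ K then {y : ℝ | |y| ≤ x / (1 + γ)} else Set.univ := by
      ext y
      simp only [A', Set.mem_preimage, Set.mem_ofPred_eq, Set.mem_univ_pi]
      rw [and_iff_right (by linarith)]
      refine forall_congr' fun j => ?_
      split_ifs with h
      · simp only [h, forall_const, Set.mem_ofPred_eq]
        rw [le_div_iff₀' h1γ]
      · simp [h]
    rw [e, Measure.pi_pi, ENNReal.ofReal_pow (centralMass_nonneg hx0), ← hcard,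
      ← Finset.prod_const, Finset.prod_filter]
    refine Finset.prod_congr rfl fun j _ => ?_
    split_ifs
    · exact gaussianReal_abs_le hx0
    · simp [μ]
  rw [hpre, (measurePreserving_piFinSuccAbove (fun _ => μ) i₀).measure_preimage_equiv,
    Measure.prod_apply hA'm]
  set a' := (1 + γ) * (1 / 4)
  set b' := (1 + γ) * B
  have hab : a' ≤ b' := by
    refine mul_le_mul_of_nonneg_left (Real.le_sqrt_of_sq_le ?_) h1γ.le
    have hk' : (1 : ℝ) ≤ k := by exact_mod_cast hk
    have : 1 ≤ Real.log (12 * k) := by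
      rw [Real.le_log_iff_exp_le (by positivity)]
      linarith [Real.exp_one_lt_d9]
    linarith
  have hcm := continuous_centralMass
  have hpdf := continuous_gaussianPDFReal
  calc ENNReal.ofReal (5 / (144 * k))
      ≤ ENNReal.ofReal (∫ x in a'..b', gaussianPDFReal 0 1 x * centralMass (x / (1 + γ)) ^ (k - 1)) :=
        ENNReal.ofReal_le_ofReal (le_integral_centralMass_pow hk hγ0 hγ1 hγ)
    _ = ∫⁻ x in Set.Ioc a' b',
          ENNReal.ofReal (gaussianPDFReal 0 1 x * centralMass (x / (1 + γ)) ^ (k - 1)) := by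
        rw [intervalIntegral.integral_of_le hab, ofReal_integral_eq_lintegral_ofReal]
        · exact (Continuous.intervalIntegrable (by fun_prop) a' b').1
        · refine (ae_restrict_iff' measurableSet_Ioc).2 (.of_forall fun x hx => ?_)
          exact mul_nonneg (gaussianPDFReal_nonneg _ _ _) (pow_nonneg (centralMass_nonneg
            (div_nonneg (by have := hx.1; simp only [a'] at this; linarith) h1γ.le)) _)
    _ = ∫⁻ x in Set.Ioc a' b',
          gaussianPDF 0 1 x * Measure.pi (fun _ : Fin d => μ) (Prod.mk x ⁻¹' A') := by
        refine setLIntegral_congr_fun measurableSet_Ioc fun x hx => ?_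
        rw [hsection x hx.1.le, ENNReal.ofReal_mul (gaussianPDFReal_nonneg _ _ _)]
        rfl
    _ ≤ ∫⁻ x, gaussianPDF 0 1 x * Measure.pi (fun _ : Fin d => μ) (Prod.mk x ⁻¹' A') :=
        setLIntegral_le_lintegral _ _
    _ = ∫⁻ x, Measure.pi (fun _ : Fin d => μ) (Prod.mk x ⁻¹' A') ∂μ := by
        have hw : ∀ g : ℝ → ENNReal, Measurable g →
            ∫⁻ x, gaussianPDF 0 1 x * g x = ∫⁻ x, g x ∂(gaussianReal 0 1) := fun g hg => by
          rw [gaussianReal_of_var_ne_zero 0 (by norm_num),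
            lintegral_withDensity_eq_lintegral_mul _ (measurable_gaussianPDF 0 1) hg]
          rfl
        exact hw _ (measurable_measure_prodMk_left hA'm)

/-- With probability at least `1/(60 k)`, the coordinate `i₀` of a Gaussian vector is positive and
dominates the other coordinates in `K`, with a margin, while the vector is not too long. -/
theorem stdGaussian_dominant_ge {d k : ℕ} (b : OrthonormalBasis (Fin d) ℝ (Vec d))
    (K : Finset (Fin d)) (i₀ : Fin d) (hi₀ : i₀ ∈ K) (hK : K.card = k) {γ : ℝ} (hγ0 : 0 ≤ γ)
    (hγ1 : γ ≤ 1 / 4) (hγ : γ * (4 * Real.log (12 * k)) ≤ 1) :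
    ENNReal.ofReal (1 / (60 * k)) ≤ stdGaussian (Vec d)
      {x | (1 / 4 ≤ inner ℝ (b i₀) x ∧
        ∀ i ∈ K, i ≠ i₀ → (1 + γ) * |inner ℝ (b i) x| ≤ inner ℝ (b i₀) x) ∧ ‖x‖ ^ 2 ≤ 40 * d} := by
  have hk : 1 ≤ k := hK ▸ Finset.card_pos.2 ⟨_, hi₀⟩
  have hkd : k ≤ d := by simpa [hK] using Finset.card_le_univ K
  have hk' : (1 : ℝ) ≤ k := by exact_mod_cast hk
  have hkd' : (k : ℝ) ≤ d := by exact_mod_cast hkd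
  set A : Set (Vec d) := {x | 1 / 4 ≤ inner ℝ (b i₀) x ∧
        ∀ i ∈ K, i ≠ i₀ → (1 + γ) * |inner ℝ (b i) x| ≤ inner ℝ (b i₀) x}
  have hAm : MeasurableSet A := by
    have h1 : MeasurableSet {x : Vec d | 1 / 4 ≤ inner ℝ (b i₀) x} :=
      measurableSet_le (by fun_prop) (by fun_prop)
    refine h1.inter ?_
    have : {x : Vec d | ∀ i ∈ K, i ≠ i₀ → (1 + γ) * |inner ℝ (b i) x| ≤ inner ℝ (b i₀) x} =
        ⋂ i, ⋂ _ : i ∈ K, ⋂ _ : i ≠ i₀, {x | (1 + γ) * |inner ℝ (b i) x| ≤ inner ℝ (b i₀) x} := by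
      ext z
      simp
    change MeasurableSet
      {x : Vec d | ∀ i ∈ K, i ≠ i₀ → (1 + γ) * |inner ℝ (b i) x| ≤ inner ℝ (b i₀) x}
    rw [this]
    exact .iInter fun j => .iInter fun _ => .iInter fun _ =>
      measurableSet_le (by fun_prop) (by fun_prop)
  have hA : ENNReal.ofReal (5 / (144 * k)) ≤ stdGaussian (Vec d) A := by
    rw [stdGaussian_eq_map_pi_orthonormalBasis b, Measure.map_apply (by fun_prop) hAm]
    refine (pi_gaussianReal_dominant_ge K i₀ hi₀ hK hγ0 hγ1 hγ).trans (measure_mono fun y hy => ?_)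
    have hin : ∀ i, inner ℝ (b i) (∑ j, y j • b j) = y i := fun i => by
      rw [b.orthonormal.inner_right_fintype]
    simp only [A, Set.mem_preimage, Set.mem_ofPred_eq, hin]
    exact hy
  have hB := stdGaussian_norm_sq_gt_le (d := d) (40 * d)
  have hsub : A ⊆ {x | x ∈ A ∧ ‖x‖ ^ 2 ≤ 40 * d} ∪ {z | (40 * d : ℝ) < ‖z‖ ^ 2} := by
    intro x hx
    by_cases h : ‖x‖ ^ 2 ≤ 40 * d
    · exact .inl ⟨hx, h⟩
    · exact .inr (not_le.1 h)
  have h1 := hA.trans ((measure_mono hsub).trans (measure_union_le _ _))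
  -- The event that the vector is too long has probability at most `exp (-9 d)`, which is negligible
  -- against `1 / k` since `k ≤ d`.
  have hexp : Real.exp (d - 40 * d / 4) ≤ 1 / (256 * k) := by
    have h8 : (256 : ℝ) ≤ Real.exp 8 := by
      have : Real.exp 8 = Real.exp 1 ^ 8 := by rw [← Real.exp_nat_mul]; norm_num
      rw [this]
      calc (256 : ℝ) = 2 ^ 8 := by norm_num
        _ ≤ Real.exp 1 ^ 8 := pow_le_pow_left₀ (by norm_num) (by linarith [Real.add_one_le_exp (1:ℝ)]) 8
    have h9 : (d : ℝ) ≤ Real.exp (9 * d - 8) := by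
      linarith [Real.add_one_le_exp (9 * (d : ℝ) - 8)]
    rw [show (d : ℝ) - 40 * d / 4 = -(8 + (9 * d - 8)) by ring, Real.exp_neg, Real.exp_add, one_div]
    refine inv_anti₀ (by positivity) (mul_le_mul h8 (hkd'.trans h9) (by positivity) (by positivity))
  have h2 : ENNReal.ofReal (5 / (144 * k)) ≤
      stdGaussian (Vec d) {x | x ∈ A ∧ ‖x‖ ^ 2 ≤ 40 * d} + ENNReal.ofReal (1 / (256 * k)) :=
    h1.trans (add_le_add_right (hB.trans (ENNReal.ofReal_le_ofReal hexp)) _)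
  have h3 : (1 / (60 * k) : ℝ) ≤ 5 / (144 * k) - 1 / (256 * k) := by
    rw [← sub_nonneg]
    have : 5 / (144 * k) - 1 / (256 * k) - 1 / (60 * k : ℝ) =
      (5 / 144 - 1 / 256 - 1 / 60) / k := by field_simp
    rw [this]
    exact div_nonneg (by norm_num) (by positivity)
  calc ENNReal.ofReal (1 / (60 * k)) ≤ ENNReal.ofReal (5 / (144 * k) - 1 / (256 * k)) :=
        ENNReal.ofReal_le_ofReal h3
    _ = ENNReal.ofReal (5 / (144 * k)) - ENNReal.ofReal (1 / (256 * k)) :=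
        ENNReal.ofReal_sub _ (by positivity)
    _ ≤ _ := tsub_le_iff_right.2 h2

end Dominant

/-! ### Noise weighted by the past -/

section Noise

/-- One step of the exponential supermartingale, in kernel form. For almost every `ω` the
sub-Gaussian bound holds at all real parameters at once, so the parameter may be frozen at the
random value `w ω`. -/
theorem lintegral_mul_exp_le_of_hasSubgaussianMGF {Ω Ω' : Type*} [MeasurableSpace Ω]
    [MeasurableSpace Ω'] {ν : Measure Ω'} [SFinite ν] {κ : Kernel Ω' Ω} [IsMarkovKernel κ]
    {X : Ω → ℝ} (hX : Kernel.HasSubgaussianMGF X 1 κ ν) (hXm : Measurable X) {w : Ω' → ℝ}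
    (hw : Measurable w) {Z : Ω' → ENNReal} (hZ : Measurable Z) :
    ∫⁻ z, Z z.1 * ENNReal.ofReal (Real.exp (w z.1 * X z.2 - w z.1 ^ 2 / 2)) ∂(ν ⊗ₘ κ) ≤
      ∫⁻ ω, Z ω ∂ν := by
  rw [Measure.lintegral_compProd (by fun_prop)]
  refine lintegral_mono_ae ?_
  filter_upwards [hX.mgf_le, hX.ae_forall_integrable_exp_mul] with ω h1 h2
  rw [lintegral_const_mul _ (by fun_prop)]
  refine mul_le_of_le_one_right' ?_
  have e : ∀ ω', Real.exp (w ω * X ω' - w ω ^ 2 / 2) =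
      Real.exp (-(w ω ^ 2 / 2)) * Real.exp (w ω * X ω') := fun ω' => by
    rw [← Real.exp_add]
    congr 1
    ring
  simp only [e]
  rw [← ofReal_integral_eq_lintegral_ofReal ((h2 _).const_mul _)
    (.of_forall fun _ => by positivity), integral_const_mul]
  have h3 := mul_le_mul_of_nonneg_left (h1 (w ω)) (Real.exp_nonneg (-(w ω ^ 2 / 2)))
  rw [← Real.exp_add, NNReal.coe_one, one_mul, neg_add_cancel, Real.exp_zero] at h3
  exact ENNReal.ofReal_le_one.2 h3

theorem history_mono {Ω : Type*} {d : ℕ} (ξ : ℕ → Ω → Vec d) (η : ℕ → Ω → ℝ) : Monotone (history ξ η) := by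
  intro s t hst
  exact sup_le_sup le_rfl (iSup_mono fun i => iSup_mono' fun hi => ⟨lt_of_lt_of_le hi hst, le_rfl⟩)

theorem measurable_draw_history {Ω : Type*} {d : ℕ} (ξ : ℕ → Ω → Vec d) (η : ℕ → Ω → ℝ) (i t : ℕ) :
    Measurable[history ξ η t] (ξ i) := by
  have h : MeasurableSpace.comap (ξ i) inferInstance ≤ history ξ η t :=
    le_sup_of_le_left (le_iSup (fun i => MeasurableSpace.comap (ξ i) inferInstance) i)
  exact (comap_measurable (ξ i)).mono h le_rfl

theorem measurable_noise_history {Ω : Type*} {d : ℕ} (ξ : ℕ → Ω → Vec d) (η : ℕ → Ω → ℝ) {i t : ℕ} (hi : i < t) :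
    Measurable[history ξ η t] (η i) := by
  have h : MeasurableSpace.comap (η i) inferInstance ≤ history ξ η t :=
    le_sup_of_le_right (le_iSup₂ (f := fun i (_ : i < t) =>
      MeasurableSpace.comap (η i) inferInstance) i hi)
  exact (comap_measurable (η i)).mono h le_rfl

variable {Ω : Type*} [MeasurableSpace Ω] [StandardBorelSpace Ω] {P : Measure Ω}
  [IsProbabilityMeasure P] {d : ℕ} {ξ : ℕ → Ω → Vec d} {η : ℕ → Ω → ℝ}

/-- The exponential supermartingale of noise with predictable weights. -/
theorem IsBanditRandomness.lintegral_exp_sum_le_one (h : IsBanditRandomness P ξ η)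
    {w : ℕ → Ω → ℝ} (hw : ∀ t, Measurable[history ξ η t] (w t)) (N : ℕ) :
    ∫⁻ ω, ENNReal.ofReal (Real.exp (∑ t ∈ Finset.range N, (w t ω * η t ω - w t ω ^ 2 / 2))) ∂P ≤
      1 := by
  induction N with
  | zero => simp
  | succ N ih =>
    have hm := history_le h.measurable_draw h.measurable_noise N
    set Z : Ω → ENNReal := fun ω =>
      ENNReal.ofReal (Real.exp (∑ t ∈ Finset.range N, (w t ω * η t ω - w t ω ^ 2 / 2))) with hZdef
    have hZ : Measurable[history ξ η N] Z := by
      refine ENNReal.measurable_ofReal.comp (Real.measurable_exp.comp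
        (Finset.measurable_sum _ fun t ht => ?_))
      have ht' := Finset.mem_range.1 ht
      have h1 : Measurable[history ξ η N] (w t) := (hw t).mono (history_mono ξ η ht'.le) le_rfl
      have h2 : Measurable[history ξ η N] (η t) := measurable_noise_history ξ η ht'
      exact (h1.mul h2).sub ((h1.pow_const 2).div_const 2)
    have key := @lintegral_mul_exp_le_of_hasSubgaussianMGF Ω Ω _ (history ξ η N) (P.trim hm) _
      (condExpKernel P (history ξ η N)) _ (η N) (h.subgaussian_noise N) (h.measurable_noise N)
      (w N) (hw N) Z hZ
    -- The composition with the conditional expectation kernel is the image of `P` on the diagonal,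
    -- so the two-variable bound becomes a bound along `ω`. The first factor carries the smaller
    -- σ-algebra of the history, hence the explicit instances below.
    rw [compProd_trim_condExpKernel hm, lintegral_trim hm hZ] at key
    have hF : @Measurable (Ω × Ω) ENNReal ((history ξ η N).prod inferInstance) _ fun z =>
        Z z.1 * ENNReal.ofReal (Real.exp (w N z.1 * η N z.2 - w N z.1 ^ 2 / 2)) := by
      have m1 : @Measurable (Ω × Ω) Ω ((history ξ η N).prod inferInstance) (history ξ η N) Prod.fst :=
        @measurable_fst Ω Ω (history ξ η N) _
      have m2 : @Measurable (Ω × Ω) Ω ((history ξ η N).prod inferInstance) _ Prod.snd :=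
        @measurable_snd Ω Ω (history ξ η N) _
      have h1 := (hw N).comp m1
      have h2 := (h.measurable_noise N).comp m2
      exact (hZ.comp m1).mul (ENNReal.measurable_ofReal.comp (Real.measurable_exp.comp
        ((h1.mul h2).sub ((h1.pow_const 2).div_const 2))))
    have hdiag : @Measurable Ω (Ω × Ω) _ ((history ξ η N).prod inferInstance) Function.diag :=
      @Measurable.prodMk Ω _ Ω Ω (history ξ η N) _ _ _ (measurable_id'' hm) measurable_id
    rw [@lintegral_map Ω (Ω × Ω) _ ((history ξ η N).prod inferInstance) _ _ _ hF hdiag] at key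
    refine le_trans (le_of_eq ?_) (key.trans ih)
    refine lintegral_congr fun ω => ?_
    rw [Finset.sum_range_succ, Real.exp_add, ENNReal.ofReal_mul (Real.exp_nonneg _)]
    rfl

/-- Tail bound for noise with predictable weights, on the event of a small quadratic variation. -/
theorem IsBanditRandomness.measure_sum_gt_le (h : IsBanditRandomness P ξ η)
    {w : ℕ → Ω → ℝ} (hw : ∀ t, Measurable[history ξ η t] (w t)) (N : ℕ) {a v : ℝ} (ha : 0 ≤ a)
    (hv : 0 < v) :
    P {ω | a < ∑ t ∈ Finset.range N, w t ω * η t ω ∧ ∑ t ∈ Finset.range N, w t ω ^ 2 ≤ v} ≤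
      ENNReal.ofReal (Real.exp (-(a ^ 2 / (2 * v)))) := by
  -- Scaling the weights by `a / v` optimizes the Chernoff bound on the event where the quadratic
  -- variation is at most `v`.
  have h1 := h.lintegral_exp_sum_le_one (w := fun t ω => a / v * w t ω)
    (fun t => (hw t).const_mul _) N
  set c := ENNReal.ofReal (Real.exp (a ^ 2 / (2 * v)))
  set Y : Ω → ENNReal := fun ω => ENNReal.ofReal (Real.exp (∑ t ∈ Finset.range N,
    (a / v * w t ω * η t ω - (a / v * w t ω) ^ 2 / 2)))
  have hY : Measurable Y := by
    refine ENNReal.measurable_ofReal.comp (Real.measurable_exp.comp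
        (Finset.measurable_sum _ fun t ht => ?_))
    have m1 : Measurable (w t) :=
      (hw t).mono (history_le h.measurable_draw h.measurable_noise t) le_rfl
    exact ((m1.const_mul _).mul (h.measurable_noise t)).sub
      (((m1.const_mul _).pow_const 2).div_const 2)
  have hsub : {ω | a < ∑ t ∈ Finset.range N, w t ω * η t ω ∧ ∑ t ∈ Finset.range N, w t ω ^ 2 ≤ v} ⊆
      {ω | c ≤ Y ω} := by
    rintro ω ⟨ha1, hv1⟩
    apply ENNReal.ofReal_le_ofReal
    apply Real.exp_le_exp.2
    have e : ∑ t ∈ Finset.range N, (a / v * w t ω * η t ω - (a / v * w t ω) ^ 2 / 2) =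
        a / v * ∑ t ∈ Finset.range N, w t ω * η t ω -
          (a / v) ^ 2 / 2 * ∑ t ∈ Finset.range N, w t ω ^ 2 := by
      rw [Finset.mul_sum, Finset.mul_sum, ← Finset.sum_sub_distrib]
      refine Finset.sum_congr rfl fun t _ => ?_
      ring
    rw [e]
    have h2 := mul_le_mul_of_nonneg_left ha1.le (div_nonneg ha hv.le)
    have h3 := mul_le_mul_of_nonneg_left hv1 (by positivity : 0 ≤ (a / v) ^ 2 / 2)
    have e1 : a / v * a = a ^ 2 / v := by ring
    have e2 : (a / v) ^ 2 / 2 * v = a ^ 2 / (2 * v) := by field_simp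
    have e3 : a ^ 2 / v = 2 * (a ^ 2 / (2 * v)) := by field_simp
    linarith
  have hc0 : c ≠ 0 := (ENNReal.ofReal_pos.2 (Real.exp_pos _)).ne'
  have h2 := mul_meas_ge_le_lintegral hY (μ := P) c
  rw [Real.exp_neg, ENNReal.ofReal_inv_of_pos (Real.exp_pos _)]
  refine (measure_mono hsub).trans ?_
  rw [← mul_one c⁻¹, ← ENNReal.div_eq_inv_mul,
    ENNReal.le_div_iff_mul_le (.inl hc0) (.inl ENNReal.ofReal_ne_top), mul_comm]
  exact h2.trans h1

theorem IsBanditRandomness.measure_abs_sum_gt_le (h : IsBanditRandomness P ξ η)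
    {w : ℕ → Ω → ℝ} (hw : ∀ t, Measurable[history ξ η t] (w t)) (N : ℕ) {a v : ℝ} (ha : 0 ≤ a)
    (hv : 0 < v) :
    P {ω | a < |∑ t ∈ Finset.range N, w t ω * η t ω| ∧ ∑ t ∈ Finset.range N, w t ω ^ 2 ≤ v} ≤
      ENNReal.ofReal (2 * Real.exp (-(a ^ 2 / (2 * v)))) := by
  have h1 := h.measure_sum_gt_le hw N ha hv
  have h2 := h.measure_sum_gt_le (w := fun t ω => -w t ω) (fun t => (hw t).neg) N ha hv
  rw [two_mul, ENNReal.ofReal_add (Real.exp_nonneg _) (Real.exp_nonneg _)]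
  refine le_trans (measure_mono ?_) ((measure_union_le _ _).trans (add_le_add h1 h2))
  rintro ω ⟨ha1, hv1⟩
  simp only [neg_mul, Finset.sum_neg_distrib, even_two, Even.neg_pow, Set.mem_union,
    Set.mem_ofPred_eq]
  rcases lt_abs.1 ha1 with h | h
  · exact .inl ⟨h, hv1⟩
  · exact .inr ⟨h, hv1⟩

/-- Tail bound for a block of noise with predictable weights. -/
theorem IsBanditRandomness.measure_abs_sum_block_gt_le (h : IsBanditRandomness P ξ η)
    {w : ℕ → Ω → ℝ} (t₀ : ℕ) (hw : ∀ u, Measurable[history ξ η (t₀ + u)] (w u)) (n : ℕ) {a v : ℝ}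
    (ha : 0 ≤ a) (hv : 0 < v) :
    P {ω | a < |∑ u ∈ Finset.range n, w u ω * η (t₀ + u) ω| ∧
        ∑ u ∈ Finset.range n, w u ω ^ 2 ≤ v} ≤
      ENNReal.ofReal (2 * Real.exp (-(a ^ 2 / (2 * v)))) := by
  -- The weights are extended by zero to the times before the block.
  have h1 := h.measure_abs_sum_gt_le (w := fun t ω => if t₀ ≤ t then w (t - t₀) ω else 0)
    (fun t => by
      by_cases ht : t₀ ≤ t
      · simp only [if_pos ht]
        have := hw (t - t₀)
        rwa [Nat.add_sub_cancel' ht] at this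
      · simp only [if_neg ht]
        exact measurable_const) (t₀ + n) ha hv
  refine le_trans (measure_mono fun ω hω => ?_) h1
  have e0 : ∀ t ∈ Finset.range t₀, ¬ t₀ ≤ t := fun t ht => by simpa using ht
  simp only [Set.mem_ofPred_eq, Finset.sum_range_add, le_add_iff_nonneg_right, zero_le, if_true,
    Nat.add_sub_cancel_left] at hω ⊢
  have e1 : ∑ t ∈ Finset.range t₀, (if t₀ ≤ t then w (t - t₀) ω else 0) * η t ω = 0 :=
    Finset.sum_eq_zero fun t ht => by rw [if_neg (e0 t ht), zero_mul]
  have e2 : ∑ t ∈ Finset.range t₀, (if t₀ ≤ t then w (t - t₀) ω else 0) ^ 2 = 0 :=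
    Finset.sum_eq_zero fun t ht => by rw [if_neg (e0 t ht)]; norm_num
  rw [e1, e2, zero_add, zero_add]
  exact hω

end Noise

/-! ### A good initial candidate -/

section Initial

/-- Some candidate has all its slots in the prescribed sets, except with small probability. -/
theorem measure_forall_not_mem_le {Ω : Type*} [MeasurableSpace Ω] {P : Measure Ω}
    [IsProbabilityMeasure P] {E : Type*} [MeasurableSpace E] {ν : Measure E} {ξ : ℕ → Ω → E}
    (hm : ∀ i, Measurable (ξ i)) (hind : iIndepFun ξ P) (hlaw : ∀ i, P.map (ξ i) = ν) {p : ℕ}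
    {S : Fin p → Set E} (hS : ∀ s, MeasurableSet (S s)) {q : ℝ} (hq : 0 ≤ q)
    (hSq : ∀ s, ENNReal.ofReal q ≤ ν (S s)) (L : ℕ) :
    P {ω | ∀ u < L, ¬ ∀ s : Fin p, ξ (u * p + s) ω ∈ S s} ≤
      ENNReal.ofReal (Real.exp (-(L * q ^ p))) := by
  have hGm : ∀ u, MeasurableSet {ω | ∀ s : Fin p, ξ (u * p + s) ω ∈ S s} := fun u => by
    rw [show {ω | ∀ s : Fin p, ξ (u * p + s) ω ∈ S s} = ⋂ s : Fin p, ξ (u * p + s) ⁻¹' S s by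
      ext; simp]
    exact .iInter fun s => hm _ (hS s)
  have hone : ∀ u, P {ω | ¬ ∀ s : Fin p, ξ (u * p + s) ω ∈ S s} ≤
      ENNReal.ofReal (Real.exp (-q ^ p)) := by
    intro u
    have h1 := (hind.precomp (g := fun s : Fin p => u * p + s.val) fun a b hab =>
      Fin.ext (by simpa using hab)).measure_inter_preimage_eq_mul Finset.univ
        (sets := S) fun s _ => hS s
    have h2 : ENNReal.ofReal (q ^ p) ≤ P {ω | ∀ s : Fin p, ξ (u * p + s) ω ∈ S s} := by
      rw [show {ω | ∀ s : Fin p, ξ (u * p + s) ω ∈ S s} =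
        ⋂ s ∈ Finset.univ, ξ (u * p + (s : Fin p).val) ⁻¹' S s by ext; simp, h1,
        ENNReal.ofReal_pow hq]
      calc ENNReal.ofReal q ^ p = ∏ _s : Fin p, ENNReal.ofReal q := by simp
        _ ≤ _ := Finset.prod_le_prod' fun s _ => by
          rw [← Measure.map_apply (hm _) (hS s), hlaw]
          exact hSq s
    have h3 : {ω | ¬ ∀ s : Fin p, ξ (u * p + s) ω ∈ S s} =
      {ω | ∀ s : Fin p, ξ (u * p + s) ω ∈ S s}ᶜ := rfl
    rw [h3, prob_compl_eq_one_sub (hGm u)]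
    calc 1 - P {ω | ∀ s : Fin p, ξ (u * p + s) ω ∈ S s} ≤ 1 - ENNReal.ofReal (q ^ p) :=
          tsub_le_tsub_left h2 _
      _ = ENNReal.ofReal (1 - q ^ p) := by
        rw [ENNReal.ofReal_sub _ (pow_nonneg hq _), ENNReal.ofReal_one]
      _ ≤ _ := ENNReal.ofReal_le_ofReal (by linarith [Real.add_one_le_exp (-q ^ p)])
  induction L with
  | zero => simp
  | succ L ih =>
    -- The draws of the candidate `L` are independent of those of all earlier candidates, so each
    -- candidate multiplies the failure probability by at most `exp (-q ^ p)`.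
    have hI := hind.indepFun_finset (Finset.range (L * p)) (Finset.Ico (L * p) (L * p + p))
      (Finset.disjoint_left.2 fun a h1 h2 => by
        have := Finset.mem_range.1 h1
        have := (Finset.mem_Ico.1 h2).1
        omega) hm
    set A : Set (Finset.range (L * p) → E) := {x | ∀ u : Fin L, ¬ ∀ s : Fin p,
      x ⟨u * p + s, Finset.mem_range.2 (by
        calc u.val * p + s.val < u.val * p + p := by omega
          _ = (u.val + 1) * p := by ring
          _ ≤ L * p := Nat.mul_le_mul_right _ u.2)⟩ ∈ S s}
    set B : Set (Finset.Ico (L * p) (L * p + p) → E) := {x | ¬ ∀ s : Fin p,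
      x ⟨L * p + s, Finset.mem_Ico.2 ⟨by omega, by omega⟩⟩ ∈ S s}
    have hA : MeasurableSet A := by
      rw [show A = ⋂ u : Fin L, (⋂ s : Fin p, (fun x : Finset.range (L * p) → E =>
        x ⟨u * p + s, Finset.mem_range.2 (by
        calc u.val * p + s.val < u.val * p + p := by omega
          _ = (u.val + 1) * p := by ring
          _ ≤ L * p := Nat.mul_le_mul_right _ u.2)⟩) ⁻¹' S s)ᶜ by ext; simp [A]]
      exact .iInter fun u => (MeasurableSet.iInter fun s => measurable_pi_apply _ (hS s)).compl
    have hB : MeasurableSet B := by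
      rw [show B = (⋂ s : Fin p, (fun x : Finset.Ico (L * p) (L * p + p) → E =>
        x ⟨L * p + s, Finset.mem_Ico.2 ⟨by omega, by omega⟩⟩) ⁻¹' S s)ᶜ by ext; simp [B]]
      exact (MeasurableSet.iInter fun s => measurable_pi_apply _ (hS s)).compl
    have h1 := hI.measure_inter_preimage_eq_mul A B hA hB
    have e : {ω | ∀ u < L + 1, ¬ ∀ s : Fin p, ξ (u * p + s) ω ∈ S s} =
        (fun ω (i : Finset.range (L * p)) => ξ i ω) ⁻¹' A ∩
        (fun ω (i : Finset.Ico (L * p) (L * p + p)) => ξ i ω) ⁻¹' B := by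
      ext ω
      simp only [Set.mem_ofPred_eq, Set.mem_inter_iff, Set.mem_preimage, A, B]
      refine ⟨fun h => ⟨fun u => h u (by omega), h L (by omega)⟩, fun h u hu => ?_⟩
      rcases Nat.lt_succ_iff_lt_or_eq.1 hu with hu | rfl
      · exact h.1 ⟨u, hu⟩
      · exact h.2
    have eA : (fun ω (i : Finset.range (L * p)) => ξ i ω) ⁻¹' A =
        {ω | ∀ u < L, ¬ ∀ s : Fin p, ξ (u * p + s) ω ∈ S s} := by
      ext ω
      exact ⟨fun h u hu => h ⟨u, hu⟩, fun h u => h u u.2⟩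
    rw [e, h1, eA]
    refine (mul_le_mul' ih (hone L)).trans (le_of_eq ?_)
    rw [← ENNReal.ofReal_mul (Real.exp_nonneg _), ← Real.exp_add]
    congr 2
    push_cast
    ring

end Initial

/-! ### Rewards in orthonormal bases -/

section Reward

variable {d p : ℕ}

/-- The reward `∑ᵢ Λᵢ ∏ₛ ⟨bᵢ(s), a(s)⟩` for orthonormal bases `b(s)`. -/
def basisReward (Λ : Fin d → ℝ) (b : Fin p → OrthonormalBasis (Fin d) ℝ (Vec d))
    (a : Action d p) : ℝ :=
  ∑ i, Λ i * ∏ s, inner ℝ (b s i) (a s : Vec d)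

/-- Completing each orthonormal system to a basis, with zero coefficients on the added vectors,
makes Parseval's identity available. The support `K` keeps track of the rank `k`, so that an initial
candidate has to win against `k - 1` coordinates rather than `d - 1`. -/
theorem OrthTensor.exists_basisReward {k : ℕ} [NeZero k] {lam : ℝ} (hlam : 0 < lam)
    (T : OrthTensor d p k lam) (hp : 0 < p) :
    ∃ (b : Fin p → OrthonormalBasis (Fin d) ℝ (Vec d)) (Λ : Fin d → ℝ) (K : Finset (Fin d))
      (i₀ : Fin d), i₀ ∈ K ∧ K.card = k ∧ Λ i₀ = lam ∧ (∀ i, |Λ i| ≤ lam) ∧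
        (∀ i, i ∉ K → Λ i = 0) ∧ T.reward = basisReward Λ b := by
  have hkd : k ≤ d := by
    have := (T.orthonormal_vec ⟨0, hp⟩).linearIndependent.fintype_card_le_finrank
    simpa using this
  set ι : Fin k → Fin d := Fin.castLE hkd
  have hι : Function.Injective ι := Fin.castLE_injective hkd
  have hb : ∀ s, ∃ b : OrthonormalBasis (Fin d) ℝ (Vec d), ∀ j, b (ι j) = T.vec s j := by
    intro s
    set v : Fin d → Vec d := Function.extend ι (T.vec s) 0
    have hv : ∀ j, v (ι j) = T.vec s j := fun j => hι.extend_apply _ _ j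
    have hon : Orthonormal ℝ ((Set.range ι).domRestrict v) := by
      have h := (T.orthonormal_vec s).comp (Equiv.ofInjective ι hι).symm (Equiv.injective _)
      convert h using 1
      funext x
      obtain ⟨x, j, rfl⟩ := x
      exact (hv j).trans (congrArg (T.vec s) (Equiv.ofInjective_symm_apply hι j).symm)
    obtain ⟨b, hb⟩ := hon.exists_orthonormalBasis_extension_of_card_eq (by simp)
    exact ⟨b, fun j => (hb _ ⟨j, rfl⟩).trans (hv j)⟩
  choose b hb using hb
  have hcoeff : ∀ j, |T.coeff j| ≤ lam := fun j => by
    have := T.abs_coeff_antitone 0 j (Fin.zero_le _)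
    rwa [T.coeff_zero, abs_of_pos hlam] at this
  refine ⟨b, Function.extend ι T.coeff 0, Finset.univ.map ⟨ι, hι⟩, ι 0, by simp, by simp, ?_, ?_, ?_, ?_⟩
  · rw [hι.extend_apply, T.coeff_zero]
  · intro i
    by_cases h : ∃ j, ι j = i
    · obtain ⟨j, rfl⟩ := h
      rw [hι.extend_apply]
      exact hcoeff j
    · rw [Function.extend_apply' _ _ _ h]
      simpa using hlam.le
  · intro i hi
    rw [Function.extend_apply' _ _ _ (by simpa using hi)]
    rfl
  · funext a
    rw [OrthTensor.reward, basisReward]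
    refine Finset.sum_of_injOn ι hι.injOn (fun _ _ => Finset.mem_coe.2 (Finset.mem_univ _)) ?_ ?_
    · intro i _ hi
      rw [Function.extend_apply' _ _ _ (by simpa using hi)]
      simp
    · intro j _
      rw [hι.extend_apply]
      simp only [hb]

variable {Λ : Fin d → ℝ} {b : Fin p → OrthonormalBasis (Fin d) ℝ (Vec d)} {lam : ℝ}

theorem sum_inner_sq (b : OrthonormalBasis (Fin d) ℝ (Vec d)) (x : Vec d) :
    ∑ i, inner ℝ (b i) x ^ 2 = ‖x‖ ^ 2 := by
  rw [← b.sum_sq_norm_inner_right x]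
  simp

theorem abs_inner_basis_le_one (b : OrthonormalBasis (Fin d) ℝ (Vec d)) (i : Fin d) {x : Vec d}
    (hx : ‖x‖ ≤ 1) : |inner ℝ (b i) x| ≤ 1 := by
  have h := abs_real_inner_le_norm (b i) x
  rw [b.norm_eq_one, one_mul] at h
  exact h.trans hx

/-- The products over at least two slots of the coordinates of an action have sum at most `1`. -/
theorem sum_prod_abs_inner_le_one (a : Action d p) {S : Finset (Fin p)} (hS : 1 < S.card) :
    ∑ i, ∏ s ∈ S, |inner ℝ (b s i) (a s : Vec d)| ≤ 1 := by
  obtain ⟨s₁, h₁, s₂, h₂, hne⟩ := Finset.one_lt_card.1 hS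
  -- All factors but two are bounded by `1`; the arithmetic-geometric mean inequality for these two
  -- leaves squares that sum by Parseval.
  have h : ∀ i, ∏ s ∈ S, |inner ℝ (b s i) (a s : Vec d)| ≤
      (inner ℝ (b s₁ i) (a s₁ : Vec d) ^ 2 + inner ℝ (b s₂ i) (a s₂ : Vec d) ^ 2) / 2 := by
    intro i
    have hsub : {s₁, s₂} ⊆ S := by
      intro s hs
      rcases Finset.mem_insert.1 hs with rfl | hs
      · exact h₁
      · rwa [Finset.mem_singleton.1 hs]
    rw [← Finset.prod_sdiff hsub, Finset.prod_pair hne]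
    have h1 : ∏ s ∈ S \ {s₁, s₂}, |inner ℝ (b s i) (a s : Vec d)| ≤ 1 :=
      Finset.prod_le_one (fun _ _ => abs_nonneg _) fun s _ => abs_inner_basis_le_one _ _ (a s).2
    refine (mul_le_of_le_one_left (by positivity) h1).trans ?_
    nlinarith [sq_nonneg (|inner ℝ (b s₁ i) (a s₁ : Vec d)| - |inner ℝ (b s₂ i) (a s₂ : Vec d)|),
      sq_abs (inner ℝ (b s₁ i) (a s₁ : Vec d)), sq_abs (inner ℝ (b s₂ i) (a s₂ : Vec d))]
  refine (Finset.sum_le_sum fun i _ => h i).trans ?_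
  rw [← Finset.sum_div, Finset.sum_add_distrib, sum_inner_sq, sum_inner_sq]
  have e1 := pow_le_one₀ (n := 2) (norm_nonneg _) (a s₁).2
  have e2 := pow_le_one₀ (n := 2) (norm_nonneg _) (a s₂).2
  linarith

theorem abs_basisReward_le (hΛ : ∀ i, |Λ i| ≤ lam) (hlam : 0 ≤ lam) (hp : 1 < p)
    (a : Action d p) : |basisReward Λ b a| ≤ lam := by
  calc |basisReward Λ b a| ≤ ∑ i, |Λ i * ∏ s, inner ℝ (b s i) (a s : Vec d)| :=
        Finset.abs_sum_le_sum_abs _ _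
    _ ≤ ∑ i, lam * ∏ s, |inner ℝ (b s i) (a s : Vec d)| := by
        refine Finset.sum_le_sum fun i _ => ?_
        rw [abs_mul, Finset.abs_prod]
        exact mul_le_mul_of_nonneg_right (hΛ i) (Finset.prod_nonneg fun _ _ => abs_nonneg _)
    _ = lam * ∑ i, ∏ s, |inner ℝ (b s i) (a s : Vec d)| := (Finset.mul_sum _ _ _).symm
    _ ≤ lam := mul_le_of_le_one_right hlam (sum_prod_abs_inner_le_one a (by simpa using hp))

theorem optReward_basisReward_le (hΛ : ∀ i, |Λ i| ≤ lam) (hlam : 0 ≤ lam) (hp : 1 < p) :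
    optReward (basisReward Λ b) ≤ lam :=
  have : Nonempty (Action d p) := ⟨fun _ => normalize 0⟩
  ciSup_le fun a => (le_abs_self _).trans (abs_basisReward_le hΛ hlam hp a)

theorem basisReward_le_optReward (hΛ : ∀ i, |Λ i| ≤ lam) (hlam : 0 ≤ lam) (hp : 1 < p)
    (a : Action d p) : basisReward Λ b a ≤ optReward (basisReward Λ b) :=
  le_ciSup (f := basisReward Λ b) ⟨lam, by
    rintro _ ⟨a, rfl⟩
    exact (le_abs_self _).trans (abs_basisReward_le hΛ hlam hp a)⟩ a

/-- The coordinates of the gradient of the reward in slot `j`. -/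
def slotGrad (Λ : Fin d → ℝ) (b : Fin p → OrthonormalBasis (Fin d) ℝ (Vec d)) (j : Fin p)
    (a : Action d p) (i : Fin d) : ℝ :=
  Λ i * ∏ s ∈ Finset.univ.erase j, inner ℝ (b s i) (a s : Vec d)

theorem basisReward_update (j : Fin p) (a : Action d p) (x : UnitBall d) :
    basisReward Λ b (Function.update a j x) =
      ∑ i, slotGrad Λ b j a i * inner ℝ (b j i) (x : Vec d) := by
  refine Finset.sum_congr rfl fun i _ => ?_
  rw [slotGrad, ← Finset.mul_prod_erase _ _ (Finset.mem_univ j), Function.update_self]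
  rw [Finset.prod_congr rfl fun s hs => by
    rw [Function.update_of_ne (Finset.ne_of_mem_erase hs)]]
  ring

/-- This is where `p ≥ 3` enters the estimation: two slots remain after removing `j`. An `ℓ¹` bound
on the gradient means that entrywise control of the empirical covariance suffices, with no loss in
the dimension. -/
theorem sum_abs_slotGrad_le (hΛ : ∀ i, |Λ i| ≤ lam) (hlam : 0 ≤ lam) (hp : 3 ≤ p) (j : Fin p)
    (a : Action d p) : ∑ i, |slotGrad Λ b j a i| ≤ lam := by
  calc ∑ i, |slotGrad Λ b j a i|
      ≤ ∑ i, lam * ∏ s ∈ Finset.univ.erase j, |inner ℝ (b s i) (a s : Vec d)| := by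
        refine Finset.sum_le_sum fun i _ => ?_
        rw [slotGrad, abs_mul, Finset.abs_prod]
        exact mul_le_mul_of_nonneg_right (hΛ i) (Finset.prod_nonneg fun _ _ => abs_nonneg _)
    _ = lam * ∑ i, ∏ s ∈ Finset.univ.erase j, |inner ℝ (b s i) (a s : Vec d)| :=
        (Finset.mul_sum _ _ _).symm
    _ ≤ lam := mul_le_of_le_one_right hlam (sum_prod_abs_inner_le_one a (by
        rw [Finset.card_erase_of_mem (Finset.mem_univ j), Finset.card_univ, Fintype.card_fin]
        omega))

theorem measurable_basisReward : Measurable (basisReward Λ b) := by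
  unfold basisReward
  have h : ∀ s i, Measurable fun a : Action d p => inner ℝ (b s i) (a s : Vec d) := fun s i => by
    have h1 : Measurable fun a : Action d p => (a s : Vec d) :=
      measurable_subtype_coe.comp (measurable_pi_apply s)
    fun_prop
  fun_prop

end Reward

/-! ### The estimator of the gradient -/

section Estimator

variable {d p : ℕ} {Λ : Fin d → ℝ} {b : Fin p → OrthonormalBasis (Fin d) ℝ (Vec d)} {lam : ℝ}

/-- The regularity of a block of `n` perturbations `x` and noise variables `e`. -/
structure BlockGood (b : OrthonormalBasis (Fin d) ℝ (Vec d)) (n : ℕ) (m ρ : ℝ) (x : ℕ → Vec d)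
    (e : ℕ → ℝ) : Prop where
  norm_le : ∀ u < n, ‖x u‖ ^ 2 ≤ m
  quad : ∀ i l, |(n : ℝ)⁻¹ * ∑ u ∈ Finset.range n, inner ℝ (b i) (x u) * inner ℝ (b l) (x u) -
    if i = l then 1 else 0| ≤ ρ
  noise : ∀ i, |(n : ℝ)⁻¹ * ∑ u ∈ Finset.range n, inner ℝ (b i) (x u) * e u| ≤ ρ

theorem clip_of_norm_le {x : Vec d} (hx : ‖x‖ ≤ 1) : (clip x : Vec d) = x := by
  simp [clip, max_eq_left hx]

/-- In coordinates, `m y` is the empirical covariance applied to the gradient, plus `√m` times the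
averaged noise. The first part errs by at most `ρ` times the `ℓ¹` norm of the gradient, the second
by `√m ρ`. Only the block enters the hypothesis, so the bound holds for every action, including one
that depends on the data. -/
theorem abs_slotMean_sub_slotGrad_le (hΛ : ∀ i, |Λ i| ≤ lam) (hlam : 0 ≤ lam) (hlam1 : lam ≤ 1)
    (hp : 3 ≤ p) {n : ℕ} {m ρ : ℝ} (hm : 1 ≤ m) (hρ : 0 ≤ ρ) {ξ : ℕ → Vec d} {η : ℕ → ℝ}
    {j : Fin p} {i₀ t₀ : ℕ}
    (h : BlockGood (b j) n m ρ (fun u => ξ (i₀ + u)) (fun u => η (t₀ + u)))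
    (a : Action d p) (i : Fin d) :
    |m * inner ℝ (b j i) (slotMean (basisReward Λ b) ξ η n m 1 j i₀ t₀ a) - slotGrad Λ b j a i| ≤
      2 * Real.sqrt m * ρ := by
  set g := slotGrad Λ b j a
  have hm0 : 0 < m := by linarith
  have hsm : 0 < Real.sqrt m := Real.sqrt_pos.2 hm0
  have hsm2 : Real.sqrt m * Real.sqrt m = m := Real.mul_self_sqrt hm0.le
  have hsm1 : 1 ≤ Real.sqrt m := Real.one_le_sqrt.2 hm
  -- With weight `1` the tentative slot is the perturbation alone, and `‖ξ‖ ^ 2 ≤ m` means that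
  -- clipping does nothing, so the reward is exactly linear in it.
  have hval : ∀ u < n, basisReward Λ b (tentative 1 a j ((Real.sqrt m)⁻¹ • ξ (i₀ + u))) =
      (Real.sqrt m)⁻¹ * ∑ l, g l * inner ℝ (b j l) (ξ (i₀ + u)) := by
    intro u hu
    have hn : ‖(Real.sqrt m)⁻¹ • ξ (i₀ + u)‖ ≤ 1 := by
      rw [norm_smul, norm_inv, Real.norm_of_nonneg hsm.le, inv_mul_le_iff₀ hsm, mul_one]
      exact Real.le_sqrt_of_sq_le (h.norm_le u hu)
    rw [tentative, basisReward_update, sub_self, zero_smul, zero_add, one_smul, clip_of_norm_le hn,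
      Finset.mul_sum]
    refine Finset.sum_congr rfl fun l _ => ?_
    rw [real_inner_smul_right]
    ring
  have hmean : m * inner ℝ (b j i) (slotMean (basisReward Λ b) ξ η n m 1 j i₀ t₀ a) =
      ∑ l, g l * ((n : ℝ)⁻¹ * ∑ u ∈ Finset.range n,
        inner ℝ (b j i) (ξ (i₀ + u)) * inner ℝ (b j l) (ξ (i₀ + u))) +
      Real.sqrt m * ((n : ℝ)⁻¹ * ∑ u ∈ Finset.range n,
        inner ℝ (b j i) (ξ (i₀ + u)) * η (t₀ + u)) := by
    rw [slotMean, real_inner_smul_right, ← List.sum_toFinset _ List.nodup_range,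
      List.toFinset_range, inner_sum]
    have e : ∀ u ∈ Finset.range n, inner ℝ (b j i)
        ((basisReward Λ b (tentative 1 a j ((Real.sqrt m)⁻¹ • ξ (i₀ + u))) + η (t₀ + u)) •
          ((Real.sqrt m)⁻¹ • ξ (i₀ + u))) =
        m⁻¹ * (∑ l, g l * (inner ℝ (b j i) (ξ (i₀ + u)) * inner ℝ (b j l) (ξ (i₀ + u))) +
          Real.sqrt m * (inner ℝ (b j i) (ξ (i₀ + u)) * η (t₀ + u))) := by
      intro u hu
      rw [hval u (Finset.mem_range.1 hu), real_inner_smul_right, real_inner_smul_right]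
      have e1 : ∑ l, g l * (inner ℝ (b j i) (ξ (i₀ + u)) * inner ℝ (b j l) (ξ (i₀ + u))) =
          inner ℝ (b j i) (ξ (i₀ + u)) * ∑ l, g l * inner ℝ (b j l) (ξ (i₀ + u)) := by
        rw [Finset.mul_sum]
        exact Finset.sum_congr rfl fun l _ => by ring
      have e3 : m⁻¹ = (Real.sqrt m)⁻¹ * (Real.sqrt m)⁻¹ := by rw [← mul_inv, hsm2]
      rw [e1, e3]
      field_simp
    rw [Finset.sum_congr rfl e, ← Finset.mul_sum, Finset.sum_add_distrib, Finset.sum_comm]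
    have e2 : m * ((n : ℝ)⁻¹ * (m⁻¹ * (∑ l, ∑ u ∈ Finset.range n,
        g l * (inner ℝ (b j i) (ξ (i₀ + u)) * inner ℝ (b j l) (ξ (i₀ + u))) +
        ∑ u ∈ Finset.range n, Real.sqrt m * (inner ℝ (b j i) (ξ (i₀ + u)) * η (t₀ + u))))) =
        (n : ℝ)⁻¹ * (∑ l, ∑ u ∈ Finset.range n,
        g l * (inner ℝ (b j i) (ξ (i₀ + u)) * inner ℝ (b j l) (ξ (i₀ + u))) +
        ∑ u ∈ Finset.range n, Real.sqrt m * (inner ℝ (b j i) (ξ (i₀ + u)) * η (t₀ + u))) := by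
      field_simp
    rw [e2, mul_add, Finset.mul_sum, ← Finset.mul_sum (Finset.range n) _ (Real.sqrt m)]
    congr 1
    · refine Finset.sum_congr rfl fun l _ => ?_
      rw [← Finset.mul_sum]
      ring
    · ring
  have hgi : g i = ∑ l, g l * (if i = l then 1 else 0) := by simp
  rw [hmean, hgi, add_sub_right_comm, ← Finset.sum_sub_distrib]
  have h1 : |∑ l, (g l * ((n : ℝ)⁻¹ * ∑ u ∈ Finset.range n,
        inner ℝ (b j i) (ξ (i₀ + u)) * inner ℝ (b j l) (ξ (i₀ + u))) -
        g l * (if i = l then 1 else 0))| ≤ ρ := by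
    refine (Finset.abs_sum_le_sum_abs _ _).trans ?_
    calc _ ≤ ∑ l, |g l| * ρ := by
          refine Finset.sum_le_sum fun l _ => ?_
          rw [← mul_sub, abs_mul]
          exact mul_le_mul_of_nonneg_left (h.quad i l) (abs_nonneg _)
      _ = (∑ l, |g l|) * ρ := (Finset.sum_mul _ _ _).symm
      _ ≤ ρ := mul_le_of_le_one_left hρ ((sum_abs_slotGrad_le hΛ hlam hp j a).trans hlam1)
  have h2 : |Real.sqrt m * ((n : ℝ)⁻¹ * ∑ u ∈ Finset.range n,
        inner ℝ (b j i) (ξ (i₀ + u)) * η (t₀ + u))| ≤ Real.sqrt m * ρ := by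
    rw [abs_mul, abs_of_pos hsm]
    exact mul_le_mul_of_nonneg_left (h.noise i) hsm.le
  refine (abs_add_le _ _).trans ((add_le_add h1 h2).trans ?_)
  nlinarith

end Estimator

/-! ### Convergence of the alternating power iteration -/

section Iteration

/-- If every pass of a loop over slots changes only its own slot, preserving `Old` and making `New`
true there, then `New` holds in all slots visited. -/
theorem iter_slots {α : Type} {p : ℕ} {Old New : Fin p → α → Prop}
    (hNO : ∀ s x, New s x → Old s x) {F : Fin p → ℕ → ℕ → (Fin p → α) → Fin p → α} {n D : ℕ}
    (hF : ∀ j i t a s, s ≠ j → F j i t a s = a s)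
    (hN : ∀ j i t a, i ≤ D → t ≤ D → (∀ s, Old s (a s)) → New j (F j i t a j)) (l : List (Fin p))
    (i t : ℕ) (hi : i + l.length * n ≤ D + n) (ht : t + l.length * n ≤ D + n) (a : Fin p → α)
    (ha : ∀ s, Old s (a s)) (hl : ∀ s, s ∉ l → New s (a s)) :
    ∀ s, New s (iter F n n l i t a s) := by
  induction l generalizing i t a with
  | nil => exact fun s => hl s List.not_mem_nil
  | cons j l ih =>
    rw [List.length_cons, Nat.add_mul, Nat.one_mul] at hi ht
    have hj := hN j i t a (by omega) (by omega) ha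
    refine ih (i + n) (t + n) (by omega) (by omega) (F j i t a) ?_ ?_
    · intro s
      by_cases hs : s = j
      · subst hs
        exact hNO _ _ hj
      · rw [hF j i t a s hs]
        exact ha s
    · intro s hs
      by_cases hsj : s = j
      · subst hsj
        exact hj
      · rw [hF j i t a s hsj]
        exact hl s (by simp [hsj, hs])

/-- A property established by every pass of a loop holds after a nonempty loop. -/
theorem iter_of_step {α β : Type} {N : α → Prop} {F : β → ℕ → ℕ → α → α} {n D : ℕ}
    (hF : ∀ b i t a, i + n ≤ D → t + n ≤ D → N (F b i t a)) (l : List β) (hl : l ≠ []) (i t : ℕ)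
    (hi : i + l.length * n ≤ D) (ht : t + l.length * n ≤ D) (a : α) :
    N (iter F n n l i t a) := by
  induction l generalizing i t a with
  | nil => exact absurd rfl hl
  | cons c l ih =>
    rw [List.length_cons, Nat.add_mul, Nat.one_mul] at hi ht
    by_cases h : l = []
    · subst h
      simp only [List.length_nil] at hi ht
      exact hF c i t a (by omega) (by omega)
    · exact ih h (i + n) (t + n) (by omega) (by omega) _

/-- A sequence of properties climbed by the passes of a loop. -/
theorem iter_chain {α β : Type} {N : ℕ → α → Prop} {F : β → ℕ → ℕ → α → α} {n D : ℕ}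
    (hF : ∀ q b i t a, i + n ≤ D → t + n ≤ D → N q a → N (q + 1) (F b i t a)) (l : List β) (q i t : ℕ)
    (hi : i + l.length * n ≤ D) (ht : t + l.length * n ≤ D) (a : α) (ha : N q a) :
    N (q + l.length) (iter F n n l i t a) := by
  induction l generalizing q i t a with
  | nil => exact ha
  | cons c l ih =>
    rw [List.length_cons, Nat.add_mul, Nat.one_mul] at hi ht
    rw [List.length_cons, show q + (l.length + 1) = q + 1 + l.length by ring]
    exact ih (q + 1) (i + n) (t + n) (by omega) (by omega) _ (hF q c i t a (by omega) (by omega) ha)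

variable {d p : ℕ}

/-- The coordinate `i₀` of `x` in the basis `b` is at least `x₀` and dominates those in `K`. -/
def Leads (b : OrthonormalBasis (Fin d) ℝ (Vec d)) (K : Finset (Fin d)) (i₀ : Fin d) (x₀ r : ℝ)
    (x : UnitBall d) : Prop :=
  x₀ ≤ inner ℝ (b i₀) (x : Vec d) ∧
    ∀ i ∈ K, i ≠ i₀ → |inner ℝ (b i) (x : Vec d)| ≤ r * inner ℝ (b i₀) (x : Vec d)

/-- The vector `x` has unit length and its coordinate `i₀` dominates all others. -/
def Dominates (b : OrthonormalBasis (Fin d) ℝ (Vec d)) (i₀ : Fin d) (r : ℝ)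
    (x : UnitBall d) : Prop :=
  ‖(x : Vec d)‖ = 1 ∧ 0 < inner ℝ (b i₀) (x : Vec d) ∧
    ∀ i, i ≠ i₀ → |inner ℝ (b i) (x : Vec d)| ≤ r * inner ℝ (b i₀) (x : Vec d)

theorem Dominates.mono {b : OrthonormalBasis (Fin d) ℝ (Vec d)} {i₀ : Fin d} {r r' : ℝ}
    {x : UnitBall d} (h : Dominates b i₀ r x) (hr : r ≤ r') : Dominates b i₀ r' x :=
  ⟨h.1, h.2.1, fun i hi => (h.2.2 i hi).trans (mul_le_mul_of_nonneg_right hr h.2.1.le)⟩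

/-- Parseval for a unit vector: the at most `d` other coordinates each contribute at most `r ^ 2`
times the square of the leading one. -/
theorem Dominates.one_le {b : OrthonormalBasis (Fin d) ℝ (Vec d)} {i₀ : Fin d} {r : ℝ}
    {x : UnitBall d} (h : Dominates b i₀ r x) :
    1 ≤ inner ℝ (b i₀) (x : Vec d) ^ 2 * (1 + d * r ^ 2) := by
  have h1 := sum_inner_sq b (x : Vec d)
  rw [h.1, one_pow, ← Finset.add_sum_erase _ _ (Finset.mem_univ i₀)] at h1
  have h2 : ∑ i ∈ Finset.univ.erase i₀, inner ℝ (b i) (x : Vec d) ^ 2 ≤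
      ∑ _i ∈ Finset.univ.erase i₀, (r * inner ℝ (b i₀) (x : Vec d)) ^ 2 := by
    refine Finset.sum_le_sum fun i hi => ?_
    rw [← sq_abs]
    exact pow_le_pow_left₀ (abs_nonneg _) (h.2.2 i (Finset.ne_of_mem_erase hi)) 2
  rw [Finset.sum_const, nsmul_eq_mul] at h2
  have h3 : ((Finset.univ.erase i₀).card : ℝ) ≤ d := by
    have := Finset.card_le_univ (Finset.univ.erase i₀)
    rw [Fintype.card_fin] at this
    exact_mod_cast this
  nlinarith [mul_le_mul_of_nonneg_right h3 (sq_nonneg (r * inner ℝ (b i₀) (x : Vec d)))]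

theorem Dominates.inv_sqrt_le {b : OrthonormalBasis (Fin d) ℝ (Vec d)} {i₀ : Fin d} {r : ℝ}
    {x : UnitBall d} (h : Dominates b i₀ r x) :
    (Real.sqrt (1 + d * r ^ 2))⁻¹ ≤ inner ℝ (b i₀) (x : Vec d) := by
  have hpos : 0 < 1 + d * r ^ 2 := by positivity
  rw [← Real.sqrt_inv]
  refine Real.sqrt_le_iff.2 ⟨h.2.1.le, ?_⟩
  rw [inv_le_iff_one_le_mul₀ hpos]
  exact h.one_le

/-- One power update in slot `j`, when the other slots are led by `i₀`. -/
theorem dominates_normalize {Λ : Fin d → ℝ} {b : Fin p → OrthonormalBasis (Fin d) ℝ (Vec d)}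
    {K : Finset (Fin d)} {i₀ : Fin d} {lam γ r x₀ τ m : ℝ} (hp : 3 ≤ p) (hlam : 0 < lam)
    (hΛ₀ : Λ i₀ = lam) (hΛ : ∀ i, |Λ i| ≤ lam) (hΛK : ∀ i, i ∉ K → Λ i = 0) (hγ : 0 < γ)
    (hγ1 : γ ≤ 1 / 4) (hr0 : 0 < r) (hr : r * (1 + γ) ≤ 1) (hx₀ : 0 < x₀) (hm : 0 < m)
    (hτ : τ ≤ γ / 16 * r * (lam * x₀ ^ (p - 1))) (j : Fin p) (a : Action d p)
    (ha : ∀ s, s ≠ j → Leads (b s) K i₀ x₀ r (a s)) (y : Vec d)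
    (hy : ∀ i, |m * inner ℝ (b j i) y - slotGrad Λ b j a i| ≤ τ) :
    Dominates (b j) i₀ ((1 - γ / 4) * r) (normalize y) := by
  have hcard : (Finset.univ.erase j).card = p - 1 := by
    rw [Finset.card_erase_of_mem (Finset.mem_univ j), Finset.card_univ, Fintype.card_fin]
  have hpos : ∀ s, s ≠ j → 0 < inner ℝ (b s i₀) (a s : Vec d) :=
    fun s hs => hx₀.trans_le (ha s hs).1
  set G := slotGrad Λ b j a i₀ with hGdef
  have hG : lam * x₀ ^ (p - 1) ≤ G := by
    rw [hGdef, slotGrad, hΛ₀]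
    refine mul_le_mul_of_nonneg_left ?_ hlam.le
    rw [← hcard, ← Finset.prod_const]
    exact Finset.prod_le_prod (fun _ _ => hx₀.le) fun s hs => (ha s (Finset.ne_of_mem_erase hs)).1
  have hG0 : 0 < G := lt_of_lt_of_le (by positivity) hG
  have hr1 : r ≤ 1 := by nlinarith
  have hτG : τ ≤ γ / 16 * r * G := hτ.trans (mul_le_mul_of_nonneg_left hG (by positivity))
  -- The source of the contraction: the gradient multiplies the ratios of `p - 1 ≥ 2` slots. Outside
  -- `K` it vanishes, so after one update the leading coordinate dominates all others although only
  -- those in `K` were controlled.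
  have hg : ∀ i, i ≠ i₀ → |slotGrad Λ b j a i| ≤ r ^ 2 * G := by
    intro i hi
    by_cases hiK : i ∈ K
    · rw [hGdef, slotGrad, slotGrad, abs_mul, Finset.abs_prod, hΛ₀]
      calc |Λ i| * ∏ s ∈ Finset.univ.erase j, |inner ℝ (b s i) (a s : Vec d)|
          ≤ lam * ∏ s ∈ Finset.univ.erase j, (r * inner ℝ (b s i₀) (a s : Vec d)) := by
            refine mul_le_mul (hΛ i) (Finset.prod_le_prod (fun _ _ => abs_nonneg _) fun s hs =>
              (ha s (Finset.ne_of_mem_erase hs)).2 i hiK hi)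
              (Finset.prod_nonneg fun _ _ => abs_nonneg _) hlam.le
        _ = r ^ (p - 1) * (lam * ∏ s ∈ Finset.univ.erase j, inner ℝ (b s i₀) (a s : Vec d)) := by
            rw [Finset.prod_mul_distrib, Finset.prod_const, hcard]
            ring
        _ ≤ r ^ 2 * (lam * ∏ s ∈ Finset.univ.erase j, inner ℝ (b s i₀) (a s : Vec d)) := by
            refine mul_le_mul_of_nonneg_right
              (pow_le_pow_of_le_one hr0.le hr1 (by omega)) (mul_nonneg hlam.le
                (Finset.prod_nonneg fun s hs => (hpos s (Finset.ne_of_mem_erase hs)).le))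
    · rw [slotGrad, hΛK i hiK, zero_mul, abs_zero]
      positivity
  have hy0 : (1 - γ / 16) * G ≤ m * inner ℝ (b j i₀) y := by
    have h1 := (abs_le.1 (hy i₀)).1
    have h2 : γ / 16 * r * G ≤ γ / 16 * G :=
      mul_le_mul_of_nonneg_right (mul_le_of_le_one_right (by positivity) hr1) hG0.le
    linarith
  have hy0pos : 0 < inner ℝ (b j i₀) y := by
    have : 0 < m * inner ℝ (b j i₀) y := lt_of_lt_of_le (mul_pos (by linarith) hG0) hy0
    exact pos_of_mul_pos_right this hm.le
  have hyi : ∀ i, i ≠ i₀ → |inner ℝ (b j i) y| ≤ (1 - γ / 4) * r * inner ℝ (b j i₀) y := by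
    intro i hi
    have h1 : |m * inner ℝ (b j i) y| ≤ r ^ 2 * G + γ / 16 * r * G := by
      have := abs_sub_abs_le_abs_sub (m * inner ℝ (b j i) y) (slotGrad Λ b j a i)
      linarith [hy i, hg i hi]
    rw [abs_mul, abs_of_pos hm] at h1
    -- The margin beats the noise: after division by `r G` the next inequality is `r + γ / 16 ≤ (1 -
    -- γ / 4) (1 - γ / 16)`.
    have h2 : r ≤ 1 - 3 / 4 * γ := by nlinarith
    have h3 : r ^ 2 * G + γ / 16 * r * G ≤ (1 - γ / 4) * r * ((1 - γ / 16) * G) := by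
      have : r + γ / 16 ≤ (1 - γ / 4) * (1 - γ / 16) := by nlinarith
      nlinarith [mul_le_mul_of_nonneg_right this (mul_pos hr0 hG0).le]
    have h4 : (1 - γ / 4) * r * ((1 - γ / 16) * G) ≤
        (1 - γ / 4) * r * (m * inner ℝ (b j i₀) y) :=
      mul_le_mul_of_nonneg_left hy0 (mul_nonneg (by linarith) hr0.le)
    have h5 : m * |inner ℝ (b j i) y| ≤ m * ((1 - γ / 4) * r * inner ℝ (b j i₀) y) := by
      linarith
    exact le_of_mul_le_mul_left h5 hm
  have hyne : y ≠ 0 := by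
    rintro rfl
    simp at hy0pos
  have hn : 0 < ‖y‖ := norm_pos_iff.2 hyne
  have hval : ∀ i, inner ℝ (b j i) (normalize y : Vec d) = ‖y‖⁻¹ * inner ℝ (b j i) y := fun i => by
    simp [normalize, real_inner_smul_right]
  refine ⟨?_, ?_, fun i hi => ?_⟩
  · simp [normalize, norm_smul, hn.ne']
  · rw [hval]
    positivity
  · rw [hval, hval, abs_mul, abs_of_pos (inv_pos.2 hn)]
    have := mul_le_mul_of_nonneg_left (hyi i hi) (inv_pos.2 hn).le
    linarith

/-- The reward of an action whose slots are all dominated by `i₀`. -/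
theorem le_basisReward_of_dominates {Λ : Fin d → ℝ}
    {b : Fin p → OrthonormalBasis (Fin d) ℝ (Vec d)} {i₀ : Fin d} {lam r : ℝ} (hp : 3 ≤ p)
    (hlam : 0 ≤ lam) (hΛ₀ : Λ i₀ = lam) (hΛ : ∀ i, |Λ i| ≤ lam) (hr0 : 0 ≤ r) (hr1 : d * r ^ 2 ≤ 1)
    (a : Action d p) (ha : ∀ s, Dominates (b s) i₀ r (a s)) :
    lam - 2 * p * lam * d * r ^ 2 ≤ basisReward Λ b a := by
  have hd : (1 : ℝ) ≤ d := by
    have : 0 < d := i₀.pos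
    exact_mod_cast this
  have hrle : r ≤ 1 := by
    by_contra h
    push Not at h
    nlinarith [sq_nonneg r]
  set c : Fin p → ℝ := fun s => inner ℝ (b s i₀) (a s : Vec d)
  have hc0 : ∀ s, 0 < c s := fun s => (ha s).2.1
  have hc1 : ∀ s, c s ≤ 1 := fun s => (le_abs_self _).trans (abs_inner_basis_le_one _ _ (a s).2)
  -- As `0 < c s ≤ 1`, the square of the leading coordinate is a lower bound for the coordinate
  -- itself. Bernoulli's inequality then handles the product over the slots.
  have hc : ∀ s, 1 - d * r ^ 2 ≤ c s := by
    intro s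
    have h1 := (ha s).one_le
    have h2 : c s ^ 2 ≤ c s := by nlinarith [hc0 s, hc1 s]
    have h3 : 1 - d * r ^ 2 ≤ c s ^ 2 := by
      have h4 : 0 ≤ d * r ^ 2 := by positivity
      have h5 : c s ^ 2 ≤ 1 := h2.trans (hc1 s)
      have : 1 ≤ c s ^ 2 * (1 + d * r ^ 2) := h1
      nlinarith
    exact h3.trans h2
  have hprod : 1 - p * (d * r ^ 2) ≤ ∏ s, c s := by
    have h1 := one_add_mul_le_pow (a := -(d * r ^ 2)) (by linarith) p
    have h2 : (1 + -(d * r ^ 2)) ^ p ≤ ∏ s, c s := by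
      have : ∏ _s : Fin p, (1 + -(d * r ^ 2)) ≤ ∏ s, c s :=
        Finset.prod_le_prod (fun _ _ => by linarith) fun s _ => by linarith [hc s]
      simpa using this
    linarith
  have hprod0 : 0 ≤ ∏ s, c s := Finset.prod_nonneg fun s _ => (hc0 s).le
  have hprod1 : ∏ s, c s ≤ 1 := Finset.prod_le_one (fun s _ => (hc0 s).le) fun s _ => hc1 s
  have hrest : ∀ i ∈ Finset.univ.erase i₀, -(lam * r ^ 2) ≤ Λ i * ∏ s, inner ℝ (b s i) (a s : Vec d) := by
    intro i hi
    refine neg_le_of_abs_le ?_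
    rw [abs_mul, Finset.abs_prod]
    have h1 : ∏ s, |inner ℝ (b s i) (a s : Vec d)| ≤ r ^ 2 := by
      calc ∏ s, |inner ℝ (b s i) (a s : Vec d)| ≤ ∏ s, r * c s :=
            Finset.prod_le_prod (fun _ _ => abs_nonneg _) fun s _ =>
              (ha s).2.2 i (Finset.ne_of_mem_erase hi)
        _ = r ^ p * ∏ s, c s := by rw [Finset.prod_mul_distrib]; simp
        _ ≤ r ^ 2 * 1 := mul_le_mul (pow_le_pow_of_le_one hr0 hrle (by omega)) hprod1 hprod0
            (by positivity)
        _ = r ^ 2 := mul_one _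
    exact mul_le_mul (hΛ i) h1 (Finset.prod_nonneg fun _ _ => abs_nonneg _) hlam
  have hsum := Finset.sum_le_sum hrest
  rw [Finset.sum_const, nsmul_eq_mul] at hsum
  have hcard : ((Finset.univ.erase i₀).card : ℝ) ≤ d := by
    have := Finset.card_le_univ (Finset.univ.erase i₀)
    rw [Fintype.card_fin] at this
    exact_mod_cast this
  rw [basisReward, ← Finset.add_sum_erase _ _ (Finset.mem_univ i₀), hΛ₀]
  have h1 : lam * (1 - p * (d * r ^ 2)) ≤ lam * ∏ s, c s := mul_le_mul_of_nonneg_left hprod hlam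
  have hp1 : (1 : ℝ) ≤ p := by exact_mod_cast (by omega : 1 ≤ p)
  have h2 : ((Finset.univ.erase i₀).card : ℝ) * (lam * r ^ 2) ≤ d * (lam * r ^ 2) :=
    mul_le_mul_of_nonneg_right hcard (by positivity)
  have h3 : (d : ℝ) * (lam * r ^ 2) ≤ p * (lam * (d * r ^ 2)) := by
    have : (0:ℝ) ≤ d * (lam * r ^ 2) := by positivity
    nlinarith
  change lam - 2 * p * lam * d * r ^ 2 ≤ lam * ∏ s, c s + _
  linarith

/-- After an update of some slot the reward is not very negative. -/
theorem neg_le_basisReward_update {Λ : Fin d → ℝ}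
    {b : Fin p → OrthonormalBasis (Fin d) ℝ (Vec d)} {τ m : ℝ} (hm : 0 < m) (j : Fin p)
    (a : Action d p) (y : Vec d)
    (hy : ∀ i, |m * inner ℝ (b j i) y - slotGrad Λ b j a i| ≤ τ) :
    -(d * τ) ≤ basisReward Λ b (Function.update a j (normalize y)) := by
  rw [basisReward_update]
  have hn1 : ∀ i, |inner ℝ (b j i) (normalize y : Vec d)| ≤ 1 := fun i =>
    abs_inner_basis_le_one _ _ (normalize y).2
  have hval : ∀ i, inner ℝ (b j i) (normalize y : Vec d) = ‖y‖⁻¹ * inner ℝ (b j i) y := fun i => by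
    simp [normalize, real_inner_smul_right]
  -- The normalized vector has the sign of `y` in every coordinate, so replacing the gradient by `m
  -- y` gives a nonnegative term and costs at most `τ`. This needs no assumption on the other slots,
  -- and it also covers `y = 0`.
  have h : ∀ i ∈ Finset.univ, -τ ≤ slotGrad Λ b j a i * inner ℝ (b j i) (normalize y : Vec d) := by
    intro i _
    have h1 : 0 ≤ m * inner ℝ (b j i) y * inner ℝ (b j i) (normalize y : Vec d) := by
      rw [hval]
      have : 0 ≤ m * ‖y‖⁻¹ * (inner ℝ (b j i) y) ^ 2 := by positivity
      nlinarith
    have h2 : |(m * inner ℝ (b j i) y - slotGrad Λ b j a i) *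
        inner ℝ (b j i) (normalize y : Vec d)| ≤ τ := by
      rw [abs_mul]
      exact (mul_le_of_le_one_right (abs_nonneg _) (hn1 i)).trans (hy i)
    have := (abs_le.1 h2).2
    linarith
  have := Finset.sum_le_sum h
  rw [Finset.sum_const, nsmul_eq_mul, Finset.card_univ, Fintype.card_fin] at this
  linarith

/-- Parameters for which the noisy power iteration converges. -/
structure Regime (d p : ℕ) (lam γ x₀ rf τ : ℝ) : Prop where
  margin_pos : 0 < γ
  margin_le : γ ≤ 1 / 4
  lead_pos : 0 < x₀
  lead_le : x₀ ^ 2 * (1 + d) ≤ 1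
  final_pos : 0 < rf
  final_le : rf * (1 + γ) ≤ 1
  error_le_start : τ ≤ γ / 16 * (1 + γ)⁻¹ * (lam * x₀ ^ (p - 1))
  error_le : ∀ r, rf ≤ r → r * (1 + γ) ≤ 1 →
    τ ≤ γ / 16 * r * (lam * (Real.sqrt (1 + d * r ^ 2))⁻¹ ^ (p - 1))

/-! ### Convergence on blocks with controlled errors -/

section Converge

variable {Λ : Fin d → ℝ} {b : Fin p → OrthonormalBasis (Fin d) ℝ (Vec d)} {K : Finset (Fin d)}
  {i₀ : Fin d} {lam γ x₀ rf m ρ : ℝ} {n D : ℕ} {ξ : ℕ → Vec d} {η : ℕ → ℝ}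

theorem slotOut_of_ne {f : Action d p → ℝ} {ζ : ℝ} (j : Fin p) (i t : ℕ) (a : Action d p)
    (s : Fin p) (hs : s ≠ j) : slotOut f ξ η n m ζ j i t a s = a s :=
  Function.update_of_ne hs _ _

theorem slotOut_self {f : Action d p → ℝ} {ζ : ℝ} (j : Fin p) (i t : ℕ) (a : Action d p) :
    slotOut f ξ η n m ζ j i t a j = normalize (slotMean f ξ η n m ζ j i t a) :=
  Function.update_self _ _ _

/-- The first sweep turns the weak lead of the initial vectors into domination by unit vectors at
the same ratio; each further sweep contracts the ratio by `1 - γ / 4` until it reaches `rf`. Hence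
there is one sweep more than the contraction count `I`. The slack `n` in the counter bounds reflects
that only the starting points of blocks must be at most `D`. -/
theorem dominates_powerOut (hp : 3 ≤ p) (hlam : 0 < lam) (hlam1 : lam ≤ 1)
    (hΛ₀ : Λ i₀ = lam) (hΛ : ∀ i, |Λ i| ≤ lam) (hΛK : ∀ i, i ∉ K → Λ i = 0) (hm : 1 ≤ m)
    (hρ : 0 ≤ ρ) (hR : Regime d p lam γ x₀ rf (2 * Real.sqrt m * ρ))
    (hgood : ∀ j i t, i ≤ D → t ≤ D →
      BlockGood (b j) n m ρ (fun u => ξ (i + u)) (fun u => η (t + u)))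
    {I : ℕ} (hI : (1 - γ / 4) ^ I ≤ rf) (i t : ℕ) (hi : i + (I + 1) * (p * n) ≤ D + n)
    (ht : t + (I + 1) * (p * n) ≤ D + n) (a : Action d p)
    (ha : ∀ s, Leads (b s) K i₀ x₀ (1 + γ)⁻¹ (a s)) (s : Fin p) :
    Dominates (b s) i₀ rf (powerOut (basisReward Λ b) ξ η n m 1 (I + 1) i t a s) := by
  have hγ := hR.margin_pos
  have hγ1 := hR.margin_le
  have h1γ : 0 < 1 + γ := by linarith
  have hr₀ : (1 + γ)⁻¹ * (1 + γ) = 1 := inv_mul_cancel₀ h1γ.ne'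
  have hr₀1 : (1 + γ)⁻¹ ≤ 1 := inv_le_one_of_one_le₀ (by linarith)
  have hm0 : 0 < m := by linarith
  have hrf : rf ≤ (1 + γ)⁻¹ := by
    rw [← one_div, le_div_iff₀ h1γ]
    exact hR.final_le
  have hpn : n ≤ p * n := Nat.le_mul_of_pos_left _ (by omega)
  -- the first sweep
  have hfirst : ∀ i t a, i + p * n ≤ D + n → t + p * n ≤ D + n →
      (∀ s, Leads (b s) K i₀ x₀ (1 + γ)⁻¹ (a s)) →
      ∀ s, Dominates (b s) i₀ (1 + γ)⁻¹ (sweepOut (basisReward Λ b) ξ η n m 1 i t a s) := by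
    intro i t a hi ht ha
    have := iter_slots (Old := fun s => Leads (b s) K i₀ x₀ (1 + γ)⁻¹)
      (New := fun s => Dominates (b s) i₀ (1 + γ)⁻¹)
      (F := slotOut (basisReward Λ b) ξ η n m 1) (n := n) (D := D) ?_ ?_ ?_ (List.finRange p) i t
      (by simpa using hi) (by simpa using ht) a ha (fun s hs => absurd (List.mem_finRange s) hs)
    · exact this
    -- In the middle of the sweep some slots are updated and some are not. A dominating unit vector
    -- also satisfies the initial lead condition, by `lead_le`, so the updated slots may be treated
    -- like the others.
    · intro s x hx
      refine ⟨?_, fun i _ hi => hx.2.2 i hi⟩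
      have h1 := hx.one_le
      have h2 : inner ℝ (b s i₀) (x : Vec d) ^ 2 * (1 + d * (1 + γ)⁻¹ ^ 2) ≤
          inner ℝ (b s i₀) (x : Vec d) ^ 2 * (1 + d) := by
        refine mul_le_mul_of_nonneg_left ?_ (sq_nonneg _)
        have : (1 + γ)⁻¹ ^ 2 ≤ 1 := pow_le_one₀ (by positivity) hr₀1
        nlinarith [Nat.cast_nonneg (α := ℝ) d]
      have h3 : x₀ ^ 2 ≤ inner ℝ (b s i₀) (x : Vec d) ^ 2 :=
        le_of_mul_le_mul_right (hR.lead_le.trans (h1.trans h2)) (by positivity)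
      exact le_of_sq_le_sq h3 hx.2.1.le
    · exact fun j i t a s hs => slotOut_of_ne j i t a s hs
    · intro j i t a hi ht ha
      rw [slotOut_self]
      refine (dominates_normalize hp hlam hΛ₀ hΛ hΛK hγ hγ1 (inv_pos.2 h1γ) hr₀.le hR.lead_pos hm0
        hR.error_le_start j a (fun s _ => ha s) _
        (abs_slotMean_sub_slotGrad_le hΛ hlam.le hlam1 hp hm hρ (hgood j i t hi ht) a)).mono ?_
      exact mul_le_of_le_one_left (by positivity) (by linarith)
  -- the later sweeps
  have hnext : ∀ r, rf ≤ r → r * (1 + γ) ≤ 1 → ∀ i t a, i + p * n ≤ D + n → t + p * n ≤ D + n →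
      (∀ s, Dominates (b s) i₀ r (a s)) →
      ∀ s, Dominates (b s) i₀ ((1 - γ / 4) * r)
        (sweepOut (basisReward Λ b) ξ η n m 1 i t a s) := by
    intro r hr hr1 i t a hi ht ha
    have hr0 : 0 < r := hR.final_pos.trans_le hr
    have := iter_slots (Old := fun s => Dominates (b s) i₀ r)
      (New := fun s => Dominates (b s) i₀ ((1 - γ / 4) * r))
      (F := slotOut (basisReward Λ b) ξ η n m 1) (n := n) (D := D) ?_ ?_ ?_ (List.finRange p) i t
      (by simpa using hi) (by simpa using ht) a ha (fun s hs => absurd (List.mem_finRange s) hs)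
    · exact this
    · exact fun s x hx => hx.mono (mul_le_of_le_one_left hr0.le (by linarith))
    · exact fun j i t a s hs => slotOut_of_ne j i t a s hs
    · intro j i t a hi ht ha
      rw [slotOut_self]
      exact dominates_normalize hp hlam hΛ₀ hΛ hΛK hγ hγ1 hr0 hr1
        (inv_pos.2 (Real.sqrt_pos.2 (by positivity))) hm0
        (hR.error_le r hr hr1) j a
        (fun s _ => ⟨(ha s).inv_sqrt_le, fun i _ hi => (ha s).2.2 i hi⟩) _
        (abs_slotMean_sub_slotGrad_le hΛ hlam.le hlam1 hp hm hρ (hgood j i t hi ht) a)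
  -- Index `0` stands for the initial candidate and index `q ≥ 1` for the state after `q` sweeps.
  -- The maximum with `rf` is needed because the error is only small relative to ratios of at least
  -- `rf`.
  have hchain := iter_chain (N := fun q (a : Action d p) =>
      if q = 0 then ∀ s, Leads (b s) K i₀ x₀ (1 + γ)⁻¹ (a s)
      else ∀ s, Dominates (b s) i₀ (max rf ((1 - γ / 4) ^ (q - 1) * (1 + γ)⁻¹)) (a s))
    (F := fun _ : ℕ => sweepOut (basisReward Λ b) ξ η n m 1) (n := p * n) (D := D + n) ?_
    (List.range (I + 1)) 0 i t (by simpa using hi) (by simpa using ht) a (by simpa using ha)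
  · simp only [List.length_range, zero_add, Nat.add_eq_zero_iff, one_ne_zero, and_false, if_false,
      Nat.add_sub_cancel] at hchain
    refine (hchain s).mono (max_le le_rfl ?_)
    exact (mul_le_of_le_one_right (pow_nonneg (by linarith) _) hr₀1).trans hI
  · intro q _ i t a hi ht ha
    rcases Nat.eq_zero_or_pos q with rfl | hq
    · simp only [if_true] at ha
      simp only [zero_add, one_ne_zero, if_false, Nat.sub_self, pow_zero, one_mul]
      exact fun s => (hfirst i t a hi ht ha s).mono (le_max_right _ _)
    · simp only [hq.ne', if_false] at ha
      simp only [Nat.add_eq_zero_iff, one_ne_zero, and_false, if_false, Nat.add_sub_cancel]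
      have h1 : max rf ((1 - γ / 4) ^ (q - 1) * (1 + γ)⁻¹) * (1 + γ) ≤ 1 := by
        rw [max_mul_of_nonneg _ _ h1γ.le, mul_assoc, hr₀, mul_one]
        exact max_le hR.final_le (pow_le_one₀ (by linarith) (by linarith))
      refine fun s => (hnext _ (le_max_left _ _) h1 i t a hi ht ha s).mono ?_
      rw [mul_max_of_nonneg _ _ (by linarith)]
      refine max_le_max (mul_le_of_le_one_left hR.final_pos.le (by linarith)) (le_of_eq ?_)
      rw [← mul_assoc, ← pow_succ', Nat.sub_add_cancel hq]

/-- Only the very last update matters, so the bound holds for every starting point, good or bad. It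
is the reason why every candidate passes the test. -/
theorem neg_le_basisReward_powerOut (hp : 3 ≤ p) (hlam : 0 < lam) (hlam1 : lam ≤ 1)
    (hΛ : ∀ i, |Λ i| ≤ lam) (hm : 1 ≤ m) (hρ : 0 ≤ ρ)
    (hgood : ∀ j i t, i ≤ D → t ≤ D →
      BlockGood (b j) n m ρ (fun u => ξ (i + u)) (fun u => η (t + u)))
    {I : ℕ} (i t : ℕ) (hi : i + (I + 1) * (p * n) ≤ D + n)
    (ht : t + (I + 1) * (p * n) ≤ D + n) (a : Action d p) :
    -(d * (2 * Real.sqrt m * ρ)) ≤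
      basisReward Λ b (powerOut (basisReward Λ b) ξ η n m 1 (I + 1) i t a) := by
  refine iter_of_step (N := fun a => -(d * (2 * Real.sqrt m * ρ)) ≤ basisReward Λ b a) (n := p * n)
    (D := D + n) ?_ _ (by simp) i t (by simpa using hi) (by simpa using ht) a
  intro _ i t a hi ht
  refine iter_of_step (N := fun a => -(d * (2 * Real.sqrt m * ρ)) ≤ basisReward Λ b a) (n := n)
    (D := D + n) ?_ _ ?_ i t (by simpa using hi) (by simpa using ht) a
  · intro j i t a hi ht
    exact neg_le_basisReward_update (by linarith) j a _
      (abs_slotMean_sub_slotGrad_le hΛ hlam.le hlam1 hp hm hρ (hgood j i t (by omega) (by omega)) a)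
  · rw [Ne, List.finRange_eq_nil_iff]
    omega

end Converge

end Iteration

/-! ### The good event of the elimination phase -/

section GoodEvent

theorem measure_exists_mem_le {Ω ι : Type*} [MeasurableSpace Ω] (P : Measure Ω) (F : Finset ι)
    (E : ι → Ω → Prop) {c : ℝ} (h : ∀ x ∈ F, P {ω | E x ω} ≤ ENNReal.ofReal c) :
    P {ω | ∃ x ∈ F, E x ω} ≤ ENNReal.ofReal (F.card * c) := by
  have e : {ω | ∃ x ∈ F, E x ω} = ⋃ x ∈ F, {ω | E x ω} := by
    ext
    simp
  rw [e, ENNReal.ofReal_mul (Nat.cast_nonneg _), ENNReal.ofReal_natCast, ← nsmul_eq_mul]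
  exact (measure_biUnion_finset_le F _).trans (Finset.sum_le_card_nsmul F _ _ h)

variable {d p : ℕ}

/-- Unit vectors whose squared coordinates determine the product of the coordinates `i` and `l`. -/
def pairVec (b : OrthonormalBasis (Fin d) ℝ (Vec d)) (i l : Fin d) (σ : Bool) : Vec d :=
  if i = l then b i else (Real.sqrt 2)⁻¹ • (b i + (if σ then (1 : ℝ) else -1) • b l)

theorem norm_pairVec (b : OrthonormalBasis (Fin d) ℝ (Vec d)) (i l : Fin d) (σ : Bool) :
    ‖pairVec b i l σ‖ = 1 := by
  unfold pairVec
  split_ifs with h hσ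
  · exact b.norm_eq_one i
  all_goals
    have h2 : (0:ℝ) < Real.sqrt 2 := by positivity
    have h0 : inner ℝ (b i) (b l) = 0 := b.orthonormal.2 h
    rw [norm_smul, norm_inv, Real.norm_of_nonneg h2.le, inv_mul_eq_one₀ h2.ne', eq_comm,
      ← Real.sqrt_sq (norm_nonneg _)]
    congr 1
    rw [norm_add_sq_real, real_inner_smul_right, h0, norm_smul, b.norm_eq_one, b.norm_eq_one]
    norm_num

/-- Polarization: the product of two coordinates is half the difference of the squares along the
unit vectors `(bᵢ ± bₗ) / √2`, which reduces the entries of the covariance to `χ²` sums. -/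
theorem quad_of_pairVec (b : OrthonormalBasis (Fin d) ℝ (Vec d)) {n : ℕ} (hn : 0 < n) {ρ : ℝ}
    (x : ℕ → Vec d) (i l : Fin d)
    (h : ∀ σ, |∑ u ∈ Finset.range n, (inner ℝ (pairVec b i l σ) (x u) ^ 2 - 1)| ≤ n * ρ) :
    |(n : ℝ)⁻¹ * ∑ u ∈ Finset.range n, inner ℝ (b i) (x u) * inner ℝ (b l) (x u) -
      if i = l then 1 else 0| ≤ ρ := by
  have hn0 : (0:ℝ) < n := by exact_mod_cast hn
  have key : ∑ u ∈ Finset.range n, (inner ℝ (b i) (x u) * inner ℝ (b l) (x u) -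
      if i = l then 1 else 0) =
      if i = l then ∑ u ∈ Finset.range n, (inner ℝ (pairVec b i l true) (x u) ^ 2 - 1)
      else (∑ u ∈ Finset.range n, (inner ℝ (pairVec b i l true) (x u) ^ 2 - 1) -
        ∑ u ∈ Finset.range n, (inner ℝ (pairVec b i l false) (x u) ^ 2 - 1)) / 2 := by
    by_cases hil : i = l
    · subst hil
      simp [pairVec, sq]
    · simp only [if_neg hil]
      rw [← Finset.sum_sub_distrib, Finset.sum_div]
      refine Finset.sum_congr rfl fun u _ => ?_
      simp only [pairVec, if_neg hil, if_true, real_inner_smul_left, inner_add_left, one_smul,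
        Bool.false_eq_true, if_false, neg_smul, inner_neg_left]
      have h2 : (Real.sqrt 2)⁻¹ ^ 2 = 1 / 2 := by
        rw [inv_pow, Real.sq_sqrt (by norm_num)]
        norm_num
      rw [mul_pow, mul_pow, h2]
      ring
  have hb : |∑ u ∈ Finset.range n, (inner ℝ (b i) (x u) * inner ℝ (b l) (x u) -
      if i = l then 1 else 0)| ≤ n * ρ := by
    rw [key]
    split_ifs with hil
    · exact h true
    · have h1 := abs_le.1 (h true)
      have h2 := abs_le.1 (h false)
      rw [abs_le]
      constructor <;> linarith [h1.1, h1.2, h2.1, h2.2]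
  rw [Finset.sum_sub_distrib, Finset.sum_const, Finset.card_range, nsmul_eq_mul] at hb
  have e : (n : ℝ)⁻¹ * ∑ u ∈ Finset.range n, inner ℝ (b i) (x u) * inner ℝ (b l) (x u) -
      (if i = l then 1 else 0) = (n : ℝ)⁻¹ * (∑ u ∈ Finset.range n, inner ℝ (b i) (x u) *
        inner ℝ (b l) (x u) - n * if i = l then 1 else 0) := by
    rw [mul_sub, inv_mul_cancel_left₀ hn0.ne']
  rw [e, abs_mul, abs_of_pos (inv_pos.2 hn0), inv_mul_le_iff₀ hn0]
  exact hb

variable {Ω : Type*} [MeasurableSpace Ω] [StandardBorelSpace Ω] {P : Measure Ω}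
  [IsProbabilityMeasure P] {ξ : ℕ → Ω → Vec d} {η : ℕ → Ω → ℝ}

theorem IsBanditRandomness.measure_norm_gt_le (h : IsBanditRandomness P ξ η) (m : ℝ) (N : ℕ) :
    P {ω | ∃ i ∈ Finset.range N, m < ‖ξ i ω‖ ^ 2} ≤
      ENNReal.ofReal (N * Real.exp (d - m / 4)) := by
  have := measure_exists_mem_le P (Finset.range N) (fun i ω => m < ‖ξ i ω‖ ^ 2)
    fun i _ => by
      have h1 := stdGaussian_norm_sq_gt_le (d := d) m
      rwa [← h.law_draw i, Measure.map_apply (h.measurable_draw i)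
        (measurableSet_lt (by fun_prop) (by fun_prop))] at h1
  rwa [Finset.card_range] at this

theorem IsBanditRandomness.measure_quad_le (h : IsBanditRandomness P ξ η)
    (b : Fin p → OrthonormalBasis (Fin d) ℝ (Vec d)) {n : ℕ} {ρ : ℝ} (hρ : 0 ≤ ρ) (hρ1 : ρ ≤ 1)
    (N : ℕ) :
    P {ω | ∃ x ∈ (Finset.univ : Finset (Fin p × Fin d × Fin d × Bool)) ×ˢ Finset.range N,
      n * ρ < |∑ u ∈ Finset.range n,
        (inner ℝ (pairVec (b x.1.1) x.1.2.1 x.1.2.2.1 x.1.2.2.2) (ξ (x.2 + u) ω) ^ 2 - 1)|} ≤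
      ENNReal.ofReal (p * (d * (d * 2)) * N * (2 * Real.exp (-(n * ρ ^ 2 / 16)))) := by
  refine (measure_exists_mem_le P _ _ fun x _ => measure_sum_inner_sq_le
    h.measurable_draw h.indep_draw h.law_draw (norm_pairVec (b x.1.1) x.1.2.1 x.1.2.2.1 x.1.2.2.2)
      x.2 n hρ hρ1).trans (le_of_eq ?_)
  simp [Finset.card_product]

/-- The history contains all Gaussian draws, hence coordinates of draws are admissible predictable
weights for the noise, at arbitrary offsets. Their quadratic variation is random, so the bound `2 n`
is part of the event and is discharged later by the covariance estimate. -/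
theorem IsBanditRandomness.measure_noise_le (h : IsBanditRandomness P ξ η)
    (b : Fin p → OrthonormalBasis (Fin d) ℝ (Vec d)) {n : ℕ} (hn : 0 < n) {ρ : ℝ} (hρ : 0 ≤ ρ)
    (N : ℕ) :
    P {ω | ∃ x ∈ (Finset.univ : Finset (Fin p × Fin d)) ×ˢ (Finset.range N ×ˢ Finset.range N),
      n * ρ < |∑ u ∈ Finset.range n, inner ℝ (b x.1.1 x.1.2) (ξ (x.2.1 + u) ω) * η (x.2.2 + u) ω| ∧
      ∑ u ∈ Finset.range n, inner ℝ (b x.1.1 x.1.2) (ξ (x.2.1 + u) ω) ^ 2 ≤ 2 * n} ≤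
      ENNReal.ofReal (p * d * (N * N) * (2 * Real.exp (-(n * ρ ^ 2 / 4)))) := by
  have hn0 : (0:ℝ) < n := by exact_mod_cast hn
  refine (measure_exists_mem_le P _ _ (c := 2 * Real.exp (-(n * ρ ^ 2 / 4)))
    fun x _ => ?_).trans (le_of_eq ?_)
  · have := h.measure_abs_sum_block_gt_le
      (w := fun u ω => inner ℝ (b x.1.1 x.1.2) (ξ (x.2.1 + u) ω)) x.2.2 (fun u => by
        have h1 := measurable_draw_history ξ η (x.2.1 + u) (x.2.2 + u)
        exact ((innerSL ℝ (b x.1.1 x.1.2)).continuous.measurable).comp h1) n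
      (a := n * ρ) (v := 2 * n) (by positivity) (by positivity)
    refine this.trans (le_of_eq ?_)
    congr 4
    field_simp
    norm_num
  · simp [Finset.card_product]

theorem IsBanditRandomness.measure_test_le (h : IsBanditRandomness P ξ η) {n : ℕ} (hn : 0 < n)
    {ρ : ℝ} (hρ : 0 ≤ ρ) (N : ℕ) :
    P {ω | ∃ t ∈ Finset.range N, n * ρ < |∑ u ∈ Finset.range n, η (t + u) ω|} ≤
      ENNReal.ofReal (N * (2 * Real.exp (-(n * ρ ^ 2 / 2)))) := by
  have hn0 : (0:ℝ) < n := by exact_mod_cast hn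
  have := measure_exists_mem_le P (Finset.range N)
    (fun t ω => n * ρ < |∑ u ∈ Finset.range n, η (t + u) ω|)
    (c := 2 * Real.exp (-(n * ρ ^ 2 / 2))) fun t _ => by
      have := h.measure_abs_sum_block_gt_le (w := fun u ω => 1) t (fun u => measurable_const) n
        (a := n * ρ) (v := n) (by positivity) (by positivity)
      simp only [one_mul, one_pow, Finset.sum_const, Finset.card_range, nsmul_eq_mul, mul_one,
        le_refl, and_true] at this
      refine this.trans (le_of_eq ?_)
      congr 4
      field_simp
  rwa [Finset.card_range] at this

/-- Simultaneous regularity of all blocks, except with small probability. -/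
theorem IsBanditRandomness.exists_blockGood (h : IsBanditRandomness P ξ η)
    (b : Fin p → OrthonormalBasis (Fin d) ℝ (Vec d)) {n : ℕ} (hn : 0 < n) {m ρ : ℝ} (hρ : 0 ≤ ρ)
    (hρ1 : ρ ≤ 1) (hp : 0 < p) (hd : 0 < d) (D : ℕ) :
    ∃ G : Set Ω, P Gᶜ ≤ ENNReal.ofReal ((D + 1 + n) * Real.exp (d - m / 4) +
        8 * p * d ^ 2 * (D + 1) ^ 2 * Real.exp (-(n * ρ ^ 2 / 16))) ∧
      ∀ ω ∈ G, (∀ j i t, i ≤ D → t ≤ D →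
        BlockGood (b j) n m ρ (fun u => ξ (i + u) ω) (fun u => η (t + u) ω)) ∧
        ∀ t ≤ D, |∑ u ∈ Finset.range n, η (t + u) ω| ≤ n * ρ := by
  have h1 := h.measure_norm_gt_le m (D + 1 + n)
  have h2 := h.measure_quad_le b (n := n) hρ hρ1 (D + 1)
  have h3 := h.measure_noise_le b hn hρ (D + 1)
  have h4 := h.measure_test_le hn hρ (D + 1)
  set A1 := {ω | ∃ i ∈ Finset.range (D + 1 + n), m < ‖ξ i ω‖ ^ 2}
  set A2 := {ω | ∃ x ∈ (Finset.univ : Finset (Fin p × Fin d × Fin d × Bool)) ×ˢ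
    Finset.range (D + 1), n * ρ < |∑ u ∈ Finset.range n,
        (inner ℝ (pairVec (b x.1.1) x.1.2.1 x.1.2.2.1 x.1.2.2.2) (ξ (x.2 + u) ω) ^ 2 - 1)|}
  set A3 := {ω | ∃ x ∈ (Finset.univ : Finset (Fin p × Fin d)) ×ˢ
    (Finset.range (D + 1) ×ˢ Finset.range (D + 1)),
      n * ρ < |∑ u ∈ Finset.range n, inner ℝ (b x.1.1 x.1.2) (ξ (x.2.1 + u) ω) * η (x.2.2 + u) ω| ∧
      ∑ u ∈ Finset.range n, inner ℝ (b x.1.1 x.1.2) (ξ (x.2.1 + u) ω) ^ 2 ≤ 2 * n}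
  set A4 := {ω | ∃ t ∈ Finset.range (D + 1), n * ρ < |∑ u ∈ Finset.range n, η (t + u) ω|}
  have hn0 : (0:ℝ) < n := by exact_mod_cast hn
  refine ⟨(A1 ∪ (A2 ∪ (A3 ∪ A4)))ᶜ, ?_, ?_⟩
  · rw [compl_compl]
    refine (measure_union_le _ _).trans ((add_le_add h1 ((measure_union_le _ _).trans
      (add_le_add h2 ((measure_union_le _ _).trans (add_le_add h3 h4))))).trans ?_)
    rw [← ENNReal.ofReal_add (by positivity) (by positivity),
      ← ENNReal.ofReal_add (by positivity) (by positivity),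
      ← ENNReal.ofReal_add (by positivity) (by positivity)]
    apply ENNReal.ofReal_le_ofReal
    push_cast
    gcongr
    set e := Real.exp (-(n * ρ ^ 2 / 16))
    have e4 : Real.exp (-(n * ρ ^ 2 / 4)) ≤ e := Real.exp_le_exp.2 (by nlinarith [sq_nonneg ρ, mul_nonneg hn0.le (sq_nonneg ρ)])
    have e2 : Real.exp (-(n * ρ ^ 2 / 2)) ≤ e := Real.exp_le_exp.2 (by nlinarith [sq_nonneg ρ, mul_nonneg hn0.le (sq_nonneg ρ)])
    have he : 0 ≤ e := Real.exp_nonneg _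
    have hp1 : (1:ℝ) ≤ p := by exact_mod_cast hp
    have hd1 : (1:ℝ) ≤ d := by exact_mod_cast hd
    have hD1 : (1:ℝ) ≤ D + 1 := by linarith [Nat.cast_nonneg (α := ℝ) D]
    have hdd : (d:ℝ) ≤ d ^ 2 := by nlinarith
    have hDD : (D + 1 : ℝ) ≤ (D + 1 : ℝ) ^ 2 := by nlinarith
    have t2 : (p * (d * (d * 2)) * (D + 1) * (2 * e) : ℝ) ≤ 4 * (p * d ^ 2 * (D + 1 : ℝ) ^ 2 * e) := by
      calc (p * (d * (d * 2)) * (D + 1) * (2 * e) : ℝ) = 4 * (p * d ^ 2 * (D + 1) * e) := by ring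
        _ ≤ _ := by gcongr
    have t3 : (p * d * ((D + 1) * (D + 1)) * (2 * Real.exp (-(n * ρ ^ 2 / 4))) : ℝ) ≤
        2 * (p * d ^ 2 * (D + 1 : ℝ) ^ 2 * e) := by
      calc (p * d * ((D + 1) * (D + 1)) * (2 * Real.exp (-(n * ρ ^ 2 / 4))) : ℝ) =
          2 * (p * d * (D + 1) ^ 2 * Real.exp (-(n * ρ ^ 2 / 4))) := by ring
        _ ≤ _ := by gcongr
    have t4 : ((D + 1) * (2 * Real.exp (-(n * ρ ^ 2 / 2))) : ℝ) ≤
        2 * (p * d ^ 2 * (D + 1 : ℝ) ^ 2 * e) := by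
      calc ((D + 1) * (2 * Real.exp (-(n * ρ ^ 2 / 2))) : ℝ) =
          2 * (1 * 1 ^ 2 * (D + 1) * Real.exp (-(n * ρ ^ 2 / 2))) := by ring
        _ ≤ _ := by gcongr
    linarith
  · intro ω hω
    simp only [Set.mem_compl_iff, Set.mem_union, not_or] at hω
    obtain ⟨g1, g2, g3, g4⟩ := hω
    simp only [A1, A2, A3, A4, Set.mem_ofPred_eq, not_exists, not_and, not_lt, not_le,
      Finset.mem_range, Finset.mem_product, Finset.mem_univ, true_and] at g1 g2 g3 g4
    have hquad : ∀ j i, i ≤ D → ∀ i' l, |(n : ℝ)⁻¹ * ∑ u ∈ Finset.range n,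
        inner ℝ (b j i') (ξ (i + u) ω) * inner ℝ (b j l) (ξ (i + u) ω) -
          if i' = l then 1 else 0| ≤ ρ := fun j i hi i' l =>
      quad_of_pairVec (b j) hn (fun u => ξ (i + u) ω) i' l fun σ =>
        g2 ((j, i', l, σ), i) (by simpa using Nat.lt_succ_of_le hi)
    refine ⟨fun j i t hi ht => ⟨fun u hu => g1 _ (by omega), hquad j i hi, fun l => ?_⟩,
      fun t ht => g4 t (by omega)⟩
    by_contra hcon
    push Not at hcon
    rw [abs_mul, abs_of_pos (inv_pos.2 hn0), lt_inv_mul_iff₀ hn0] at hcon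
    -- A large noise average would force a second moment above `2 n`, while the covariance estimate
    -- bounds it by `(1 + ρ) n ≤ 2 n`.
    have h5 := g3 ((j, l), (i, t)) ⟨by simp only; omega, by simp only; omega⟩ hcon
    have h6 := (abs_le.1 (hquad j i hi l l)).2
    rw [if_pos rfl, sub_le_iff_le_add, inv_mul_le_iff₀ hn0] at h6
    simp only [← sq] at h6
    nlinarith

end GoodEvent

/-! ### The elimination phase on the good event -/

section Phase

variable {d p : ℕ}

/-- The initial vectors from which the power iteration in one slot succeeds. -/
def initSet (b : OrthonormalBasis (Fin d) ℝ (Vec d)) (K : Finset (Fin d)) (i₀ : Fin d) (γ : ℝ) :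
    Set (Vec d) :=
  {x | (1 / 4 ≤ inner ℝ (b i₀) x ∧
    ∀ i ∈ K, i ≠ i₀ → (1 + γ) * |inner ℝ (b i) x| ≤ inner ℝ (b i₀) x) ∧ ‖x‖ ^ 2 ≤ 40 * d}

theorem measurableSet_initSet (b : OrthonormalBasis (Fin d) ℝ (Vec d)) (K : Finset (Fin d))
    (i₀ : Fin d) (γ : ℝ) : MeasurableSet (initSet b K i₀ γ) := by
  have h1 : MeasurableSet {x : Vec d | 1 / 4 ≤ inner ℝ (b i₀) x} :=
    measurableSet_le (by fun_prop) (by fun_prop)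
  have h2 : MeasurableSet {x : Vec d | ‖x‖ ^ 2 ≤ 40 * d} :=
    measurableSet_le (by fun_prop) (by fun_prop)
  have h3 : MeasurableSet
      {x : Vec d | ∀ i ∈ K, i ≠ i₀ → (1 + γ) * |inner ℝ (b i) x| ≤ inner ℝ (b i₀) x} := by
    have : {x : Vec d | ∀ i ∈ K, i ≠ i₀ → (1 + γ) * |inner ℝ (b i) x| ≤ inner ℝ (b i₀) x} =
        ⋂ i, ⋂ _ : i ∈ K, ⋂ _ : i ≠ i₀, {x | (1 + γ) * |inner ℝ (b i) x| ≤ inner ℝ (b i₀) x} := by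
      ext z
      simp
    rw [this]
    exact .iInter fun j => .iInter fun _ => .iInter fun _ =>
      measurableSet_le (by fun_prop) (by fun_prop)
  exact (h1.inter h3).inter h2

/-- A coordinate of at least `1 / 4` in a vector of length at most `√(40 d)` is at least `1 / √(16 ·
40 d)` after normalization. -/
theorem leads_normalize {b : OrthonormalBasis (Fin d) ℝ (Vec d)} {K : Finset (Fin d)} {i₀ : Fin d}
    {γ : ℝ} (hγ : 0 < γ) {x : Vec d} (hx : x ∈ initSet b K i₀ γ) :
    Leads b K i₀ (Real.sqrt (640 * d))⁻¹ (1 + γ)⁻¹ (normalize x) := by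
  obtain ⟨⟨h1, h2⟩, h3⟩ := hx
  have hval : ∀ i, inner ℝ (b i) (normalize x : Vec d) = ‖x‖⁻¹ * inner ℝ (b i) x := fun i => by
    simp [normalize, real_inner_smul_right]
  have hx0 : x ≠ 0 := by
    rintro rfl
    norm_num at h1
  have hn : 0 < ‖x‖ := norm_pos_iff.2 hx0
  refine ⟨?_, fun i hi hne => ?_⟩
  · rw [hval]
    have h4 : 4 * ‖x‖ ≤ Real.sqrt (640 * d) := Real.le_sqrt_of_sq_le (by nlinarith)
    calc (Real.sqrt (640 * d))⁻¹ ≤ (4 * ‖x‖)⁻¹ := inv_anti₀ (by positivity) h4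
      _ = ‖x‖⁻¹ * (1 / 4) := by rw [mul_inv]; ring
      _ ≤ _ := mul_le_mul_of_nonneg_left h1 (inv_pos.2 hn).le
  · rw [hval, hval, abs_mul, abs_of_pos (inv_pos.2 hn)]
    have h5 : |inner ℝ (b i) x| ≤ (1 + γ)⁻¹ * inner ℝ (b i₀) x := by
      rw [le_inv_mul_iff₀ (by linarith)]
      exact h2 i hi hne
    have := mul_le_mul_of_nonneg_left h5 (inv_pos.2 hn).le
    linarith

/-- The final candidates: except on an event of small probability all of them pass the test, and
one of them is nearly optimal. -/
theorem exists_good_event {k : ℕ} [NeZero k] {lam : ℝ} (hp : 3 ≤ p) (hlam : 0 < lam)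
    (hlam1 : lam ≤ 1) {γ rf m ρ : ℝ} {L n I : ℕ} (hn : 0 < n) (hm : 1 ≤ m) (hρ : 0 ≤ ρ)
    (hR : Regime d p lam γ (Real.sqrt (640 * d))⁻¹ rf (2 * Real.sqrt m * ρ))
    (hγk : γ * (4 * Real.log (12 * k)) ≤ 1) (hrf : d * rf ^ 2 ≤ 1) (hI : (1 - γ / 4) ^ I ≤ rf)
    (hτ : d * (2 * Real.sqrt m * ρ) ≤ lam / 4) (hρ1 : ρ ≤ lam / 4) (T : OrthTensor d p k lam)
    {Ω : Type*} [MeasurableSpace Ω] [StandardBorelSpace Ω] {P : Measure Ω}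
    [IsProbabilityMeasure P] {ξ : ℕ → Ω → Vec d} {η : ℕ → Ω → ℝ}
    (h : IsBanditRandomness P ξ η) :
    ∃ G : Set Ω, P Gᶜ ≤ ENNReal.ofReal
        ((L * p + L * ((I + 1) * (p * n) + n) + 1 + n) * Real.exp (d - m / 4) +
        8 * p * d ^ 2 * (L * p + L * ((I + 1) * (p * n) + n) + 1) ^ 2 *
          Real.exp (-(n * ρ ^ 2 / 16)) + Real.exp (-(L * (1 / (60 * k)) ^ p))) ∧
      ∀ ω ∈ G, stageOut T.reward (ξ · ω) (η · ω) (lam * (1 - p * (1 / 2) ^ 1)) n m 1 (I + 1)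
          ((List.range L).map fun u => initOut (ξ · ω) (u * p)) (L * p) 0 =
            (List.range L).map (armOut T.reward (ξ · ω) (η · ω) L n m 1 (I + 1)) ∧
        ∃ u < L, lam - 2 * p * lam * d * rf ^ 2 ≤
          T.reward (armOut T.reward (ξ · ω) (η · ω) L n m 1 (I + 1) u) := by
  obtain ⟨b, Λ, K, i₀, hi₀, hK, hΛ₀, hΛ, hΛK, hT⟩ := T.exists_basisReward hlam (by omega)
  rw [hT]
  -- An upper bound for both counters: `L * p` initial draws, then `(I + 1) * (p * n)` updates and
  -- `n` test plays per candidate.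
  set D := L * p + L * ((I + 1) * (p * n) + n) with hD
  obtain ⟨G, hG, hgood⟩ := h.exists_blockGood b hn (m := m) hρ (by linarith) (by omega) i₀.pos D
  have hinit := measure_forall_not_mem_le h.measurable_draw h.indep_draw h.law_draw
    (S := fun s : Fin p => initSet (b s) K i₀ γ) (fun s => measurableSet_initSet _ _ _ _)
    (q := 1 / (60 * k)) (by positivity) (fun s => stdGaussian_dominant_ge (b s) K i₀ hi₀ hK
      hR.margin_pos.le hR.margin_le hγk) L
  set B := {ω | ∀ u < L, ¬ ∀ s : Fin p, ξ (u * p + s) ω ∈ initSet (b s) K i₀ γ}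
  refine ⟨G ∩ Bᶜ, ?_, ?_⟩
  · rw [Set.compl_inter, compl_compl]
    refine (measure_union_le _ _).trans ((add_le_add hG hinit).trans ?_)
    rw [← ENNReal.ofReal_add (by positivity) (by positivity), hD]
    push_cast
    exact le_rfl
  · rintro ω ⟨hω, hωB⟩
    obtain ⟨hblock, htest⟩ := hgood ω hω
    have hn0 : (0:ℝ) < n := by exact_mod_cast hn
    have hidx : ∀ u < L, L * p + u * ((I + 1) * (p * n)) + (I + 1) * (p * n) ≤ D ∧
        u * ((I + 1) * (p * n) + n) + (I + 1) * (p * n) ≤ D := by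
      intro u hu
      have h1 : (u + 1) * ((I + 1) * (p * n) + n) ≤ L * ((I + 1) * (p * n) + n) :=
        Nat.mul_le_mul_right _ hu
      constructor <;> nlinarith
    constructor
    · refine stageOut_eq_arms lam L n m 1 (I + 1) fun u hu => ?_
      obtain ⟨h1, h2⟩ := hidx u hu
      have h3 := neg_le_basisReward_powerOut (Λ := Λ) (b := b) (n := n) (D := D)
        (ξ := (ξ · ω)) (η := (η · ω)) hp hlam hlam1 hΛ
        hm hρ hblock (I := I) (L * p + u * ((I + 1) * (p * n))) (u * ((I + 1) * (p * n) + n))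
        (by omega) (by omega) (initOut (ξ · ω) (u * p))
      have h4 := htest _ h2
      have h5 : (p : ℝ) ≥ 3 := by exact_mod_cast hp
      rw [meanOut, ← List.sum_toFinset _ List.nodup_range, List.toFinset_range,
        Finset.sum_add_distrib, Finset.sum_const, Finset.card_range, nsmul_eq_mul,
        le_inv_mul_iff₀ hn0]
      have h6 := (abs_le.1 h4).1
      -- Because `p ≥ 3`, the threshold of stage `1` is at most `-lam / 2`. The reward is at least
      -- `-lam / 4` and the averaged test noise at least `-lam / 4`, so the test cannot fail.
      have h7 : lam * (1 - p * (1 / 2) ^ 1) ≤ -(lam / 2) := by nlinarith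
      have h8 : -(lam / 4) ≤ basisReward Λ b
        (armOut (basisReward Λ b) (ξ · ω) (η · ω) L n m 1 (I + 1) u) := by
        refine le_trans ?_ h3
        linarith
      have h9 := mul_le_mul_of_nonneg_left h7 hn0.le
      have h10 := mul_le_mul_of_nonneg_left h8 hn0.le
      have h11 := mul_le_mul_of_nonneg_left hρ1 hn0.le
      linarith
    · obtain ⟨u, hu, hus⟩ : ∃ u < L, ∀ s : Fin p, ξ (u * p + s) ω ∈ initSet (b s) K i₀ γ := by
        by_contra hcon
        exact hωB fun u hu hs => hcon ⟨u, hu, hs⟩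
      obtain ⟨h1, h2⟩ := hidx u hu
      refine ⟨u, hu, le_basisReward_of_dominates hp hlam.le hΛ₀ hΛ hR.final_pos.le hrf _ ?_⟩
      exact dominates_powerOut (K := K) (n := n) (D := D) (ξ := (ξ · ω)) (η := (η · ω)) hp
        hlam hlam1 hΛ₀ hΛ hΛK hm hρ hR hblock hI _ _
        (by omega) (by omega) _ fun s => leads_normalize hR.margin_pos (hus s)

end Phase

/-! ### Upper confidence bounds -/

section UCB

variable {L : ℕ}

/-- The arm played by a UCB round. -/
def ucbChoice (b : ℝ) (s : (Fin L → ℕ) × (Fin L → ℝ)) : Option (Fin L) :=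
  (List.finRange L).argmax fun i => s.2 i / s.1 i + Real.sqrt (b / s.1 i)

/-- The numbers of plays and the total rewards of the arms after `u` UCB rounds, for arms with
means `μ` and noise `e`. -/
def ucbState (μ : Fin L → ℝ) (e : ℕ → ℝ) (b : ℝ) : ℕ → (Fin L → ℕ) × (Fin L → ℝ)
  | 0 => (fun _ => 1, fun i => μ i + e i)
  | u + 1 =>
    let s := ucbState μ e b u
    (fun i => s.1 i + if ucbChoice b s = some i then 1 else 0,
      fun i => s.2 i + if ucbChoice b s = some i then μ i + e (L + u) else 0)

/-- Whether the play `v` of the UCB phase is a play of the arm `i`. -/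
def ucbWeight (μ : Fin L → ℝ) (e : ℕ → ℝ) (b : ℝ) (i : Fin L) (v : ℕ) : ℝ :=
  if v < L then if v = i then 1 else 0
  else if ucbChoice b (ucbState μ e b (v - L)) = some i then 1 else 0

variable (μ : Fin L → ℝ) (e : ℕ → ℝ) (b : ℝ)

theorem one_le_ucbState (u : ℕ) (i : Fin L) : 1 ≤ (ucbState μ e b u).1 i := by
  induction u with
  | zero => exact le_rfl
  | succ u ih => exact ih.trans (Nat.le_add_right _ _)

theorem ucbState_le (u : ℕ) (i : Fin L) : (ucbState μ e b u).1 i ≤ u + 1 := by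
  induction u with
  | zero => exact le_rfl
  | succ u ih =>
    simp only [ucbState]
    split_ifs <;> omega

theorem ucbChoice_ne_none (hL : 0 < L) (s : (Fin L → ℕ) × (Fin L → ℝ)) :
    ∃ i, ucbChoice b s = some i := by
  rw [← Option.ne_none_iff_exists']
  intro h
  have := congrArg List.length (List.argmax_eq_none.1 h)
  simp at this
  omega

theorem ucbState_sum (hL : 0 < L) (u : ℕ) : ∑ i, (ucbState μ e b u).1 i = L + u := by
  induction u with
  | zero => simp [ucbState]
  | succ u ih =>
    obtain ⟨c, hc⟩ := ucbChoice_ne_none b hL (ucbState μ e b u)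
    simp only [ucbState, Finset.sum_add_distrib, ih, hc, Option.some.injEq]
    simp [add_assoc]

/-- The deviation of an empirical mean becomes a noise sum with predictable `0`-`1` weights, whose
quadratic variation is exactly the number of plays of the arm. -/
theorem ucbState_eq_sum_weight (u : ℕ) (i : Fin L) :
    (ucbState μ e b u).2 i - (ucbState μ e b u).1 i * μ i =
        ∑ v ∈ Finset.range (L + u), ucbWeight μ e b i v * e v ∧
      ((ucbState μ e b u).1 i : ℝ) = ∑ v ∈ Finset.range (L + u), ucbWeight μ e b i v ^ 2 := by
  induction u with
  | zero =>
    have h : ∀ v ∈ Finset.range L, ucbWeight μ e b i v = if v = i then 1 else 0 := fun v hv => by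
      rw [ucbWeight, if_pos (Finset.mem_range.1 hv)]
    constructor
    · rw [add_zero, Finset.sum_congr rfl fun v hv => by rw [h v hv]]
      simp [ucbState]
    · rw [add_zero, Finset.sum_congr rfl fun v hv => by rw [h v hv]]
      simp [ucbState]
  | succ u ih =>
    have h : ucbWeight μ e b i (L + u) =
        if ucbChoice b (ucbState μ e b u) = some i then 1 else 0 := by
      rw [ucbWeight, if_neg (by omega), Nat.add_sub_cancel_left]
    rw [← add_assoc, Finset.sum_range_succ, Finset.sum_range_succ, ← ih.1, ← ih.2, h]
    simp only [ucbState]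
    split_ifs <;> simp
    ring

/-- Regret of UCB when all empirical means are accurate. -/
theorem sum_ucb_regret_le (hb : 0 < b) {n : ℕ} {opt ε : ℝ} (hμ : ∃ i, opt - ε ≤ μ i)
    (h : ∀ u < n, ∀ i, |(ucbState μ e b u).2 i - (ucbState μ e b u).1 i * μ i| ≤
      Real.sqrt (b * (ucbState μ e b u).1 i)) (a₀ : ℝ) :
    ∑ u ∈ Finset.range n, (opt - (ucbChoice b (ucbState μ e b u)).elim a₀ μ) ≤
      n * ε + 6 * Real.sqrt (b * (L * (L + n))) := by
  obtain ⟨j, hj⟩ := hμ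
  have hL : 0 < L := Fin.pos j
  -- A potential argument: a round playing an arm with `N` earlier plays costs at most `ε + 2 √(b /
  -- N)`, and the second term is paid for by the increase of `Φ`.
  set Φ : ℕ → ℝ := fun u => ∑ i, Real.sqrt ((ucbState μ e b u).1 i) with hΦ
  have step : ∀ u < n, opt - (ucbChoice b (ucbState μ e b u)).elim a₀ μ ≤
      ε + 6 * Real.sqrt b * (Φ (u + 1) - Φ u) := by
    intro u hu
    obtain ⟨c, hc⟩ := ucbChoice_ne_none b hL (ucbState μ e b u)
    have hmax := (List.argmax_eq_some_iff.1 hc).2.1 j (List.mem_finRange j)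
    have hpos : ∀ i, (0 : ℝ) < (ucbState μ e b u).1 i := fun i =>
      Nat.cast_pos.2 (one_le_ucbState μ e b u i)
    have hmean : ∀ i, |(ucbState μ e b u).2 i / (ucbState μ e b u).1 i - μ i| ≤
        Real.sqrt (b / (ucbState μ e b u).1 i) := fun i => by
      have h1 := h u hu i
      have h2 := hpos i
      set N : ℝ := ((ucbState μ e b u).1 i : ℝ)
      rw [show (ucbState μ e b u).2 i / N - μ i = ((ucbState μ e b u).2 i - N * μ i) / N by
        field_simp, abs_div, abs_of_pos h2, div_le_iff₀ h2]
      refine h1.trans (le_of_eq ?_)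
      nth_rw 3 [← Real.sqrt_sq h2.le]
      rw [← Real.sqrt_mul (by positivity)]
      congr 1
      field_simp
    have h1 := abs_le.1 (hmean j)
    have h2 := abs_le.1 (hmean c)
    have hdiff : Φ (u + 1) - Φ u =
        Real.sqrt ((ucbState μ e b u).1 c + 1) - Real.sqrt ((ucbState μ e b u).1 c) := by
      rw [hΦ]
      simp only [← Finset.sum_sub_distrib, ucbState, hc, Option.some.injEq]
      rw [Finset.sum_eq_single c (fun i _ hi => by simp [hi.symm]) (by simp)]
      simp
    have hN := hpos c
    have hN1 : (1 : ℝ) ≤ (ucbState μ e b u).1 c := Nat.one_le_cast.2 (one_le_ucbState μ e b u c)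
    set N : ℝ := ((ucbState μ e b u).1 c : ℝ)
    have hgap : 2 * Real.sqrt (b / N) ≤ 6 * Real.sqrt b * (Real.sqrt (N + 1) - Real.sqrt N) := by
      rw [Real.sqrt_div hb.le]
      have hs := Real.sqrt_pos.2 hN
      have hs1 : Real.sqrt (N + 1) ≤ 2 * Real.sqrt N := by
        rw [Real.sqrt_le_left (by positivity), mul_pow, Real.sq_sqrt hN.le]
        linarith
      have hs2 : Real.sqrt (N + 1) - Real.sqrt N = (Real.sqrt (N + 1) + Real.sqrt N)⁻¹ := by
        refine eq_inv_of_mul_eq_one_left ?_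
        have e1 := Real.sq_sqrt hN.le
        have e2 := Real.sq_sqrt (by positivity : 0 ≤ N + 1)
        linear_combination e2 - e1
      -- From `√(N + 1) ≤ 2 √N`, valid as every arm has been played at least once.
      have hs3 : (3 * Real.sqrt N)⁻¹ ≤ Real.sqrt (N + 1) - Real.sqrt N := by
        rw [hs2]
        exact inv_anti₀ (by positivity) (by linarith)
      calc 2 * (Real.sqrt b / Real.sqrt N) = 6 * Real.sqrt b * (3 * Real.sqrt N)⁻¹ := by
            field_simp
            norm_num
        _ ≤ _ := by gcongr
    rw [hc, hdiff]
    simp only [Option.elim]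
    linarith
  have hΦ0 : 0 ≤ Φ 0 := Finset.sum_nonneg fun i _ => Real.sqrt_nonneg _
  -- Cauchy-Schwarz, with total play count `L + n`.
  have hΦn : Φ n ≤ Real.sqrt (L * (L + n)) := by
    apply Real.le_sqrt_of_sq_le
    have h1 := sq_sum_le_card_mul_sum_sq (s := Finset.univ)
      (f := fun i : Fin L => Real.sqrt ((ucbState μ e b n).1 i))
    simp only [Real.sq_sqrt (Nat.cast_nonneg _), Finset.card_univ, Fintype.card_fin] at h1
    rw [← Nat.cast_sum, ucbState_sum μ e b hL] at h1
    push_cast at h1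
    exact h1
  calc _ ≤ ∑ u ∈ Finset.range n, (ε + 6 * Real.sqrt b * (Φ (u + 1) - Φ u)) :=
        Finset.sum_le_sum fun u hu => step u (Finset.mem_range.1 hu)
    _ = n * ε + 6 * Real.sqrt b * (Φ n - Φ 0) := by
      rw [Finset.sum_add_distrib, ← Finset.mul_sum, Finset.sum_range_sub]
      simp
    _ ≤ _ := by
      rw [Real.sqrt_mul hb.le, ← mul_assoc]
      gcongr
      linarith

end UCB

/-! ### The UCB program and its closed form -/

section Run

variable {d p : ℕ} {f : Action d p → ℝ} {ξ : ℕ → Vec d} {η : ℕ → ℝ}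

/-- The program keeps its state by overwriting one entry, the recursion by adding indicators; the
induction identifies the two. With no arms the state never changes and the default action is played.
-/
theorem runs_ucbRounds (arms : List (Action d p)) (b : ℝ) (t₀ n u i : ℕ) :
    Runs f ξ η
      (ucbRounds arms b n (ucbState (fun i => f (arms.get i)) (fun v => η (t₀ + v)) b u).1
        (ucbState (fun i => f (arms.get i)) (fun v => η (t₀ + v)) b u).2) i
      (t₀ + (arms.length + u)) ()
      ((List.range' u n).map fun v =>
        (ucbChoice b (ucbState (fun i => f (arms.get i)) (fun v => η (t₀ + v)) b v)).elim
          (fun _ => normalize 0) arms.get) i (t₀ + (arms.length + u) + n) := by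
  induction n generalizing u with
  | zero => exact .ret _ _ _
  | succ n ih =>
    have h := ih (u + 1)
    rw [List.range'_succ, List.map_cons]
    generalize hc : ucbChoice b (ucbState (fun i => f (arms.get i)) (fun v => η (t₀ + v)) b u) = c
      at h ⊢
    have hc' := hc
    unfold ucbChoice at hc'
    unfold ucbRounds
    rw [hc']
    have e : t₀ + (arms.length + u) + (n + 1) = t₀ + (arms.length + (u + 1)) + n := by ring
    rw [e]
    cases c with
    | none =>
      refine .play ?_
      have e1 : ucbState (fun i => f (arms.get i)) (fun v => η (t₀ + v)) b (u + 1) =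
          ucbState (fun i => f (arms.get i)) (fun v => η (t₀ + v)) b u := by
        rw [ucbState, hc]
        simp
      rw [e1] at h
      exact h
    | some j =>
      refine .play ?_
      have e1 : ucbState (fun i => f (arms.get i)) (fun v => η (t₀ + v)) b (u + 1) =
          (Function.update (ucbState (fun i => f (arms.get i)) (fun v => η (t₀ + v)) b u).1 j
            ((ucbState (fun i => f (arms.get i)) (fun v => η (t₀ + v)) b u).1 j + 1),
          Function.update (ucbState (fun i => f (arms.get i)) (fun v => η (t₀ + v)) b u).2 j
            ((ucbState (fun i => f (arms.get i)) (fun v => η (t₀ + v)) b u).2 j +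
              (f (arms.get j) + η (t₀ + (arms.length + u))))) := by
        rw [ucbState, hc]
        ext i
        · by_cases hij : i = j
          · subst hij; simp
          · simp [hij, Ne.symm hij]
        · by_cases hij : i = j
          · subst hij; simp
          · simp [hij, Ne.symm hij]
      rw [e1] at h
      exact h

theorem runs_forList_play (arms : List (Action d p)) (l : List (Fin arms.length)) (i t : ℕ)
    (R : Fin arms.length → ℝ) :
    Runs f ξ η (Prog.forList (fun i R => .play (arms.get i) fun r =>
        .ret (Function.update R i r)) l R) i t
      (iter (fun j _ t R => Function.update R j (f (arms.get j) + η t)) 0 1 l i t R)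
      (l.map arms.get) i (t + l.length) := by
  induction l generalizing i t R with
  | nil => exact .ret _ _ _
  | cons j l ih =>
    rw [List.map_cons, List.length_cons, show t + (l.length + 1) = t + 1 + l.length by ring]
    exact .play (ih _ _ _)

theorem runs_ucb (arms : List (Action d p)) (b : ℝ) (n i t : ℕ) :
    Runs f ξ η (ucb arms b n) i t ()
      (arms ++ (List.range n).map fun v =>
        (ucbChoice b (ucbState (fun i => f (arms.get i)) (fun v => η (t + v)) b v)).elim
          (fun _ => normalize 0) arms.get) i (t + arms.length + n) := by
  have h1 := runs_forList_play (f := f) (ξ := ξ) (η := η) arms (List.finRange arms.length) i t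
    fun _ => 0
  have h2 := runs_ucbRounds (f := f) (ξ := ξ) (η := η) arms b t n 0 i
  rw [iter_update (fun j _ t => f (arms.get j) + η t)] at h1
  simp only [mul_one] at h1
  rw [List.length_finRange, ← List.ofFn_eq_map, List.ofFn_get] at h1
  rw [← List.range_eq_range', add_zero] at h2
  exact h1.bind h2

end Run

/-! ### The outcomes are determined by the past -/

section Measurability

variable {d p : ℕ}

theorem measurable_normalize : Measurable (normalize : Vec d → UnitBall d) :=
  Measurable.subtype_mk (by fun_prop)

theorem measurable_clip : Measurable (clip : Vec d → UnitBall d) :=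
  Measurable.subtype_mk (by fun_prop)

theorem measurable_update_slot {Ω : Type*} [MeasurableSpace Ω] {a : Ω → Action d p}
    {x : Ω → UnitBall d} (ha : Measurable a) (hx : Measurable x) (j : Fin p) :
    Measurable fun ω => Function.update (a ω) j (x ω) := by
  refine measurable_pi_iff.2 fun s => ?_
  by_cases h : s = j
  · subst h
    simpa using hx
  · simp only [Function.update_of_ne h]
    exact (measurable_pi_apply s).comp ha

variable {Ω : Type*} [MeasurableSpace Ω] {f : Action d p → ℝ} {ξ : ℕ → Ω → Vec d}
  {η : ℕ → Ω → ℝ} {t₁ : ℕ}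

/-- The σ-algebra on `Ω` is left arbitrary, requiring all draws but only the noise before `t₁` to be
measurable. The lemmas of this section are later used with the history σ-algebras, where they
express predictability. -/
theorem measurable_slotMean (hf : Measurable f) (hξ : ∀ i, Measurable (ξ i))
    (hη : ∀ t < t₁, Measurable (η t)) {n : ℕ} {m ζ : ℝ} (j : Fin p) (i : ℕ) {t : ℕ}
    (ht : t + n ≤ t₁) {a : Ω → Action d p} (ha : Measurable a) :
    Measurable fun ω => slotMean f (ξ · ω) (η · ω) n m ζ j i t (a ω) := by
  have hz : ∀ u, Measurable fun ω => (Real.sqrt m)⁻¹ • ξ (i + u) ω := fun u =>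
    (continuous_const_smul _).measurable.comp (hξ (i + u))
  have haj : Measurable fun ω => (a ω j : Vec d) :=
    measurable_subtype_coe.comp ((measurable_pi_apply j).comp ha)
  have htent : ∀ u, Measurable fun ω => tentative ζ (a ω) j ((Real.sqrt m)⁻¹ • ξ (i + u) ω) :=
    fun u => measurable_update_slot ha
      (measurable_clip.comp (((continuous_const_smul (1 - ζ)).measurable.comp haj).add
        ((continuous_const_smul ζ).measurable.comp (hz u)))) j
  have hsum : Measurable fun ω => ∑ u ∈ Finset.range n,
      (f (tentative ζ (a ω) j ((Real.sqrt m)⁻¹ • ξ (i + u) ω)) + η (t + u) ω) •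
        ((Real.sqrt m)⁻¹ • ξ (i + u) ω) := by
    refine Finset.measurable_sum _ fun u hu => ?_
    have hu' := Finset.mem_range.1 hu
    exact ((hf.comp (htent u)).add (hη _ (by omega))).smul (hz u)
  have e : (fun ω => slotMean f (ξ · ω) (η · ω) n m ζ j i t (a ω)) = fun ω => (n : ℝ)⁻¹ •
      ∑ u ∈ Finset.range n,
      (f (tentative ζ (a ω) j ((Real.sqrt m)⁻¹ • ξ (i + u) ω)) + η (t + u) ω) •
        ((Real.sqrt m)⁻¹ • ξ (i + u) ω) := by
    funext ω
    rw [slotMean, ← List.sum_toFinset _ List.nodup_range, List.toFinset_range]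
  rw [e]
  exact (continuous_const_smul (n : ℝ)⁻¹).measurable.comp hsum

theorem measurable_slotOut (hf : Measurable f) (hξ : ∀ i, Measurable (ξ i))
    (hη : ∀ t < t₁, Measurable (η t)) {n : ℕ} {m ζ : ℝ} (j : Fin p) (i : ℕ) {t : ℕ}
    (ht : t + n ≤ t₁) {a : Ω → Action d p} (ha : Measurable a) :
    Measurable fun ω => slotOut f (ξ · ω) (η · ω) n m ζ j i t (a ω) :=
  measurable_update_slot ha (measurable_normalize.comp (measurable_slotMean hf hξ hη j i ht ha)) j

theorem measurable_iter {α β : Type} [MeasurableSpace α] {F : Ω → β → ℕ → ℕ → α → α} {D N : ℕ}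
    (hF : ∀ b i t, t + N ≤ t₁ → ∀ x : Ω → α, Measurable x →
      Measurable fun ω => F ω b i t (x ω)) (l : List β) (i t : ℕ) (ht : t + l.length * N ≤ t₁)
    {x : Ω → α} (hx : Measurable x) : Measurable fun ω => iter (F ω) D N l i t (x ω) := by
  induction l generalizing i t x with
  | nil => exact hx
  | cons b l ih =>
    rw [List.length_cons, Nat.add_mul, Nat.one_mul] at ht
    exact ih (i + D) (t + N) (by omega) (hF b i t (by omega) x hx)

theorem measurable_powerOut (hf : Measurable f) (hξ : ∀ i, Measurable (ξ i))
    (hη : ∀ t < t₁, Measurable (η t)) {n : ℕ} {m ζ : ℝ} {I : ℕ} (i : ℕ) {t : ℕ}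
    (ht : t + I * (p * n) ≤ t₁) {a : Ω → Action d p} (ha : Measurable a) :
    Measurable fun ω => powerOut f (ξ · ω) (η · ω) n m ζ I i t (a ω) := by
  refine measurable_iter (t₁ := t₁) (fun _ i t ht x hx => ?_) _ i t (by simpa using ht) ha
  exact measurable_iter (t₁ := t₁) (fun j i t ht x hx => measurable_slotOut hf hξ hη j i ht hx)
    _ i t (by simpa using ht) hx

theorem measurable_armOut (hf : Measurable f) (hξ : ∀ i, Measurable (ξ i)) {L n : ℕ} {m ζ : ℝ}
    {I u : ℕ} (hu : u < L) (hη : ∀ t < L * (I * (p * n) + n), Measurable (η t)) :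
    Measurable fun ω => armOut f (ξ · ω) (η · ω) L n m ζ I u := by
  have h1 : (u + 1) * (I * (p * n) + n) ≤ L * (I * (p * n) + n) := Nat.mul_le_mul_right _ hu
  refine measurable_powerOut hf hξ hη _ (by nlinarith) ?_
  exact measurable_pi_iff.2 fun j => measurable_normalize.comp (hξ _)

theorem measurableSet_ucbChoice {L : ℕ} (b : ℝ) {s : Ω → (Fin L → ℕ) × (Fin L → ℝ)}
    (hs : Measurable s) (i : Fin L) : MeasurableSet {ω | ucbChoice b (s ω) = some i} := by
  have hF : ∀ j, Measurable fun ω => (s ω).2 j / (s ω).1 j + Real.sqrt (b / (s ω).1 j) :=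
    fun j => by
      have h1 : Measurable fun ω => (((s ω).1 j : ℕ) : ℝ) :=
        measurable_from_top.comp ((measurable_pi_apply j).comp hs.fst)
      have h2 : Measurable fun ω => (s ω).2 j := (measurable_pi_apply j).comp hs.snd
      exact (h2.div h1).add ((h1.const_div b).sqrt)
  -- Being the chosen arm is a finite system of inequalities between indices of arms; ties go to the
  -- arm listed first.
  simp only [ucbChoice, List.argmax_eq_some_iff, List.mem_finRange, true_and, forall_true_left,
    Set.ofPred_and, Set.ofPred_forall]
  refine MeasurableSet.inter ?_ ?_
  · exact .iInter fun j => measurableSet_le (hF j) (hF i)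
  · exact .iInter fun j => (measurableSet_le (hF i) (hF j)).imp (.const _)

theorem measurable_ucbState {L : ℕ} (b : ℝ) {μ : Ω → Fin L → ℝ} (hμ : Measurable μ)
    {e : ℕ → Ω → ℝ} (u : ℕ) (he : ∀ v < L + u, Measurable (e v)) :
    Measurable fun ω => ucbState (μ ω) (e · ω) b u := by
  induction u with
  | zero =>
    refine measurable_const.prodMk (measurable_pi_iff.2 fun i => ?_)
    exact ((measurable_pi_apply i).comp hμ).add (he _ (by omega))
  | succ u ih =>
    have ih' := ih fun v hv => he v (by omega)
    have hc := measurableSet_ucbChoice b ih'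
    refine Measurable.prodMk (measurable_pi_iff.2 fun i => ?_) (measurable_pi_iff.2 fun i => ?_)
    · exact ((measurable_pi_apply i).comp ih'.fst).add
        (Measurable.ite (hc i) measurable_const measurable_const)
    · exact ((measurable_pi_apply i).comp ih'.snd).add
        (Measurable.ite (hc i) (((measurable_pi_apply i).comp hμ).add (he _ (by omega)))
          measurable_const)

end Measurability

/-! ### Regret of the bandit algorithm -/

section Regret

variable {d p : ℕ} {Ω : Type*} [MeasurableSpace Ω] [StandardBorelSpace Ω] {P : Measure Ω}
  [IsProbabilityMeasure P] {ξ : ℕ → Ω → Vec d} {η : ℕ → Ω → ℝ}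

/-- All empirical means of the UCB phase are accurate, except with small probability. -/
theorem IsBanditRandomness.measure_ucb_le (h : IsBanditRandomness P ξ η) {L t₁ : ℕ} {b : ℝ}
    (hb : 0 < b) {μ : Ω → Fin L → ℝ} (hμ : Measurable[history ξ η t₁] μ) (n : ℕ) :
    P {ω | ∃ u < n, ∃ i,
        Real.sqrt (b * (ucbState (μ ω) (fun v => η (t₁ + v) ω) b u).1 i) <
          |(ucbState (μ ω) (fun v => η (t₁ + v) ω) b u).2 i -
            (ucbState (μ ω) (fun v => η (t₁ + v) ω) b u).1 i * μ ω i|} ≤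
      ENNReal.ofReal (L * n ^ 2 * (2 * Real.exp (-(b / 2)))) := by
  have hw : ∀ (i : Fin L) (v : ℕ), Measurable[history ξ η (t₁ + v)]
      fun ω => ucbWeight (μ ω) (fun v => η (t₁ + v) ω) b i v := by
    intro i v
    unfold ucbWeight
    by_cases hv : v < L
    · simp only [if_pos hv]
      exact measurable_const
    · simp only [if_neg hv]
      refine Measurable.ite ?_ measurable_const measurable_const
      refine @measurableSet_ucbChoice Ω (history ξ η (t₁ + v)) L b _ ?_ i
      refine @measurable_ucbState Ω (history ξ η (t₁ + v)) L b μ ?_ (fun v => η (t₁ + v)) (v - L) ?_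
      · exact hμ.mono (history_mono ξ η (Nat.le_add_right _ _)) le_rfl
      · exact fun w hw => measurable_noise_history ξ η (by omega)
  -- The number of plays of an arm is random, so the union bound also runs over its possible values
  -- `1, …, n`; each value fixes the bound on the quadratic variation, and the tail `exp (-b / 2)`
  -- is the same for all.
  have key := measure_exists_mem_le P
    ((Finset.univ : Finset (Fin L)) ×ˢ (Finset.range n ×ˢ Finset.Icc 1 n))
    (fun x ω => Real.sqrt (b * x.2.2) < |∑ v ∈ Finset.range (L + x.2.1),
        ucbWeight (μ ω) (fun v => η (t₁ + v) ω) b x.1 v * η (t₁ + v) ω| ∧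
      ∑ v ∈ Finset.range (L + x.2.1), ucbWeight (μ ω) (fun v => η (t₁ + v) ω) b x.1 v ^ 2 ≤ x.2.2)
    (c := 2 * Real.exp (-(b / 2))) (fun x hx => by
      have hc : (1 : ℝ) ≤ x.2.2 := by
        exact_mod_cast (Finset.mem_Icc.1 (Finset.mem_product.1 (Finset.mem_product.1 hx).2).2).1
      have := h.measure_abs_sum_block_gt_le t₁ (hw x.1) (L + x.2.1)
        (Real.sqrt_nonneg (b * x.2.2)) (v := x.2.2) (by linarith)
      rw [Real.sq_sqrt (by positivity)] at this
      refine this.trans (le_of_eq ?_)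
      congr 4
      field_simp)
  refine le_trans (measure_mono ?_) (key.trans (le_of_eq ?_))
  · rintro ω ⟨u, hu, i, hi⟩
    obtain ⟨h1, h2⟩ := ucbState_eq_sum_weight (μ ω) (fun v => η (t₁ + v) ω) b u i
    refine ⟨(i, u, (ucbState (μ ω) (fun v => η (t₁ + v) ω) b u).1 i), ?_, ?_, ?_⟩
    · simp only [Finset.mem_product, Finset.mem_univ, Finset.mem_range, Finset.mem_Icc, true_and]
      exact ⟨hu, one_le_ucbState _ _ _ _ _, (ucbState_le _ _ _ _ _).trans hu⟩
    · rw [h1] at hi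
      exact hi
    · exact h2.ge
  · simp only [Finset.card_product, Finset.card_univ, Fintype.card_fin, Finset.card_range,
      Nat.card_Icc]
    push_cast [Nat.add_sub_cancel]
    ring_nf

theorem regret_le_of_runs {α : Type} {Q : Prog d p α} {f : Action d p → ℝ} {ξ : ℕ → Vec d}
    {η : ℕ → ℝ} {x : α} {as : List (Action d p)} {i t : ℕ}
    (h : Runs f ξ η Q 0 0 x as i t) (hf : ∀ a, f a ≤ optReward f) (n : ℕ) :
    regret Q f ξ η n ≤ (as.map fun a => optReward f - f a).sum := by
  rw [regret, actions, h.runFrom_eq]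
  conv_rhs => rw [← List.take_append_drop n as, List.map_append, List.sum_append]
  refine le_add_of_nonneg_right (List.sum_nonneg fun y hy => ?_)
  obtain ⟨a, -, rfl⟩ := List.mem_map.1 hy
  exact sub_nonneg.2 (hf a)

theorem sum_regret_le {f : Action d p → ℝ} {c : ℝ} (hf : ∀ a, optReward f - f a ≤ c)
    (as : List (Action d p)) : (as.map fun a => optReward f - f a).sum ≤ as.length * c := by
  have := List.sum_le_card_nsmul (as.map fun a => optReward f - f a) c fun y hy => by
    obtain ⟨a, -, rfl⟩ := List.mem_map.1 hy
    exact hf a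
  simpa using this

/-- The regret of UCB over arms of which one is nearly optimal. -/
theorem regret_banditAlg_le {f : Action d p → ℝ} {c : ℝ} (hf : ∀ a, f a ≤ optReward f)
    (hc : ∀ a, optReward f - f a ≤ c) {ξ : ℕ → Vec d} {η : ℕ → ℝ} {lam b ε : ℝ} (hb : 0 < b)
    {θ : Params} {arms : List (Action d p)} {L i t n : ℕ} (hL : arms.length = L)
    (hends : Ends f ξ η (phasedElimination d p lam θ) 0 0 arms i t) {μ : Fin L → ℝ}
    (hμ : ∀ i : Fin L, μ i = f (arms.get (i.cast hL.symm))) (hε : ∃ i, optReward f - ε ≤ μ i)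
    (hucb : ∀ u < n, ∀ i, |(ucbState μ (fun v => η (t + v)) b u).2 i -
        (ucbState μ (fun v => η (t + v)) b u).1 i * μ i| ≤
      Real.sqrt (b * (ucbState μ (fun v => η (t + v)) b u).1 i)) :
    regret (banditAlg d p lam θ b n) f ξ η n ≤
      (t + L) * c + (n * ε + 6 * Real.sqrt (b * (L * (L + n)))) := by
  subst hL
  obtain rfl : μ = fun i => f (arms.get i) := funext hμ
  obtain ⟨as, has⟩ := hends
  have hlen := has.length_add
  have hrun := has.bind (g := fun arms => ucb arms b n) (runs_ucb arms b n i t)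
  refine (regret_le_of_runs hrun hf n).trans ?_
  rw [List.map_append, List.map_append, List.sum_append, List.sum_append, add_mul, add_assoc]
  -- The three periods: elimination and the first play of every arm, at the worst possible regret
  -- per play, then the UCB rounds.
  refine add_le_add ?_ (add_le_add ?_ ?_)
  · rw [← hlen]
    exact sum_regret_le hc as
  · exact sum_regret_le hc arms
  · refine le_trans (le_of_eq ?_)
      (sum_ucb_regret_le _ _ b hb hε hucb (f fun _ => normalize 0))
    rw [List.map_map, ← List.sum_toFinset _ List.nodup_range, List.toFinset_range]
    refine Finset.sum_congr rfl fun u _ => ?_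
    simp only [Function.comp]
    cases ucbChoice b (ucbState (fun i => f (arms.get i)) (fun v => η (t + v)) b u) <;> rfl

/-- The regret of the bandit algorithm, when phased elimination outputs all its candidates and one
of them is nearly optimal, except with small probability. -/
theorem IsBanditRandomness.measure_regret_gt_le {k : ℕ} [NeZero k] {lam : ℝ} (hp : 3 ≤ p)
    (hlam : 0 < lam) (T : OrthTensor d p k lam) (h : IsBanditRandomness P ξ η) {θ : Params}
    (hθ : θ.stages = 1) {b ε : ℝ} (hb : 0 < b) (n : ℕ) {G : Set Ω}
    (hG : ∀ ω ∈ G, stageOut T.reward (ξ · ω) (η · ω) (lam * (1 - p * (1 / 2) ^ 1)) (θ.samples 1)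
        (θ.invVar 1) (θ.weight 1) (θ.sweeps 1)
        ((List.range θ.inits).map fun u => initOut (ξ · ω) (u * p)) (θ.inits * p) 0 =
          (List.range θ.inits).map (armOut T.reward (ξ · ω) (η · ω) θ.inits (θ.samples 1)
            (θ.invVar 1) (θ.weight 1) (θ.sweeps 1)) ∧
      ∃ u < θ.inits, lam - ε ≤ T.reward (armOut T.reward (ξ · ω) (η · ω) θ.inits (θ.samples 1)
            (θ.invVar 1) (θ.weight 1) (θ.sweeps 1) u)) :
    P {ω | ¬ regret (banditAlg d p lam θ b n) T.reward (ξ · ω) (η · ω) n ≤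
        (θ.inits * (θ.sweeps 1 * (p * θ.samples 1) + θ.samples 1) + θ.inits) * (2 * lam) +
          (n * ε + 6 * Real.sqrt (b * (θ.inits * (θ.inits + n))))} ≤
      P Gᶜ + ENNReal.ofReal (θ.inits * n ^ 2 * (2 * Real.exp (-(b / 2)))) := by
  obtain ⟨B, Λ, K, i₀, hi₀, hK, hΛ₀, hΛ, hΛK, hT⟩ := T.exists_basisReward hlam (by omega)
  rw [hT] at hG ⊢
  set t₁ := θ.inits * (θ.sweeps 1 * (p * θ.samples 1) + θ.samples 1) with ht₁
  set arm : ℕ → Ω → Action d p := fun u ω => armOut (basisReward Λ B) (ξ · ω) (η · ω) θ.inits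
    (θ.samples 1) (θ.invVar 1) (θ.weight 1) (θ.sweeps 1) u
  -- The arms are random, but their means are known before the first UCB noise, so the confidence
  -- bounds apply without conditioning on the arms.
  have hμ : Measurable[history ξ η t₁]
      fun ω (i : Fin θ.inits) => basisReward Λ B (arm i ω) := by
    refine (@measurable_pi_iff Ω (Fin θ.inits) (fun _ => ℝ) (history ξ η t₁) _ _).2 fun i =>
      measurable_basisReward.comp ?_
    refine @measurable_armOut d p Ω (history ξ η t₁) _ ξ η measurable_basisReward ?_ _ _ _ _ _ _
      i.2 ?_
    · exact fun j => measurable_draw_history ξ η j t₁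
    · exact fun t ht => measurable_noise_history ξ η ht
  refine le_trans (measure_mono ?_) ((measure_union_le Gᶜ _).trans
    (add_le_add le_rfl (h.measure_ucb_le hb hμ n)))
  intro ω hω
  by_contra hcon
  rw [Set.mem_union, not_or, Set.mem_compl_iff, not_not] at hcon
  obtain ⟨hωG, hωu⟩ := hcon
  obtain ⟨hout, u, hu, hopt⟩ := hG ω hωG
  refine hω ?_
  have hends := ends_phasedElimination (f := basisReward Λ B) (ξ := (ξ · ω)) (η := (η · ω)) lam θ hθ
  rw [hout, ← ht₁] at hends
  have hreg := regret_banditAlg_le (basisReward_le_optReward hΛ hlam.le (by omega))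
    (c := 2 * lam) (fun a => by
      have h1 := optReward_basisReward_le (b := B) hΛ hlam.le (by omega : 1 < p)
      have h2 := (abs_le.1 (abs_basisReward_le (b := B) hΛ hlam.le (by omega) a)).1
      linarith)
    (n := n) (ε := ε) hb (L := θ.inits) (by simp) hends
    (μ := fun i => basisReward Λ B (arm i ω)) (fun i => by simp [arm])
    ⟨⟨u, hu⟩, by
      have h1 := optReward_basisReward_le (b := B) hΛ hlam.le (by omega : 1 < p)
      refine le_trans ?_ hopt
      linarith⟩
    (fun v hv i => by
      by_contra hlt
      exact hωu ⟨v, hv, i, not_le.1 hlt⟩)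
  rw [ht₁] at hreg
  push_cast at hreg
  exact hreg

end Regret

/-! ### Choice of the parameters -/

section Parameters

/-- The error condition for all ratios in between follows from the two extremes: the start, where
the coordinate is only `1 / √(640 d)`, and the end, where it is at least `1 / √2` but the ratio is
small. -/
theorem regime_of_le {d p : ℕ} {lam γ rf τ : ℝ} (hp : 3 ≤ p) (hd : 0 < d) (hlam : 0 < lam)
    (hγ : 0 < γ) (hγ4 : γ ≤ 1 / 4) (hrf : 0 < rf) (hrf2 : rf ≤ 1 / 2)
    (hA : τ ≤ γ / 32 * lam * (Real.sqrt (640 * d))⁻¹ ^ (p - 1))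
    (hB : τ ≤ γ / 16 * rf * lam * (Real.sqrt 2)⁻¹ ^ (p - 1)) :
    Regime d p lam γ (Real.sqrt (640 * d))⁻¹ rf τ := by
  have hd1 : (1 : ℝ) ≤ d := by exact_mod_cast hd
  have hx : 0 < (Real.sqrt (640 * d))⁻¹ := by positivity
  refine ⟨hγ, hγ4, hx, ?_, hrf, ?_, ?_, ?_⟩
  · rw [inv_pow, Real.sq_sqrt (by positivity), inv_mul_le_iff₀ (by positivity)]
    linarith
  · nlinarith
  · refine hA.trans ?_
    have h1 : 1 / 2 ≤ (1 + γ)⁻¹ := by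
      rw [one_div]
      exact inv_anti₀ (by positivity) (by linarith)
    have h2 : 0 ≤ γ / 16 * (lam * (Real.sqrt (640 * d))⁻¹ ^ (p - 1)) := by positivity
    nlinarith
  · intro r hr hr1
    have hr0 : 0 < r := hrf.trans_le hr
    have hr1' : r ≤ 1 := by nlinarith
    -- For `d r ^ 2 ≤ 1` the leading coordinate is at least `1 / √2`. Otherwise `r / √(1 + d r ^ 2)
    -- ≥ 1 / √(2 d)`, so the signal is no weaker than at the start.
    rcases le_total (d * r ^ 2) 1 with h | h
    · refine hB.trans ?_
      have h1 : (Real.sqrt 2)⁻¹ ≤ (Real.sqrt (1 + d * r ^ 2))⁻¹ :=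
        inv_anti₀ (by positivity) (Real.sqrt_le_sqrt (by linarith))
      rw [mul_assoc (γ / 16 * rf)]
      gcongr
    · refine hA.trans ?_
      have h3 : (r * (Real.sqrt (1 + d * r ^ 2))⁻¹) ^ (p - 1) ≤
          r * (Real.sqrt (1 + d * r ^ 2))⁻¹ ^ (p - 1) := by
        rw [mul_pow]
        refine mul_le_mul_of_nonneg_right ?_ (by positivity)
        exact pow_le_of_le_one hr0.le hr1' (by omega)
      have h4 : (Real.sqrt (640 * d))⁻¹ ≤ r * (Real.sqrt (1 + d * r ^ 2))⁻¹ := by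
        rw [← div_eq_mul_inv, inv_eq_one_div, div_le_div_iff₀ (by positivity) (by positivity),
          one_mul]
        nth_rw 2 [← Real.sqrt_sq hr0.le]
        rw [← Real.sqrt_mul (by positivity)]
        exact Real.sqrt_le_sqrt (by nlinarith)
      have h5 : (Real.sqrt (640 * d))⁻¹ ^ (p - 1) ≤
          r * (Real.sqrt (1 + d * r ^ 2))⁻¹ ^ (p - 1) :=
        (pow_le_pow_left₀ hx.le h4 _).trans h3
      calc γ / 32 * lam * (Real.sqrt (640 * d))⁻¹ ^ (p - 1) ≤
            γ / 32 * lam * (r * (Real.sqrt (1 + d * r ^ 2))⁻¹ ^ (p - 1)) := by gcongr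
        _ ≤ γ / 16 * lam * (r * (Real.sqrt (1 + d * r ^ 2))⁻¹ ^ (p - 1)) := by
          gcongr
          norm_num
        _ = _ := by ring

/-- The logarithmic factor of the parameters. -/
def logFactor (p d : ℕ) (ε δ : ℝ) : ℝ := p * (1 + Real.log (d / (ε * δ)))

section

variable {p d k : ℕ} {lam δ ε : ℝ}

theorem one_le_ratio (hd : 0 < d) (hδ : 0 < δ) (hδ1 : δ < 1) (hε : 0 < ε) (hε1 : ε ≤ 1) :
    1 ≤ d / (ε * δ) := by
  have hd1 : (1 : ℝ) ≤ d := by exact_mod_cast hd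
  rw [one_le_div (by positivity)]
  nlinarith

theorem le_logFactor (hd : 0 < d) (hδ : 0 < δ) (hδ1 : δ < 1) (hε : 0 < ε) (hε1 : ε ≤ 1) :
    p ≤ logFactor p d ε δ := by
  have := Real.log_nonneg (one_le_ratio hd hδ hδ1 hε hε1)
  have hp : (0 : ℝ) ≤ p := Nat.cast_nonneg p
  rw [logFactor]
  nlinarith

/-- Powers of `d`, `1 / ε` and `1 / δ` of exponent at most `p` are thus below `exp l` for `l =
logFactor p d ε δ`, so the failure probability can be measured in powers of `exp l` alone. -/
theorem exp_logFactor (hd : 0 < d) (hδ : 0 < δ) (hε : 0 < ε) :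
    Real.exp (logFactor p d ε δ) = (Real.exp 1 * (d / (ε * δ))) ^ p := by
  have hd1 : (0 : ℝ) < d := by exact_mod_cast hd
  rw [logFactor, Real.exp_nat_mul, Real.exp_add, Real.exp_log (by positivity)]

theorem pow_le_exp_logFactor (hd : 0 < d) (hδ : 0 < δ) (hδ1 : δ < 1) (hε : 0 < ε) (hε1 : ε ≤ 1)
    {j : ℕ} (hj : j ≤ p) {x : ℝ} (hx : 0 ≤ x) (hxQ : x ≤ Real.exp 1 * (d / (ε * δ))) :
    x ^ j ≤ Real.exp (logFactor p d ε δ) := by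
  rw [exp_logFactor hd hδ hε]
  have h1 : 1 ≤ Real.exp 1 * (d / (ε * δ)) :=
    one_le_mul_of_one_le_of_one_le (Real.one_le_exp (by norm_num))
      (one_le_ratio hd hδ hδ1 hε hε1)
  exact (pow_le_pow_left₀ hx hxQ j).trans (pow_le_pow_right₀ h1 hj)

end

/-- The sample size makes the errors of the power iteration small enough. -/
theorem regime_of_samples {p d : ℕ} {lam ε l n : ℝ} (hp : 3 ≤ p) (hd : 0 < d) (hlam : 0 < lam)
    (hε : 0 < ε) (hε1 : ε ≤ lam) (hl : p ≤ l)
    (hn : 10 ^ 10 * l ^ 5 * (640 * d) ^ p / (lam * ε) ≤ n) :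
    Regime d p lam (1 / (4 * l)) (Real.sqrt (640 * d))⁻¹ (Real.sqrt (ε / (2 * p * lam * d)))
        (2 * Real.sqrt (180 * d * l) * Real.sqrt (1440 * l / n)) ∧
      d * (2 * Real.sqrt (180 * d * l) * Real.sqrt (1440 * l / n)) ≤ lam / 4 ∧
      Real.sqrt (1440 * l / n) ≤ lam / 4 := by
  have hd1 : (1 : ℝ) ≤ d := by exact_mod_cast hd
  have hp3 : (3 : ℝ) ≤ p := by exact_mod_cast hp
  have hl3 : 3 ≤ l := hp3.trans hl
  set W : ℝ := (640 * d) ^ p with hW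
  have hWpos : 0 < W := by positivity
  have hW0 : (640 * d) * (640 * d) ^ (p - 1) = W := by
    rw [hW, ← pow_succ', Nat.sub_add_cancel (by omega)]
  have hW2 : d ^ 2 * 2 ^ p ≤ W := by
    have h1 : (2 : ℝ) ^ p ≤ 640 ^ p := by gcongr; norm_num
    have h2 : (d : ℝ) ^ 2 ≤ d ^ p := pow_le_pow_right₀ hd1 (by omega)
    rw [hW, mul_pow, mul_comm]
    gcongr
  have hW3 : (d : ℝ) ^ 3 ≤ W := by
    have h1 : (d : ℝ) ^ 3 ≤ d ^ p := pow_le_pow_right₀ hd1 hp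
    have h2 : (d : ℝ) ^ p ≤ (640 * d) ^ p := by gcongr; linarith
    exact h1.trans h2
  have hn' : 10 ^ 10 * l ^ 5 * W ≤ n * (lam * ε) := (div_le_iff₀ (by positivity)).1 hn
  have hn0 : 0 < n := lt_of_lt_of_le (by positivity) hn
  have hnl : 10 ^ 10 * l ^ 5 * W ≤ n * lam ^ 2 := hn'.trans (by
    rw [sq]
    gcongr)
  have hτ : (2 * Real.sqrt (180 * d * l) * Real.sqrt (1440 * l / n)) ^ 2 =
      1036800 * d * l ^ 2 / n := by
    rw [mul_pow, mul_pow, Real.sq_sqrt (by positivity), Real.sq_sqrt (by positivity)]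
    ring
  have hrf : Real.sqrt (ε / (2 * p * lam * d)) ^ 2 = ε / (2 * p * lam * d) :=
    Real.sq_sqrt (by positivity)
  have hrf0 : 0 < Real.sqrt (ε / (2 * p * lam * d)) := Real.sqrt_pos.2 (by positivity)
  have hl45 : l ^ 4 ≤ l ^ 5 := pow_le_pow_right₀ (by linarith) (by norm_num)
  have hl25 : l ^ 2 ≤ l ^ 5 := pow_le_pow_right₀ (by linarith) (by norm_num)
  have hl15 : l ≤ l ^ 5 := le_self_pow₀ (by linarith) (by norm_num)
  refine ⟨regime_of_le hp hd hlam (by positivity) ?_ hrf0 ?_ ?_ ?_, ?_, ?_⟩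
  · rw [div_le_div_iff₀ (by positivity) (by norm_num)]
    linarith
  · rw [Real.sqrt_le_left (by norm_num), div_le_iff₀ (by positivity)]
    have h1 : 3 * lam * 1 ≤ p * lam * d := by gcongr
    linarith
  -- The condition at the start. After squaring it reads `n lam ^ 2 ≳ l ^ 4 (640 d) ^ p`, which
  -- holds because `ε ≤ lam`.
  · refine le_of_abs_le (abs_le_of_sq_le_sq ?_ (by positivity))
    rw [hτ, mul_pow, mul_pow, inv_pow, inv_pow, ← pow_mul, mul_comm (p - 1) 2, pow_mul,
      Real.sq_sqrt (by positivity), div_le_iff₀ hn0]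
    have h1 : (640 * (d : ℝ)) ^ (p - 1) = W / (640 * d) := by
      rw [← hW0]
      field_simp
    rw [h1]
    have h2 : (1 / (4 * l) / 32) ^ 2 * lam ^ 2 * (W / (640 * d))⁻¹ * n =
        (n * lam ^ 2) * (640 * d) / (16384 * l ^ 2 * W) := by
      field_simp
      norm_num
    rw [h2, le_div_iff₀ (by positivity)]
    have h3 : 1036800 * d * l ^ 2 * (16384 * l ^ 2 * W) ≤ 10 ^ 10 * l ^ 5 * W * (640 * d) := by
      have h4 := mul_le_mul_of_nonneg_right hl45 (by positivity : 0 ≤ W * d)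
      nlinarith
    exact h3.trans (by gcongr)
  -- The condition at the final ratio. After squaring it reads `n lam ε ≳ l ^ 4 p d ^ 2 2 ^ p`,
  -- where `p ≤ l` accounts for the fifth power of `l`.
  · refine le_of_abs_le (abs_le_of_sq_le_sq ?_ (by positivity))
    rw [hτ, mul_pow, mul_pow, mul_pow, hrf, inv_pow, inv_pow, ← pow_mul, mul_comm (p - 1) 2,
      pow_mul, Real.sq_sqrt (by positivity), div_le_iff₀ hn0]
    have h1 : (2 : ℝ) ^ (p - 1) = 2 ^ p / 2 := by
      rw [← Nat.sub_add_cancel (by omega : 1 ≤ p), pow_succ, Nat.add_sub_cancel]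
      ring
    rw [h1]
    have h2 : (1 / (4 * l) / 16) ^ 2 * (ε / (2 * p * lam * d)) * lam ^ 2 * (2 ^ p / 2 : ℝ)⁻¹ * n =
        (n * (lam * ε)) / (4096 * l ^ 2 * p * d * 2 ^ p) := by
      field_simp
      norm_num
    rw [h2, le_div_iff₀ (by positivity)]
    refine le_trans ?_ hn'
    have h3 : 1036800 * d * l ^ 2 * (4096 * l ^ 2 * p * d * 2 ^ p) =
        4246732800 * (l ^ 4 * p * (d ^ 2 * 2 ^ p)) := by ring
    rw [h3]
    calc 4246732800 * (l ^ 4 * p * (d ^ 2 * 2 ^ p)) ≤ 10 ^ 10 * (l ^ 4 * l * W) := by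
          gcongr
          norm_num
      _ = _ := by ring
  · refine le_of_abs_le (abs_le_of_sq_le_sq ?_ (by positivity))
    rw [mul_pow, hτ, ← mul_div_assoc, div_le_iff₀ hn0]
    have h1 : (d : ℝ) ^ 2 * (1036800 * d * l ^ 2) = 1036800 * (l ^ 2 * d ^ 3) := by ring
    have h2 : l ^ 2 * (d : ℝ) ^ 3 ≤ l ^ 5 * W := by gcongr
    rw [h1]
    nlinarith
  · refine le_of_abs_le (abs_le_of_sq_le_sq ?_ (by positivity))
    rw [Real.sq_sqrt (by positivity), div_le_iff₀ hn0]
    have h1 : l * 1 ≤ l ^ 5 * W := by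
      gcongr
      exact (one_le_pow₀ hd1).trans hW3
    nlinarith

/-- With `γ = 1 / (4 l)`, each sweep contracts by `exp (-1 / (16 l))`, so `8 l ^ 2` sweeps give `exp
(-l / 2) ≤ √r`. -/
theorem pow_le_of_sweeps {l r : ℝ} {I : ℕ} (hl : 1 ≤ l) (hr : 0 < r)
    (hr1 : 1 / r ≤ Real.exp l) (hI : 8 * l ^ 2 ≤ I) :
    (1 - 1 / (4 * l) / 4) ^ I ≤ Real.sqrt r := by
  have h1 : 0 ≤ 1 - 1 / (4 * l) / 4 := by
    rw [sub_nonneg, div_div, div_le_one (by positivity)]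
    linarith
  have h2 : 1 - 1 / (4 * l) / 4 ≤ Real.exp (-(1 / (16 * l))) := by
    have := Real.add_one_le_exp (-(1 / (16 * l)))
    refine le_trans (le_of_eq ?_) this
    field_simp
    ring
  refine (pow_le_pow_left₀ h1 h2 I).trans ?_
  rw [← Real.exp_nat_mul]
  apply Real.le_sqrt_of_sq_le
  rw [← Real.exp_nat_mul]
  have h3 : Real.exp (-l) ≤ r := by
    rw [Real.exp_neg]
    rw [one_div] at hr1
    exact inv_le_of_inv_le₀ hr hr1
  refine le_trans (Real.exp_le_exp.2 ?_) h3
  have h4 : l ≤ I / (8 * l) := by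
    rw [le_div_iff₀ (by positivity)]
    nlinarith
  have h5 : ((2 : ℕ) : ℝ) * (I * -(1 / (16 * l))) = -(I / (8 * l)) := by
    field_simp
    ring
  rw [h5]
  linarith

end Parameters

/-! ### Failure probability of the chosen parameters -/

section Parameters

theorem twelve_le_exp {l : ℝ} (hl : 3 ≤ l) : 12 ≤ Real.exp l := by
  have h1 : (2.7 : ℝ) ≤ Real.exp 1 := by linarith [Real.exp_one_gt_d9]
  have h2 : (2.7 : ℝ) ^ 3 ≤ Real.exp 1 ^ 3 := pow_le_pow_left₀ (by norm_num) h1 3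
  rw [← Real.exp_nat_mul] at h2
  have h3 : Real.exp 3 ≤ Real.exp l := Real.exp_le_exp.2 hl
  norm_num at h2
  linarith

theorem le_exp_self (l : ℝ) : l ≤ Real.exp l := by linarith [Real.add_one_le_exp l]

/-- The failure probability of the good event. -/
theorem failure_le {p d k L n I : ℕ} {l δ : ℝ} (hp : 0 < p) (hd : 0 < d) (hk : 0 < k) (hδ : 0 < δ)
    (hl : 3 ≤ l) (hpl : p ≤ l) (hd2 : (d : ℝ) ^ 2 ≤ Real.exp l) (hδl : 4 / δ ≤ Real.exp l)
    (hL0 : 0 < L) (hL : L ≤ Real.exp (9 * l)) (hLδ : (60 * k) ^ p * Real.log (4 / δ) ≤ L)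
    (hI : I + 1 ≤ Real.exp (3 * l)) (hn0 : 0 < n) (hn : n ≤ Real.exp (27 * l)) :
    (L * p + L * ((I + 1) * (p * n) + n) + 1 + n) * Real.exp (d - 180 * d * l / 4) +
        8 * p * d ^ 2 * (L * p + L * ((I + 1) * (p * n) + n) + 1) ^ 2 *
          Real.exp (-(n * Real.sqrt (1440 * l / n) ^ 2 / 16)) +
        Real.exp (-(L * (1 / (60 * k)) ^ p)) ≤ δ := by
  have hp1 : (1 : ℝ) ≤ p := by exact_mod_cast hp
  have hd1 : (1 : ℝ) ≤ d := by exact_mod_cast hd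
  have hL1 : (1 : ℝ) ≤ L := by exact_mod_cast hL0
  have hn1 : (1 : ℝ) ≤ n := by exact_mod_cast hn0
  have hk1 : (1 : ℝ) ≤ k := by exact_mod_cast hk
  have hI0 : (0 : ℝ) ≤ I := Nat.cast_nonneg I
  have h10 : (10 : ℝ) ≤ Real.exp l := by linarith [twelve_le_exp hl]
  set E := Real.exp l with hE
  have hpow : ∀ j : ℕ, Real.exp (j * l) = E ^ j := fun j => Real.exp_nat_mul l j
  have e9 : Real.exp (9 * l) = E ^ 9 := by exact_mod_cast hpow 9
  have e3 : Real.exp (3 * l) = E ^ 3 := by exact_mod_cast hpow 3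
  have e27 : Real.exp (27 * l) = E ^ 27 := by exact_mod_cast hpow 27
  rw [e9] at hL
  rw [e3] at hI
  rw [e27] at hn
  have hpE : p ≤ E := hpl.trans (le_exp_self l)
  have hprod : L * ((I + 1) * (p * n)) ≤ E ^ 40 := by
    calc L * ((I + 1) * (p * n)) ≤ E ^ 9 * (E ^ 3 * (E * E ^ 27)) := by gcongr
      _ = _ := by ring
  have hX : ∀ x : ℝ, x ≤ L * ((I + 1) * (p * n)) → x ≤ E ^ 40 := fun x hx => hx.trans hprod
  have hI1 : (1 : ℝ) ≤ I + 1 := by linarith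
  have hb1 : (L : ℝ) * p ≤ E ^ 40 := hX _ (by
    have : (p : ℝ) ≤ (I + 1) * (p * n) := by
      calc (p : ℝ) = 1 * (p * 1) := by ring
        _ ≤ _ := by gcongr
    gcongr)
  have hb2 : (L : ℝ) * n ≤ E ^ 40 := hX _ (by
    have : (n : ℝ) ≤ (I + 1) * (p * n) := by
      calc (n : ℝ) = 1 * (1 * n) := by ring
        _ ≤ _ := by gcongr
    gcongr)
  have hb3 : (n : ℝ) ≤ E ^ 40 := le_trans (le_mul_of_one_le_left (by linarith) hL1) hb2
  -- The union bounds run over at most `E ^ 41` positions, and `E⁻¹ ≤ δ / 4`; the exponents below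
  -- are chosen to leave one spare factor of `E`.
  have hD : L * p + L * ((I + 1) * (p * n) + n) + 1 + n ≤ E ^ 41 := by
    calc L * p + L * ((I + 1) * (p * n) + n) + 1 + n ≤ 10 * E ^ 40 := by
          rw [mul_add]
          linarith
      _ ≤ E * E ^ 40 := by gcongr
      _ = _ := by ring
  have hD' : L * p + L * ((I + 1) * (p * n) + n) + 1 ≤ E ^ 41 := by linarith
  have hδE : E⁻¹ ≤ δ / 4 := by
    rw [inv_le_comm₀ (by positivity) (by positivity), inv_div]
    exact hδl
  have hE0 : 0 < E := Real.exp_pos l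
  have t1 : Real.exp (d - 180 * d * l / 4) ≤ (E ^ 42)⁻¹ := by
    rw [← hpow, ← Real.exp_neg]
    apply Real.exp_le_exp.2
    push_cast
    nlinarith
  -- The exponent equals `-90 l`, since `1440 / 16 = 90`.
  have t2 : Real.exp (-(n * Real.sqrt (1440 * l / n) ^ 2 / 16)) ≤ (E ^ 86)⁻¹ := by
    rw [← hpow, ← Real.exp_neg, Real.sq_sqrt (by positivity)]
    apply Real.exp_le_exp.2
    rw [mul_div_cancel₀ _ (by positivity)]
    push_cast
    linarith
  -- Here the number of candidates `(60 k) ^ p log (4 / δ)` is used.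
  have t3 : Real.exp (-(L * (1 / (60 * k)) ^ p)) ≤ δ / 4 := by
    have h1 : Real.log (4 / δ) ≤ L * (1 / (60 * k)) ^ p := by
      rw [one_div, inv_pow, ← div_eq_mul_inv, le_div_iff₀ (by positivity), mul_comm]
      exact hLδ
    refine (Real.exp_le_exp.2 (neg_le_neg h1)).trans (le_of_eq ?_)
    rw [Real.exp_neg, Real.exp_log (by positivity), inv_div]
  have u1 : (L * p + L * ((I + 1) * (p * n) + n) + 1 + n) * Real.exp (d - 180 * d * l / 4) ≤
      δ / 4 := by
    calc _ ≤ E ^ 41 * (E ^ 42)⁻¹ := by gcongr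
      _ = E⁻¹ := by field_simp
      _ ≤ _ := hδE
  have u2 : 8 * p * d ^ 2 * (L * p + L * ((I + 1) * (p * n) + n) + 1) ^ 2 *
          Real.exp (-(n * Real.sqrt (1440 * l / n) ^ 2 / 16)) ≤ δ / 4 := by
    calc _ ≤ E * E * E * (E ^ 41) ^ 2 * (E ^ 86)⁻¹ := by
          gcongr
          linarith
      _ = E⁻¹ := by field_simp
      _ ≤ _ := hδE
  linarith

end Parameters

/-! ### Sizes of the parameters and the elimination guarantee -/

section Phase

theorem OrthTensor.le_dim {d p k : ℕ} [NeZero k] {lam : ℝ} (T : OrthTensor d p k lam)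
    (hp : 0 < p) : k ≤ d := by
  simpa using (T.orthonormal_vec ⟨0, hp⟩).linearIndependent.fintype_card_le_finrank

/-- The quantities that `l` dominates. -/
structure LogBounds (p d k : ℕ) (lam ε δ l : ℝ) : Prop where
  three_le : 3 ≤ l
  order_le : p ≤ l
  four_div_le : 4 / δ ≤ Real.exp l
  one_le_log : 1 ≤ Real.log (4 / δ)
  log_le : Real.log (4 / δ) ≤ 2 * l
  rank_pow_le : (k : ℝ) ^ p ≤ Real.exp l
  dim_pow_le : (d : ℝ) ^ p ≤ Real.exp l
  dim_sq_le : (d : ℝ) ^ 2 ≤ Real.exp l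
  inv_le : 1 / lam * (1 / ε) ≤ Real.exp l
  log_rank_le : Real.log (12 * k) ≤ l
  ratio_le : 1 / (ε / (2 * p * lam * d)) ≤ Real.exp l

/-- With `Q = d / (ε δ)` one has `exp l = (e Q) ^ p`, and each of `d`, `k`, `1 / ε`, `1 / δ`, `1 /
lam` is at most `Q`. As `p ≥ 3`, there is room for squares and constants. -/
theorem logBounds_logFactor {p d k : ℕ} {lam δ ε : ℝ} (hp : 3 ≤ p) (hk : 0 < k) (hkd : k ≤ d)
    (hlam : 0 < lam) (hlam1 : lam ≤ 1) (hδ : 0 < δ) (hδ1 : δ < 1) (hε : 0 < ε) (hεlam : ε ≤ lam) :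
    LogBounds p d k lam ε δ (logFactor p d ε δ) := by
  have hd : 0 < d := hk.trans_le hkd
  have hd1 : (1 : ℝ) ≤ d := by exact_mod_cast hd
  have hk1 : (1 : ℝ) ≤ k := by exact_mod_cast hk
  have hkd' : (k : ℝ) ≤ d := by exact_mod_cast hkd
  have hp3 : (3 : ℝ) ≤ p := by exact_mod_cast hp
  have hε1 : ε ≤ 1 := hεlam.trans hlam1
  set l := logFactor p d ε δ with hldef
  set Q : ℝ := d / (ε * δ) with hQ
  have hQ1 : 1 ≤ Q := one_le_ratio hd hδ hδ1 hε hε1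
  have hpl : p ≤ l := le_logFactor hd hδ hδ1 hε hε1
  have hl3 : 3 ≤ l := hp3.trans hpl
  have hpow : ∀ {j : ℕ} (_ : j ≤ p) {x : ℝ} (_ : 0 ≤ x) (_ : x ≤ Real.exp 1 * Q),
      x ^ j ≤ Real.exp l := fun hj _ hx hxQ => pow_le_exp_logFactor hd hδ hδ1 hε hε1 hj hx hxQ
  have he2 : (2 : ℝ) ≤ Real.exp 1 := by linarith [Real.exp_one_gt_d9]
  have hdQ : d ≤ Q := by
    rw [hQ, le_div_iff₀ (by positivity)]
    exact mul_le_of_le_one_right (by positivity) (mul_le_one₀ hε1 hδ.le hδ1.le)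
  have hεQ : 1 / ε ≤ Q := by
    rw [hQ, ← div_div, ← div_mul_eq_div_div_swap, mul_comm, div_mul_eq_div_div_swap]
    gcongr
    rw [one_le_div hδ]
    linarith
  have hδQ : 1 / δ ≤ Q := by
    rw [hQ, ← div_div]
    gcongr
    rw [one_le_div hε]
    linarith
  have hlamQ : 1 / lam ≤ Q := (one_div_le_one_div_of_le hε hεlam).trans hεQ
  have hQe : Q ≤ Real.exp 1 * Q := le_mul_of_one_le_left (by linarith) (by linarith)
  have hlog : Real.log Q ≤ l / 3 - 1 := by
    have h1 : 3 * (1 + Real.log Q) ≤ l := by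
      rw [hldef, logFactor]
      have := Real.log_nonneg hQ1
      gcongr
    linarith
  have hδl : 4 / δ ≤ Real.exp l := by
    have h1 := hpow (j := 2) (by omega) (by positivity : 0 ≤ Real.exp 1 * Q) le_rfl
    have h2 : 4 / δ = 4 * (1 / δ) := by ring
    rw [h2]
    have h3 : 4 * (1 / δ) ≤ (2 * Q) ^ 2 := by nlinarith
    exact (h3.trans (pow_le_pow_left₀ (by linarith) (by gcongr) 2)).trans h1
  refine ⟨hl3, hpl, hδl, ?_, ?_, hpow le_rfl (by linarith) (hkd'.trans (hdQ.trans hQe)),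
    hpow le_rfl (by linarith) (hdQ.trans hQe), hpow (by omega) (by linarith) (hdQ.trans hQe),
    ?_, ?_, ?_⟩
  · rw [Real.le_log_iff_exp_le (by positivity), le_div_iff₀ hδ]
    nlinarith [Real.exp_one_lt_d9, Real.exp_pos 1]
  · have := Real.log_le_log (by positivity) hδl
    rw [Real.log_exp] at this
    linarith
  · refine le_trans ?_ (hpow (j := 2) (by omega) (by linarith) hQe)
    rw [sq]
    gcongr
  · have h2 : Real.log (12 * k) ≤ Real.log (Real.exp 3 * Q) :=
      Real.log_le_log (by positivity) (mul_le_mul (twelve_le_exp le_rfl) (hkd'.trans hdQ)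
        (by positivity) (Real.exp_nonneg _))
    rw [Real.log_mul (Real.exp_pos 3).ne' (by positivity), Real.log_exp] at h2
    linarith
  · have h1 : 1 / (ε / (2 * p * lam * d)) = 2 * p * (lam * (d / ε)) := by
      field_simp
    have h2 : d / ε ≤ Q := by
      rw [hQ, ← div_div]
      exact le_div_self (by positivity) hδ hδ1.le
    have h3 : 2 * (p : ℝ) ≤ Real.exp p := by
      have h4 := Real.quadratic_le_exp_of_nonneg (by positivity : (0 : ℝ) ≤ p)
      nlinarith
    have h5 : lam * (d / ε) ≤ Q := (mul_le_of_le_one_left (by positivity) hlam1).trans h2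
    have h6 : Real.exp l = Real.exp p * Q ^ p := by
      rw [hldef, exp_logFactor hd hδ hε, mul_pow, ← Real.exp_nat_mul, mul_one]
    have h7 : Q ≤ Q ^ p := le_self_pow₀ hQ1 (by omega)
    rw [h1, h6]
    exact mul_le_mul h3 (h5.trans h7) (by positivity) (Real.exp_nonneg _)

section

variable {p d k : ℕ} {lam ε δ l : ℝ}

/-- Exponentials in `p` count as powers of `exp l`, from `10 ≤ exp 3` and `p ≤ l`. -/
theorem LogBounds.pow_le (h : LogBounds p d k lam ε δ l) {c : ℝ} (hc : 0 ≤ c) (j : ℕ)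
    (hj : c ≤ 10 ^ j) : c ^ p ≤ Real.exp l ^ (3 * j) := by
  have h1 : c ≤ Real.exp 3 ^ j :=
    hj.trans (pow_le_pow_left₀ (by norm_num) (by linarith [twelve_le_exp (le_refl (3 : ℝ))]) j)
  refine (pow_le_pow_left₀ hc h1 p).trans ?_
  rw [← Real.exp_nat_mul, ← Real.exp_nat_mul, ← Real.exp_nat_mul]
  apply Real.exp_le_exp.2
  have := mul_le_mul_of_nonneg_right h.order_le (by positivity : (0 : ℝ) ≤ j * 3)
  push_cast
  linarith

theorem LogBounds.inits_le (h : LogBounds p d k lam ε δ l) (hk : 0 < k) :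
    0 < ⌈(60 * k) ^ p * Real.log (4 / δ)⌉₊ ∧
      (⌈(60 * k) ^ p * Real.log (4 / δ)⌉₊ : ℝ) ≤ 4 * l * (60 * k) ^ p ∧
      (⌈(60 * k) ^ p * Real.log (4 / δ)⌉₊ : ℝ) ≤ Real.exp (9 * l) := by
  have hk1 : (1 : ℝ) ≤ k := by exact_mod_cast hk
  have hX1 : 1 ≤ (60 * k) ^ p * Real.log (4 / δ) :=
    one_le_mul_of_one_le_of_one_le (one_le_pow₀ (by linarith)) h.one_le_log
  have hl := h.three_le
  have hL4 : (⌈(60 * k) ^ p * Real.log (4 / δ)⌉₊ : ℝ) ≤ 4 * l * (60 * k) ^ p := by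
    have h1 := Nat.ceil_lt_add_one (by linarith : 0 ≤ (60 * k) ^ p * Real.log (4 / δ))
    have h2 := mul_le_mul_of_nonneg_left h.log_le (by positivity : (0 : ℝ) ≤ (60 * k) ^ p)
    linarith
  refine ⟨Nat.ceil_pos.2 (by linarith), hL4, hL4.trans ?_⟩
  have h1 := twelve_le_exp hl
  have h2 := le_exp_self l
  have h3 := h.rank_pow_le
  have h4 := h.pow_le (c := 60) (by norm_num) 2 (by norm_num)
  have e9 : Real.exp (9 * l) = Real.exp l ^ 9 := by exact_mod_cast Real.exp_nat_mul l 9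
  rw [e9]
  set E := Real.exp l
  rw [mul_pow]
  calc 4 * l * (60 ^ p * (k : ℝ) ^ p) ≤ E * E * (E ^ 6 * E) := by
        gcongr
        linarith
    _ = E ^ 9 := by ring

theorem LogBounds.sweeps_le (h : LogBounds p d k lam ε δ l) :
    (⌈8 * l ^ 2⌉₊ : ℝ) + 1 ≤ 10 * l ^ 2 ∧ (⌈8 * l ^ 2⌉₊ : ℝ) + 1 ≤ Real.exp (3 * l) := by
  have hl := h.three_le
  have hI : (⌈8 * l ^ 2⌉₊ : ℝ) + 1 ≤ 10 * l ^ 2 := by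
    have := Nat.ceil_lt_add_one (by positivity : 0 ≤ 8 * l ^ 2)
    nlinarith
  refine ⟨hI, hI.trans ?_⟩
  have h1 := twelve_le_exp hl
  have h2 := le_exp_self l
  have e3 : Real.exp (3 * l) = Real.exp l ^ 3 := by exact_mod_cast Real.exp_nat_mul l 3
  rw [e3]
  set E := Real.exp l
  calc 10 * l ^ 2 ≤ E * E ^ 2 := by
        gcongr
        linarith
    _ = E ^ 3 := by ring

theorem LogBounds.samples_le (h : LogBounds p d k lam ε δ l) (hd : 0 < d) (hlam : 0 < lam)
    (hlam1 : lam ≤ 1) (hε : 0 < ε) (hε1 : ε ≤ 1) :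
    0 < ⌈10 ^ 10 * l ^ 5 * (640 * d) ^ p / (lam * ε)⌉₊ ∧
      (⌈10 ^ 10 * l ^ 5 * (640 * d) ^ p / (lam * ε)⌉₊ : ℝ) ≤
        2 * (10 ^ 10 * l ^ 5 * (640 * d) ^ p / (lam * ε)) ∧
      (⌈10 ^ 10 * l ^ 5 * (640 * d) ^ p / (lam * ε)⌉₊ : ℝ) ≤ Real.exp (27 * l) := by
  have hd1 : (1 : ℝ) ≤ d := by exact_mod_cast hd
  have hl := h.three_le
  have hX1 : 1 ≤ 10 ^ 10 * l ^ 5 * (640 * d) ^ p / (lam * ε) := by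
    rw [one_le_div (by positivity)]
    have h1 : (1 : ℝ) ≤ l ^ 5 := one_le_pow₀ (by linarith)
    have h2 : (1 : ℝ) ≤ (640 * d) ^ p := one_le_pow₀ (by linarith)
    have h3 : lam * ε ≤ 1 := mul_le_one₀ hlam1 hε.le hε1
    have h4 : (1 : ℝ) ≤ l ^ 5 * (640 * d) ^ p := one_le_mul_of_one_le_of_one_le h1 h2
    linarith
  have hn2 : (⌈10 ^ 10 * l ^ 5 * (640 * d) ^ p / (lam * ε)⌉₊ : ℝ) ≤
      2 * (10 ^ 10 * l ^ 5 * (640 * d) ^ p / (lam * ε)) := by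
    have := Nat.ceil_lt_add_one
      (by linarith : 0 ≤ 10 ^ 10 * l ^ 5 * (640 * d) ^ p / (lam * ε))
    linarith
  refine ⟨Nat.ceil_pos.2 (by linarith), hn2, hn2.trans ?_⟩
  have h1 := twelve_le_exp hl
  have h2 := le_exp_self l
  have h3 := h.dim_pow_le
  have h4 := h.pow_le (c := 640) (by norm_num) 3 (by norm_num)
  have h5 := h.inv_le
  have e27 : Real.exp (27 * l) = Real.exp l ^ 27 := by exact_mod_cast Real.exp_nat_mul l 27
  rw [e27]
  have e : 2 * (10 ^ 10 * l ^ 5 * (640 * d) ^ p / (lam * ε)) =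
      (2 * 10 ^ 10) * l ^ 5 * (640 ^ p * d ^ p) * (1 / lam * (1 / ε)) := by
    rw [mul_pow]
    ring
  rw [e]
  have h6 : (2 * 10 ^ 10 : ℝ) ≤ Real.exp l ^ 11 :=
    le_trans (by norm_num) (pow_le_pow_left₀ (by norm_num : (0 : ℝ) ≤ 12) h1 11)
  generalize (2 * 10 ^ 10 : ℝ) = K at h6 ⊢
  set E := Real.exp l
  have h7 : l ^ 5 ≤ E ^ 5 := pow_le_pow_left₀ (by linarith) h2 5
  have h8 : K * l ^ 5 ≤ E ^ 11 * E ^ 5 := mul_le_mul h6 h7 (by positivity) (by positivity)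
  have h9 : (640 ^ p * d ^ p : ℝ) ≤ E ^ (3 * 3) * E :=
    mul_le_mul h4 h3 (by positivity) (by positivity)
  refine (mul_le_mul (mul_le_mul h8 h9 (by positivity) (by positivity)) h5 (by positivity)
    (by positivity)).trans (le_of_eq ?_)
  ring

end

/-- Parameters of one-stage phased elimination for accuracy `ε` and failure probability `δ`. -/
theorem exists_params {p d k : ℕ} [NeZero k] {lam δ ε : ℝ} (hp : 3 ≤ p) (hkd : k ≤ d)
    (hlam : 0 < lam) (hlam1 : lam ≤ 1) (hδ : 0 < δ) (hδ1 : δ < 1) (hε : 0 < ε) (hεlam : ε ≤ lam) :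
    ∃ θ : Params, θ.stages = 1 ∧
      (θ.inits : ℝ) ≤ Real.exp (9 * logFactor p d ε δ) ∧
      (θ.inits : ℝ) ≤ 4 * logFactor p d ε δ * (60 * k) ^ p ∧
      (θ.inits * (θ.sweeps 1 * (p * θ.samples 1) + θ.samples 1) : ℝ) ≤
        4 * 10 ^ 12 * logFactor p d ε δ ^ 9 * ((60 * k) ^ p * (640 * d) ^ p / (lam * ε)) ∧
      ∀ (T : OrthTensor d p k lam) (Ω : Type*) [MeasurableSpace Ω] [StandardBorelSpace Ω]
        (P : Measure Ω) [IsProbabilityMeasure P] (ξ : ℕ → Ω → Vec d) (η : ℕ → Ω → ℝ),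
        IsBanditRandomness P ξ η → ∃ G : Set Ω, P Gᶜ ≤ ENNReal.ofReal δ ∧ ∀ ω ∈ G,
          stageOut T.reward (ξ · ω) (η · ω) (lam * (1 - p * (1 / 2) ^ 1)) (θ.samples 1)
            (θ.invVar 1) (θ.weight 1) (θ.sweeps 1)
            ((List.range θ.inits).map fun u => initOut (ξ · ω) (u * p)) (θ.inits * p) 0 =
              (List.range θ.inits).map (armOut T.reward (ξ · ω) (η · ω) θ.inits (θ.samples 1)
                (θ.invVar 1) (θ.weight 1) (θ.sweeps 1)) ∧
          ∃ u < θ.inits, lam - ε ≤ T.reward (armOut T.reward (ξ · ω) (η · ω) θ.inits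
            (θ.samples 1) (θ.invVar 1) (θ.weight 1) (θ.sweeps 1) u) := by
  have hk : 0 < k := Nat.pos_of_ne_zero (NeZero.ne k)
  have hd : 0 < d := hk.trans_le hkd
  have hd1 : (1 : ℝ) ≤ d := by exact_mod_cast hd
  have hp3 : (3 : ℝ) ≤ p := by exact_mod_cast hp
  have hB := logBounds_logFactor hp hk hkd hlam hlam1 hδ hδ1 hε hεlam
  set l := logFactor p d ε δ
  have hl3 := hB.three_le
  obtain ⟨hL0, hL4, hL9⟩ := hB.inits_le hk
  obtain ⟨hI10, hI3⟩ := hB.sweeps_le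
  obtain ⟨hn0, hn2, hn27⟩ := hB.samples_le hd hlam hlam1 hε (hεlam.trans hlam1)
  have hsamp := regime_of_samples hp hd hlam hε hεlam hB.order_le
    (Nat.le_ceil (10 ^ 10 * l ^ 5 * (640 * d) ^ p / (lam * ε)))
  have hLδ := Nat.le_ceil ((60 * k) ^ p * Real.log (4 / δ))
  set L := ⌈(60 * k) ^ p * Real.log (4 / δ)⌉₊
  set n := ⌈10 ^ 10 * l ^ 5 * (640 * d) ^ p / (lam * ε)⌉₊
  have hr0 : 0 < ε / (2 * p * lam * d) := by positivity
  have hIr := pow_le_of_sweeps (by linarith) hr0 hB.ratio_le (Nat.le_ceil (8 * l ^ 2))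
  set I := ⌈8 * l ^ 2⌉₊
  have hrsq : Real.sqrt (ε / (2 * p * lam * d)) ^ 2 = ε / (2 * p * lam * d) :=
    Real.sq_sqrt hr0.le
  -- One stage, weight `1`, and inverse variance `180 d l`, so large that with high probability no
  -- perturbation leaves the unit ball.
  refine ⟨⟨L, 1, fun _ => I + 1, fun _ => n, fun _ => 180 * d * l, fun _ => 1,
    fun _ => by positivity, fun _ => one_pos, fun _ => le_rfl⟩, rfl, hL9, hL4, ?_, ?_⟩
  · push_cast
    have hX : 0 ≤ 10 ^ 10 * l ^ 5 * (640 * d) ^ p / (lam * ε) := by positivity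
    have e : 4 * 10 ^ 12 * l ^ 9 * ((60 * k) ^ p * (640 * d) ^ p / (lam * ε)) =
        400 * l ^ 4 * (60 * k) ^ p * (10 ^ 10 * l ^ 5 * (640 * d) ^ p / (lam * ε)) := by ring
    rw [e]
    generalize 10 ^ 10 * l ^ 5 * (640 * d) ^ p / (lam * ε) = X at hn2 hX
    have h1 : (p : ℝ) * n ≤ l * (2 * X) :=
      mul_le_mul hB.order_le hn2 (by positivity) (by linarith)
    have h2 : (n : ℝ) ≤ p * n := le_mul_of_one_le_left (by positivity) (by linarith)
    have h3 : ((I : ℝ) + 1) * (p * n) + n ≤ 50 * l ^ 3 * X := by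
      have h4 : ((I : ℝ) + 1) * (p * n) ≤ 10 * l ^ 2 * (l * (2 * X)) :=
        mul_le_mul hI10 h1 (by positivity) (by positivity)
      have h5 : l * X * 1 ≤ l * X * l ^ 2 := by
        gcongr
        exact one_le_pow₀ (by linarith)
      have h6 : 0 ≤ l * X * l ^ 2 := by positivity
      linarith
    have h7 := mul_le_mul hL4 h3 (by positivity) (by positivity)
    have h8 : 0 ≤ l ^ 4 * (60 * k) ^ p * X := by positivity
    linarith
  · intro T Ω _ _ P _ ξ η h
    have hγk : 1 / (4 * l) * (4 * Real.log (12 * k)) ≤ 1 := by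
      have := hB.log_rank_le
      rw [one_div, inv_mul_le_iff₀ (by positivity)]
      linarith
    -- The final ratio satisfies `2 p lam d r ^ 2 = ε`, exactly the permitted loss of reward.
    have hrf : d * Real.sqrt (ε / (2 * p * lam * d)) ^ 2 ≤ 1 := by
      rw [hrsq, mul_div_assoc', div_le_one (by positivity)]
      have h1 : d * ε ≤ d * lam := by gcongr
      have h2 : d * lam * 1 ≤ d * lam * (2 * p) := by
        gcongr
        linarith
      linarith
    obtain ⟨G, hG, hgood⟩ := exists_good_event (m := 180 * d * l) (L := L)
      (I := I) hp hlam hlam1 hn0 (by nlinarith)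
      (Real.sqrt_nonneg _) hsamp.1 (k := k) hγk hrf hIr hsamp.2.1 hsamp.2.2 T h
    refine ⟨G, hG.trans (ENNReal.ofReal_le_ofReal ?_), fun ω hω => ?_⟩
    · exact failure_le (by omega) hd hk hδ hl3 hB.order_le hB.dim_sq_le hB.four_div_le hL0 hL9
        hLδ hI3 hn0 hn27
    · obtain ⟨h1, u, hu, h2⟩ := hgood ω hω
      refine ⟨h1, u, hu, le_trans (le_of_eq ?_) h2⟩
      rw [hrsq]
      field_simp

end Phase

/-! ### Final bounds and absorption of constants -/

/-! ### Sample complexity and regret -/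

section Bounds

/-- Exponentials are absorbed by `log (p / δ) ^ p`. -/
theorem exists_pow_le_mul_log_pow {A : ℝ} (hA : 1 ≤ A) : ∃ K : ℝ, 1 ≤ K ∧ ∀ (p : ℕ) (δ : ℝ),
    3 ≤ p → 0 < δ → δ < 1 → A ^ p ≤ K * Real.log (p / δ) ^ p := by
  -- If `log (p / δ) ≥ A`, no constant is needed. Otherwise `p ≤ p / δ ≤ exp A`, so `A ^ p` is
  -- bounded.
  refine ⟨A ^ ⌈Real.exp A⌉₊, one_le_pow₀ hA, fun p δ hp hδ hδ1 => ?_⟩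
  have hp3 : (3 : ℝ) ≤ p := by exact_mod_cast hp
  have hle : (p : ℝ) ≤ p / δ := le_div_self (by positivity) hδ hδ1.le
  have hlog1 : 1 ≤ Real.log (p / δ) := by
    rw [Real.le_log_iff_exp_le (by positivity)]
    linarith [Real.exp_one_lt_d9]
  have hK : 1 ≤ A ^ ⌈Real.exp A⌉₊ := one_le_pow₀ hA
  rcases le_total A (Real.log (p / δ)) with h | h
  · calc A ^ p ≤ Real.log (p / δ) ^ p := pow_le_pow_left₀ (by linarith) h p
      _ ≤ _ := le_mul_of_one_le_left (by positivity) hK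
  · have h1 : (p : ℝ) ≤ Real.exp A := hle.trans ((Real.log_le_iff_le_exp (by positivity)).1 h)
    have h2 : p ≤ ⌈Real.exp A⌉₊ := by exact_mod_cast h1.trans (Nat.le_ceil _)
    calc A ^ p ≤ A ^ ⌈Real.exp A⌉₊ := pow_le_pow_right₀ hA h2
      _ ≤ _ := le_mul_of_one_le_right (by positivity) (one_le_pow₀ hlog1)

theorem OrthTensor.abs_reward_le {d p k : ℕ} [NeZero k] {lam : ℝ} (T : OrthTensor d p k lam)
    (hp : 1 < p) (hlam : 0 < lam) (a : Action d p) : |T.reward a| ≤ lam := by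
  obtain ⟨B, Λ, K, i₀, -, -, -, hΛ, -, hT⟩ := T.exists_basisReward hlam (by omega)
  rw [hT]
  exact abs_basisReward_le hΛ hlam.le hp a

theorem OrthTensor.optReward_le {d p k : ℕ} [NeZero k] {lam : ℝ} (T : OrthTensor d p k lam)
    (hp : 1 < p) (hlam : 0 < lam) : optReward T.reward ≤ lam := by
  obtain ⟨B, Λ, K, i₀, -, -, -, hΛ, -, hT⟩ := T.exists_basisReward hlam (by omega)
  rw [hT]
  exact optReward_basisReward_le hΛ hlam.le hp

theorem OrthTensor.regret_le {d p k : ℕ} [NeZero k] {lam : ℝ} (T : OrthTensor d p k lam)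
    (hp : 1 < p) (hlam : 0 < lam) {α : Type} (Q : Prog d p α) (ξ : ℕ → Vec d) (η : ℕ → ℝ)
    (n : ℕ) : regret Q T.reward ξ η n ≤ n * (2 * lam) := by
  refine (sum_regret_le (c := 2 * lam) (fun a => ?_) _).trans ?_
  · have h1 := T.optReward_le hp hlam
    have h2 := (abs_le.1 (T.abs_reward_le hp hlam a)).1
    linarith
  · gcongr
    exact List.length_take_le _ _

theorem length_actions_of_stages_eq_zero {d p : ℕ} {f : Action d p → ℝ} {ξ : ℕ → Vec d}
    {η : ℕ → ℝ} (lam : ℝ) {θ : Params} (hθ : θ.stages = 0) (h1 : θ.inits = 1) :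
    (phasedElimination d p lam θ).output f ξ η = [initOut ξ 0] ∧
      ((phasedElimination d p lam θ).actions f ξ η).length = 0 := by
  have h : Ends f ξ η (phasedElimination d p lam θ) 0 0 [initOut ξ 0] (0 + p) 0 := by
    unfold phasedElimination
    rw [h1, hθ]
    refine Ends.bind (Ends.bind (ends_randomAction 0 0) ?_) (Ends.ret _ _ _)
    exact Ends.bind (Ends.ret _ _ _) (Ends.ret _ _ _)
  obtain ⟨as, h⟩ := h
  rw [output, actions, h.runFrom_eq]
  exact ⟨rfl, h.length_add⟩

variable {p d k : ℕ} [NeZero k] {lam δ K : ℝ}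

/-- Degenerate cases are separated: for `k > d` there is no orthogonal tensor, and for `ε ≥ 2 lam`
every action is `ε`-optimal, so one candidate and no plays suffice. Otherwise accuracy `ε / 2 ≤ lam`
is requested, which puts the parameters in the range of `exists_params`. -/
theorem exists_params_candidates (hp : 3 ≤ p) (hlam : 0 < lam) (hlam1 : lam ≤ 1) (hδ : 0 < δ)
    (hδ1 : δ < 1) (hK1 : 1 ≤ K) (hK : 19200 ^ p ≤ K * Real.log (p / δ) ^ p) {ε : ℝ} (hε : 0 < ε)
    (hε1 : ε < 1) :
    ∃ θ : Params,
      ∀ (T : OrthTensor d p k lam) (Ω : Type*) [MeasurableSpace Ω] [StandardBorelSpace Ω]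
        (P : Measure Ω) [IsProbabilityMeasure P] (ξ : ℕ → Ω → Vec d) (η : ℕ → Ω → ℝ),
        IsBanditRandomness P ξ η →
        P {ω | ¬ ∃ a ∈ (phasedElimination d p lam θ).output T.reward (ξ · ω) (η · ω),
            optReward T.reward - ε ≤ T.reward a} ≤ ENNReal.ofReal δ ∧
        ∀ ω,
          (((phasedElimination d p lam θ).actions T.reward (ξ · ω) (η · ω)).length : ℝ) ≤
            10 ^ 16 * K * p ^ 9 * (1 + Real.log (d / (ε * δ))) ^ 9 *
              ((2 * k) ^ p * Real.log (p / δ) ^ p * d ^ p * lam⁻¹ * ε⁻¹) ∧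
          (((phasedElimination d p lam θ).output T.reward (ξ · ω) (η · ω)).length : ℝ) ≤
            10 ^ 16 * K * p ^ 9 * (1 + Real.log (d / (ε * δ))) ^ 9 *
              ((2 * k) ^ p * Real.log (p / δ) ^ p) := by
  have trivial_params : ∃ θ : Params, θ.stages = 0 ∧ θ.inits = 1 :=
    ⟨⟨1, 0, fun _ => 0, fun _ => 0, fun _ => 1, fun _ => 1, fun _ => one_pos, fun _ => one_pos,
      fun _ => le_rfl⟩, rfl, rfl⟩
  obtain ⟨θ₀, hθ₀, hθ₀1⟩ := trivial_params
  by_cases hkd : k ≤ d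
  swap
  · exact ⟨θ₀, fun T => absurd (T.le_dim (by omega)) hkd⟩
  have hk : 0 < k := Nat.pos_of_ne_zero (NeZero.ne k)
  have hk1 : (1 : ℝ) ≤ k := by exact_mod_cast hk
  have hd1 : (1 : ℝ) ≤ d := by exact_mod_cast hk.trans_le hkd
  have hp3 : (3 : ℝ) ≤ p := by exact_mod_cast hp
  have hpδ : (p : ℝ) ≤ p / δ := le_div_self (by positivity) hδ hδ1.le
  have hlogp : 1 ≤ Real.log (p / δ) := by
    rw [Real.le_log_iff_exp_le (by positivity)]
    linarith [Real.exp_one_lt_d9]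
  have hx : 1 ≤ 1 + Real.log (d / (ε * δ)) := by
    linarith [Real.log_nonneg (one_le_ratio (hk.trans_le hkd) hδ hδ1 hε hε1.le)]
  have hM : 1 ≤ (2 * k : ℝ) ^ p * Real.log (p / δ) ^ p :=
    one_le_mul_of_one_le_of_one_le (one_le_pow₀ (by linarith)) (one_le_pow₀ hlogp)
  have hlog2 : logFactor p d (ε / 2) δ ≤ 2 * (p * (1 + Real.log (d / (ε * δ)))) := by
    have h1 : d / (ε / 2 * δ) = 2 * (d / (ε * δ)) := by
      field_simp
    have h2 := Real.log_two_lt_d9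
    rw [logFactor, h1, Real.log_mul (by norm_num) (by positivity)]
    nlinarith
  have hlog0 : 0 ≤ logFactor p d (ε / 2) δ :=
    (Nat.cast_nonneg p).trans (le_logFactor (hk.trans_le hkd) hδ hδ1 (by linarith) (by linarith))
  set x := 1 + Real.log (d / (ε * δ)) with hxdef
  set M := (2 * k : ℝ) ^ p * Real.log (p / δ) ^ p with hMdef
  have hy1 : 1 ≤ p * x := one_le_mul_of_one_le_of_one_le (by linarith) hx
  have hfac : 1 ≤ 10 ^ 16 * K * p ^ 9 * x ^ 9 := by
    have := one_le_pow₀ hy1 (n := 9)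
    rw [mul_pow] at this
    have := one_le_mul_of_one_le_of_one_le hK1 this
    linarith
  rcases le_or_gt (2 * lam) ε with hcase | hcase
  · refine ⟨θ₀, fun T Ω _ _ P _ ξ η h => ⟨?_, fun ω => ?_⟩⟩
    · have : {ω | ¬ ∃ a ∈ (phasedElimination d p lam θ₀).output T.reward (ξ · ω) (η · ω),
          optReward T.reward - ε ≤ T.reward a} = ∅ := by
        refine Set.eq_empty_of_forall_notMem fun ω hω => hω ?_
        rw [(length_actions_of_stages_eq_zero lam hθ₀ hθ₀1).1]
        refine ⟨_, List.mem_singleton_self _, ?_⟩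
        have h1 := T.optReward_le (by omega) hlam
        have h2 := (abs_le.1 (T.abs_reward_le (by omega) hlam (initOut (ξ · ω) 0))).1
        linarith
      rw [this, measure_empty]
      exact zero_le
    · obtain ⟨h1, h2⟩ := length_actions_of_stages_eq_zero (f := T.reward) (ξ := (ξ · ω))
        (η := (η · ω)) lam hθ₀ hθ₀1
      rw [h1, h2]
      constructor
      · rw [Nat.cast_zero]
        positivity
      · rw [List.length_singleton, Nat.cast_one]
        exact one_le_mul_of_one_le_of_one_le hfac hM
  · obtain ⟨θ, hθ, -, hinits, hact, hgood⟩ := exists_params (k := k) hp hkd hlam hlam1 hδ hδ1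
      (ε := ε / 2) (by linarith) (by linarith)
    have h60 : (60 * k : ℝ) ^ p ≤ K * M := by
      rw [hMdef, show (60 * k : ℝ) = 30 * (2 * k) by ring, mul_pow]
      have h30 : (30 : ℝ) ^ p ≤ 19200 ^ p := by gcongr; norm_num
      calc (30 : ℝ) ^ p * (2 * k) ^ p ≤ (K * Real.log (p / δ) ^ p) * (2 * k) ^ p := by
            gcongr
            exact h30.trans hK
        _ = _ := by ring
    -- The constant is `60 · 640 / 2`, the factor `2` being the one in `2 k`.
    have h19200 : (60 * k : ℝ) ^ p * (640 * d) ^ p ≤ K * (M * d ^ p) := by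
      rw [hMdef, ← mul_pow, show (60 * k * (640 * d) : ℝ) = 19200 * ((2 * k) * d) by ring,
        mul_pow 19200, mul_pow (2 * (k : ℝ))]
      calc (19200 : ℝ) ^ p * ((2 * k) ^ p * d ^ p) ≤
            (K * Real.log (p / δ) ^ p) * ((2 * k) ^ p * d ^ p) := by gcongr
        _ = _ := by ring
    refine ⟨θ, fun T Ω _ _ P _ ξ η h => ⟨?_, fun ω => ⟨?_, ?_⟩⟩⟩
    · obtain ⟨G, hG, hGgood⟩ := hgood T Ω P ξ η h
      refine le_trans (measure_mono ?_) hG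
      intro ω hω hωG
      refine hω ?_
      obtain ⟨h1, u, hu, h2⟩ := hGgood ω hωG
      rw [output_phasedElimination lam θ hθ, h1]
      refine ⟨_, List.mem_map.2 ⟨u, List.mem_range.2 hu, rfl⟩, le_trans ?_ h2⟩
      linarith [T.optReward_le (by omega) hlam]
    · rw [length_actions_phasedElimination lam θ hθ]
      push_cast
      refine hact.trans ?_
      have h1 : logFactor p d (ε / 2) δ ^ 9 ≤ (2 * (p * x)) ^ 9 := pow_le_pow_left₀ hlog0 hlog2 9
      calc 4 * 10 ^ 12 * logFactor p d (ε / 2) δ ^ 9 *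
            ((60 * k) ^ p * (640 * d) ^ p / (lam * (ε / 2))) ≤
          4 * 10 ^ 12 * (2 * (p * x)) ^ 9 * (K * (M * d ^ p) / (lam * (ε / 2))) := by gcongr
        _ = 4096 * 10 ^ 12 * (K * p ^ 9 * x ^ 9 * (M * d ^ p * lam⁻¹ * ε⁻¹)) := by
          field_simp
          norm_num
        _ ≤ 10 ^ 16 * (K * p ^ 9 * x ^ 9 * (M * d ^ p * lam⁻¹ * ε⁻¹)) := by
          gcongr
          norm_num
        _ = _ := by ring
    · refine le_trans (Nat.cast_le.2 (length_output_phasedElimination_le lam θ hθ)) ?_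
      refine hinits.trans ?_
      calc 4 * logFactor p d (ε / 2) δ * (60 * k) ^ p ≤ 4 * (2 * (p * x)) * (K * M) := by gcongr
        _ = 8 * (p * x) ^ 1 * (K * M) := by ring
        _ ≤ 10 ^ 16 * (p * x) ^ 9 * (K * M) := by
          gcongr
          · norm_num
          · norm_num
        _ = _ := by ring

/-- With accuracy `s / n` and `s ^ 2 = A n`, each source of regret is a multiple of `s`: elimination
because `A / (s / n) = s`, the first plays because `A ≤ s`, the inaccuracy of the best arm because
`n (s / n) = s`, and UCB because `L (L + n)` is of order `A n`. The factor `lam` in the regret per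
play cancels the `lam⁻¹` in the number of plays. -/
theorem ucb_budget_le {L t n lam y K A s : ℝ} (hL0 : 0 ≤ L) (hn : 0 < n) (hlam : 0 < lam)
    (hlam1 : lam ≤ 1) (hy : 1 ≤ y) (hK : 1 ≤ K) (hA : 0 ≤ A) (hs : 0 < s) (hssq : s ^ 2 = A * n)
    (hAs : A ≤ s) (hAn : A ≤ n) (hL : L ≤ 8 * y * (K * A))
    (ht : t ≤ 2048 * 10 ^ 12 * y ^ 9 * (K * A / (lam * (s / n)))) :
    (t + L) * (2 * lam) + (n * (s / n) + 6 * Real.sqrt (60 * y * (L * (L + n)))) ≤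
      10 ^ 16 * (y ^ 9 * K) * s := by
  have ht' : t * (2 * lam) ≤ 4096 * 10 ^ 12 * (y ^ 9 * K * s) := by
    have h1 : K * A / (lam * (s / n)) * (2 * lam) = 2 * K * s := by
      rw [show K * A / (lam * (s / n)) = K * (A * n) / (lam * s) by field_simp, ← hssq]
      field_simp
    have h2 := mul_le_mul_of_nonneg_right ht (by positivity : 0 ≤ 2 * lam)
    rw [mul_assoc _ _ (2 * lam), h1] at h2
    linarith
  have hy9 : y ≤ y ^ 9 := le_self_pow₀ hy (by norm_num)
  have hy2 : y ^ 2 ≤ y ^ 9 := pow_le_pow_right₀ hy (by norm_num)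
  have hyK9 : 1 ≤ y ^ 9 * K := one_le_mul_of_one_le_of_one_le (one_le_pow₀ hy) hK
  have hLlam : L * (2 * lam) ≤ 16 * (y ^ 9 * K * s) := by
    calc L * (2 * lam) ≤ 8 * y * (K * A) * (2 * 1) := by gcongr
      _ = 16 * (y * K * A) := by ring
      _ ≤ _ := by gcongr
  have hyK1 : 1 ≤ y * K := one_le_mul_of_one_le_of_one_le hy hK
  have hsqrt : Real.sqrt (60 * y * (L * (L + n))) ≤ 66 * (y ^ 9 * K * s) := by
    have h1 : Real.sqrt (60 * y * (L * (L + n))) ≤ 66 * (y ^ 2 * K * s) := by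
      rw [Real.sqrt_le_left (by positivity)]
      have h2 : L + n ≤ 9 * (y * K) * n := by
        have h3 : y * (K * A) ≤ y * (K * n) := by gcongr
        have h4 : 1 * n ≤ y * K * n := by gcongr
        linarith
      have h5 : 60 * y * (L * (L + n)) ≤ 60 * y * (8 * y * (K * A) * (9 * (y * K) * n)) := by
        gcongr
      have h6 : y ^ 3 * (K ^ 2 * (A * n)) ≤ y ^ 4 * (K ^ 2 * (A * n)) := by
        gcongr
        norm_num
      have h7 : (66 * (y ^ 2 * K * s)) ^ 2 = 4356 * (y ^ 4 * (K ^ 2 * (A * n))) := by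
        rw [← hssq]
        ring
      have h8 : 0 ≤ y ^ 4 * (K ^ 2 * (A * n)) := by positivity
      rw [h7]
      linarith
    refine h1.trans ?_
    gcongr
  have hns : n * (s / n) ≤ y ^ 9 * K * s := by
    rw [mul_div_cancel₀ _ hn.ne']
    exact le_mul_of_one_le_left hs.le hyK9
  rw [add_mul]
  have h0 : 0 ≤ y ^ 9 * K * s := by positivity
  linarith

theorem sq_mul_le_exp {p : ℕ} {d n δ : ℝ} (hp : 3 ≤ p) (hd : 1 ≤ d) (hn : 1 ≤ n) (hδ : 0 < δ)
    (hδ1 : δ < 1) : n ^ 2 * (4 / δ) ≤ Real.exp (p * (1 + Real.log (d * n / δ))) := by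
  have hdn : 1 ≤ d * n := one_le_mul_of_one_le_of_one_le hd hn
  have hQ : 1 ≤ d * n / δ := hdn.trans (le_div_self (by positivity) hδ hδ1.le)
  have h2 : n ≤ d * n / δ :=
    (le_mul_of_one_le_left (by linarith) hd).trans (le_div_self (by positivity) hδ hδ1.le)
  have h3 : 1 / δ ≤ d * n / δ := by gcongr
  rw [Real.exp_nat_mul, Real.exp_add, Real.exp_log (by positivity)]
  generalize d * n / δ = Q at hQ h2 h3
  have he : (2 : ℝ) ≤ Real.exp 1 := by linarith [Real.exp_one_gt_d9]
  have h4 : (2 * Q) ^ 3 ≤ (Real.exp 1 * Q) ^ p :=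
    (pow_le_pow_left₀ (by linarith) (by gcongr) 3).trans
      (pow_le_pow_right₀ (one_le_mul_of_one_le_of_one_le (by linarith) hQ) hp)
  refine le_trans ?_ h4
  have h5 : n ^ 2 * (1 / δ) ≤ Q ^ 2 * Q := by gcongr
  have h6 : 0 ≤ Q ^ 2 * Q := by positivity
  calc n ^ 2 * (4 / δ) = 4 * (n ^ 2 * (1 / δ)) := by ring
    _ ≤ 8 * (Q ^ 2 * Q) := by linarith
    _ = _ := by ring

/-- The confidence parameter `b = 60 y` gives the tail `exp (-30 y)`, which outweighs `exp (18 y)`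
arms and the union over `n ^ 2` pairs of round and count. -/
theorem ucb_failure_le {L n y δ : ℝ} (hδ : 0 < δ) (hy : 1 ≤ y) (hL : L ≤ Real.exp (18 * y))
    (hn : n ^ 2 * (4 / δ) ≤ Real.exp y) :
    L * n ^ 2 * (2 * Real.exp (-(60 * y / 2))) ≤ δ / 2 := by
  have hn2 : n ^ 2 ≤ Real.exp y * (δ / 4) := by
    have := mul_le_mul_of_nonneg_right hn (by positivity : 0 ≤ δ / 4)
    refine le_trans (le_of_eq ?_) this
    field_simp
  calc L * n ^ 2 * (2 * Real.exp (-(60 * y / 2))) ≤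
        Real.exp (18 * y) * (Real.exp y * (δ / 4)) * (2 * Real.exp (-(60 * y / 2))) := by
        gcongr
    _ = δ / 2 * (Real.exp (18 * y) * Real.exp y * Real.exp (-(60 * y / 2))) := by ring
    _ = δ / 2 * Real.exp (18 * y + y + -(60 * y / 2)) := by rw [Real.exp_add, Real.exp_add]
    _ ≤ δ / 2 * 1 := by
        gcongr
        exact Real.exp_le_one_iff.2 (by linarith)
    _ = δ / 2 := mul_one _

/-- The regret bound for horizons that are long enough to learn. -/
theorem exists_params_regret_of_lt (hp : 3 ≤ p) (hkd : k ≤ d) (hlam : 0 < lam) (hlam1 : lam ≤ 1)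
    (hδ : 0 < δ) (hδ1 : δ < 1) (hK1 : 1 ≤ K) {n : ℕ} (hn : 0 < n) {A s : ℝ} (hA1 : 1 ≤ A)
    (h60 : (60 * k) ^ p ≤ K * A) (h19200 : (60 * k) ^ p * (640 * d) ^ p ≤ K * A) (hs0 : 0 < s)
    (hssq : s ^ 2 = A * n) (hcase : s < lam * n) :
    ∃ (θ : Params) (b : ℝ), 0 < b ∧
      ∀ (T : OrthTensor d p k lam) (Ω : Type*) [MeasurableSpace Ω] [StandardBorelSpace Ω]
        (P : Measure Ω) [IsProbabilityMeasure P] (ξ : ℕ → Ω → Vec d) (η : ℕ → Ω → ℝ),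
        IsBanditRandomness P ξ η →
        P {ω | ¬ regret (banditAlg d p lam θ b n) T.reward (ξ · ω) (η · ω) n ≤
            10 ^ 16 * ((p * (1 + Real.log (d * n / δ))) ^ 9 * K) * s} ≤ ENNReal.ofReal δ := by
  have hk : 0 < k := Nat.pos_of_ne_zero (NeZero.ne k)
  have hd1 : (1 : ℝ) ≤ d := by exact_mod_cast hk.trans_le hkd
  have hn1 : (1 : ℝ) ≤ n := by exact_mod_cast hn
  have hp3 : (3 : ℝ) ≤ p := by exact_mod_cast hp
  have hexpy := sq_mul_le_exp hp hd1 hn1 hδ hδ1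
  have hQ : 1 ≤ d * n / δ := (one_le_mul_of_one_le_of_one_le hd1 hn1).trans
    (le_div_self (by positivity) hδ hδ1.le)
  have hx : 1 ≤ 1 + Real.log (d * n / δ) := by linarith [Real.log_nonneg hQ]
  set Q := d * n / δ with hQdef
  set x := 1 + Real.log Q with hxdef
  have hy1 : 1 ≤ p * x := one_le_mul_of_one_le_of_one_le (by linarith) hx
  have hn0 : (0 : ℝ) < n := by linarith
  have hε0 : 0 < s / n := by positivity
  have hεlam : s / n ≤ lam := by
    rw [div_le_iff₀ hn0]
    exact hcase.le
  have hAs : A ≤ s := by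
    have hsn : s ≤ n := hcase.le.trans (mul_le_of_le_one_left hn0.le hlam1)
    nlinarith
  have hAn : A ≤ n := hAs.trans (hcase.le.trans (mul_le_of_le_one_left hn0.le hlam1))
  have hlog0 : 0 ≤ logFactor p d (s / n) (δ / 2) :=
    (Nat.cast_nonneg p).trans (le_logFactor (hk.trans_le hkd) (by linarith) (by linarith) hε0
      (hεlam.trans hlam1))
  -- The horizon replaces `1 / ε` in the logarithm: `1 / (s / n) ≤ n`, because `s ≥ A ≥ 1`. The
  -- failure probability is halved to leave room for UCB.
  have hlog2 : logFactor p d (s / n) (δ / 2) ≤ 2 * (p * x) := by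
    have h1 : d / (s / n * (δ / 2)) ≤ 2 * Q := by
      have e : d / (s / n * (δ / 2)) = 2 * Q / s := by
        rw [hQdef]
        field_simp
      rw [e]
      exact div_le_self (by positivity) (hA1.trans hAs)
    have h2 := Real.log_le_log (by positivity) h1
    rw [Real.log_mul (by norm_num) (by positivity)] at h2
    have h3 := Real.log_two_lt_d9
    rw [logFactor]
    nlinarith
  obtain ⟨θ, hθ, hexp, hinits, hact, hgood⟩ := exists_params (k := k) hp hkd hlam hlam1
    (δ := δ / 2) (by linarith) (by linarith) hε0 hεlam
  set y := p * x with hy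
  refine ⟨θ, 60 * y, by linarith, fun T Ω _ _ P _ ξ η h => ?_⟩
  obtain ⟨G, hG, hGgood⟩ := hgood T Ω P ξ η h
  have key := h.measure_regret_gt_le hp hlam T hθ (b := 60 * y) (by linarith) n hGgood
  have hL : (θ.inits : ℝ) ≤ 8 * y * (K * A) := by
    refine hinits.trans ?_
    calc 4 * logFactor p d (s / n) (δ / 2) * (60 * k) ^ p ≤ 4 * (2 * y) * (K * A) := by gcongr
      _ = _ := by ring
  have ht : (θ.inits * (θ.sweeps 1 * (p * θ.samples 1) + θ.samples 1) : ℝ) ≤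
      2048 * 10 ^ 12 * y ^ 9 * (K * A / (lam * (s / n))) := by
    have h1 : logFactor p d (s / n) (δ / 2) ^ 9 ≤ (2 * y) ^ 9 :=
      pow_le_pow_left₀ hlog0 hlog2 9
    refine hact.trans ?_
    calc _ ≤ 4 * 10 ^ 12 * (2 * y) ^ 9 * (K * A / (lam * (s / n))) := by gcongr
      _ = _ := by ring
  have hbound := ucb_budget_le (Nat.cast_nonneg θ.inits) hn0 hlam hlam1 hy1 hK1
    (by linarith) hs0 hssq hAs hAn hL ht
  have hfail := ucb_failure_le hδ hy1
    (hexp.trans (Real.exp_le_exp.2 (by linarith : 9 * logFactor p d (s / n) (δ / 2) ≤ 18 * y)))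
    hexpy
  refine le_trans (measure_mono ?_) (key.trans ?_)
  · intro ω hω hle
    exact hω (hle.trans hbound)
  refine (add_le_add hG (ENNReal.ofReal_le_ofReal hfail)).trans (le_of_eq ?_)
  rw [← ENNReal.ofReal_add (by linarith) (by linarith), add_halves]

theorem exists_params_regret (hp : 3 ≤ p) (hlam : 0 < lam) (hlam1 : lam ≤ 1) (hδ : 0 < δ)
    (hδ1 : δ < 1) (hK1 : 1 ≤ K) (hK : 19200 ^ p ≤ K * Real.log (p / δ) ^ p) (n : ℕ) :
    ∃ (θ : Params) (b : ℝ), 0 < b ∧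
      ∀ (T : OrthTensor d p k lam) (Ω : Type*) [MeasurableSpace Ω] [StandardBorelSpace Ω]
        (P : Measure Ω) [IsProbabilityMeasure P] (ξ : ℕ → Ω → Vec d) (η : ℕ → Ω → ℝ),
        IsBanditRandomness P ξ η →
        P {ω | ¬ regret (banditAlg d p lam θ b n) T.reward (ξ · ω) (η · ω) n ≤
            10 ^ 16 * K * p ^ 9 * (1 + Real.log (d * n / δ)) ^ 9 *
              Real.sqrt ((2 * k) ^ p * Real.log (p / δ) ^ p * d ^ p * n)} ≤
          ENNReal.ofReal δ := by
  have θ₀ : Params := ⟨1, 0, fun _ => 0, fun _ => 0, fun _ => 1, fun _ => 1, fun _ => one_pos,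
    fun _ => one_pos, fun _ => le_rfl⟩
  by_cases hkd : k ≤ d
  swap
  · exact ⟨θ₀, 1, one_pos, fun T => absurd (T.le_dim (by omega)) hkd⟩
  rcases Nat.eq_zero_or_pos n with rfl | hn
  · refine ⟨θ₀, 1, one_pos, fun T Ω _ _ P _ ξ η h => ?_⟩
    simp [regret]
  have hk : 0 < k := Nat.pos_of_ne_zero (NeZero.ne k)
  have hk1 : (1 : ℝ) ≤ k := by exact_mod_cast hk
  have hd1 : (1 : ℝ) ≤ d := by exact_mod_cast hk.trans_le hkd
  have hn1 : (1 : ℝ) ≤ n := by exact_mod_cast hn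
  have hp3 : (3 : ℝ) ≤ p := by exact_mod_cast hp
  have hpδ : (p : ℝ) ≤ p / δ := le_div_self (by positivity) hδ hδ1.le
  have hlogp : 1 ≤ Real.log (p / δ) := by
    rw [Real.le_log_iff_exp_le (by positivity)]
    linarith [Real.exp_one_lt_d9]
  have hdn : 1 ≤ (d : ℝ) * n := one_le_mul_of_one_le_of_one_le hd1 hn1
  have hQ : 1 ≤ d * n / δ := hdn.trans (le_div_self (by positivity) hδ hδ1.le)
  have hx : 1 ≤ 1 + Real.log (d * n / δ) := by linarith [Real.log_nonneg hQ]
  have hA1 : 1 ≤ (2 * k : ℝ) ^ p * Real.log (p / δ) ^ p * d ^ p :=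
    one_le_mul_of_one_le_of_one_le (one_le_mul_of_one_le_of_one_le (one_le_pow₀ (by linarith))
      (one_le_pow₀ hlogp)) (one_le_pow₀ hd1)
  have h60 : (60 * k : ℝ) ^ p ≤ K * ((2 * k : ℝ) ^ p * Real.log (p / δ) ^ p * d ^ p) := by
    rw [show (60 * k : ℝ) = 30 * (2 * k) by ring, mul_pow]
    have h30 : (30 : ℝ) ^ p ≤ 19200 ^ p := by gcongr; norm_num
    calc (30 : ℝ) ^ p * (2 * k) ^ p ≤ (K * Real.log (p / δ) ^ p) * (2 * k) ^ p * d ^ p := by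
          refine le_trans ?_ (le_mul_of_one_le_right (by positivity) (one_le_pow₀ hd1))
          gcongr
          exact h30.trans hK
      _ = _ := by ring
  have h19200 : (60 * k : ℝ) ^ p * (640 * d) ^ p ≤
      K * ((2 * k : ℝ) ^ p * Real.log (p / δ) ^ p * d ^ p) := by
    rw [← mul_pow, show (60 * k * (640 * d) : ℝ) = 19200 * ((2 * k) * d) by ring,
      mul_pow 19200, mul_pow (2 * (k : ℝ))]
    calc (19200 : ℝ) ^ p * ((2 * k) ^ p * d ^ p) ≤
          (K * Real.log (p / δ) ^ p) * ((2 * k) ^ p * d ^ p) := by gcongr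
      _ = _ := by ring
  set A := (2 * k : ℝ) ^ p * Real.log (p / δ) ^ p * d ^ p with hAdef
  set Q := d * n / δ with hQdef
  set x := 1 + Real.log Q with hxdef
  have hy1 : 1 ≤ p * x := one_le_mul_of_one_le_of_one_le (by linarith) hx
  have hyK : 1 ≤ (p * x) ^ 9 * K := one_le_mul_of_one_le_of_one_le (one_le_pow₀ hy1) hK1
  set s := Real.sqrt (A * n) with hs
  have hs0 : 0 < s := Real.sqrt_pos.2 (by positivity)
  have hssq : s ^ 2 = A * n := Real.sq_sqrt (by positivity)
  have e : 10 ^ 16 * K * p ^ 9 * x ^ 9 * s = 10 ^ 16 * ((p * x) ^ 9 * K) * s := by ring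
  rw [e]
  -- For short horizons the trivial regret `2 lam n ≤ 2 s` is already within the bound, whatever the
  -- algorithm does; for long ones `s / n < lam` is an admissible accuracy.
  rcases le_or_gt (lam * n) s with hcase | hcase
  · refine ⟨θ₀, 1, one_pos, fun T Ω _ _ P _ ξ η h => ?_⟩
    have : {ω | ¬ regret (banditAlg d p lam θ₀ 1 n) T.reward (ξ · ω) (η · ω) n ≤
        10 ^ 16 * ((p * x) ^ 9 * K) * s} = ∅ := by
      refine Set.eq_empty_of_forall_notMem fun ω hω => hω ?_
      refine (T.regret_le (by omega) hlam _ _ _ n).trans ?_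
      have h1 : 1 * s ≤ (p * x) ^ 9 * K * s := by gcongr
      nlinarith
    rw [this, measure_empty]
    exact zero_le
  · rw [hxdef]
    exact exists_params_regret_of_lt hp hkd hlam hlam1 hδ hδ1 hK1 hn hA1 h60 h19200 hs0 hssq hcase

end Bounds

end TensorBandit

end

theorem mainTheorem8 :
    ∃ (C : ℝ) (c : ℕ), 0 < C ∧
      ∀ (p d k : ℕ) [NeZero k] (lam δ : ℝ), 3 ≤ p → 0 < lam → lam ≤ 1 → 0 < δ → δ < 1 →
        -- the candidate set contains an `ε`-optimal action
        (∀ ε : ℝ, 0 < ε → ε < 1 → ∃ θ : Params,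
          ∀ (T : OrthTensor d p k lam) (Ω : Type*) [MeasurableSpace Ω] [StandardBorelSpace Ω]
            (P : Measure Ω) [IsProbabilityMeasure P] (ξ : ℕ → Ω → Vec d) (η : ℕ → Ω → ℝ),
            IsBanditRandomness P ξ η →
            P {ω | ¬ ∃ a ∈ (phasedElimination d p lam θ).output T.reward (ξ · ω) (η · ω),
                optReward T.reward - ε ≤ T.reward a} ≤ ENNReal.ofReal δ ∧
            ∀ ω,
              (((phasedElimination d p lam θ).actions T.reward (ξ · ω) (η · ω)).length : ℝ) ≤
                C * p ^ c * (1 + Real.log (d / (ε * δ))) ^ c *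
                  ((2 * k) ^ p * Real.log (p / δ) ^ p * d ^ p * lam⁻¹ * ε⁻¹) ∧
              (((phasedElimination d p lam θ).output T.reward (ξ · ω) (η · ω)).length : ℝ) ≤
                C * p ^ c * (1 + Real.log (d / (ε * δ))) ^ c *
                  ((2 * k) ^ p * Real.log (p / δ) ^ p)) ∧
        -- the regret of phased elimination followed by UCB on the candidate set
        (∀ n : ℕ, ∃ (θ : Params) (b : ℝ), 0 < b ∧
          ∀ (T : OrthTensor d p k lam) (Ω : Type*) [MeasurableSpace Ω] [StandardBorelSpace Ω]
            (P : Measure Ω) [IsProbabilityMeasure P] (ξ : ℕ → Ω → Vec d) (η : ℕ → Ω → ℝ),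
            IsBanditRandomness P ξ η →
            P {ω | ¬ regret (banditAlg d p lam θ b n) T.reward (ξ · ω) (η · ω) n ≤
                C * p ^ c * (1 + Real.log (d * n / δ)) ^ c *
                  Real.sqrt ((2 * k) ^ p * Real.log (p / δ) ^ p * d ^ p * n)} ≤
              ENNReal.ofReal δ) := by
  -- The base `19200 = 60 · 640 / 2` collects the constants of the initialization and the sample
  -- size, relative to `(2 k) ^ p d ^ p`.
  obtain ⟨K, hK1, hK⟩ := exists_pow_le_mul_log_pow (A := 19200) (by norm_num)
  -- The exponent `9` is four powers of the logarithmic factor from the candidates, sweeps and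
  -- slots, plus five from the sample size.
  refine ⟨10 ^ 16 * K, 9, by positivity, fun p d k _ lam δ hp hlam hlam1 hδ hδ1 => ⟨?_, ?_⟩⟩
  · exact fun ε hε hε1 =>
      exists_params_candidates hp hlam hlam1 hδ hδ1 hK1 (hK p δ hp hδ hδ1) hε hε1
  · exact exists_params_regret hp hlam hlam1 hδ hδ1 hK1 (hK p δ hp hδ hδ1)
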